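/- Let $n\ge 2$ and let $\gamma:\mathbb S^1\to\mathbb{RP}^{n-1}$ be a smooth closed curve. Call $\gamma$ *convex* if, for every hyperplane $H\subset\mathbb{RP}^{n-1}$, the sum over all points $z\in\mathbb S^1$ of the local multiplicities of the intersection of $\gamma$ with $H$ at $z$ is at most $n-1$; here the local multiplicity at $z$ is the order of vanishing at $z$ of $\ell\circ f$, where $f$ is a smooth local lift of $\gamma$ to $\mathbb R^n\setminus\{0\}$ and $\ell$ is a linear form defining $H$. The *standard discriminant* $D_\gamma\subset\mathbb{RP}^{n-1}$ is the union over $z\in\mathbb S^1$ of the codimension-$2$ projective subspaces osculating $\gamma$, i.e. of the projectivizations of $\operatorname{span}\{f(z),f'(z),\dots,f^{(n-3)}(z)\}$ (for $n=2$ it is empty). The *$\mathbb R$-degree* of a hypersurface $\mathcal H\subset\mathbb{RP}^{n-1}$ is the supremum of the cardinality of $\mathcal H\cap L$ over all projective lines $L\subset\mathbb{RP}^{n-1}$ that intersect $\mathcal H$ transversally, i.e. such that near every point of $\mathcal H\cap L$ the set $\mathcal H$ is a smooth hypersurface whose tangent hyperplane there does not contain $L$. Then, for every convex closed curve $\gamma:\mathbb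 S^1\to\mathbb{RP}^{n-1}$, the $\mathbb R$-degree of $D_\gamma$ equals $2n-4$. -/

import Mathlib

open scoped LinearAlgebra.Projectivization ContDiff Topology

namespace ProjCurve

/-- Real projective space `ℝP^{n-1}`, the space of lines through the origin of `ℝ^n`. -/
abbrev RP (n : ℕ) : Type := ℙ ℝ (Fin n → ℝ)

/-- `f` is a smooth lift to `ℝ^n \ {0}`, near the parameter `t`, of the curve
`s ↦ γ (exp (i s))` in projective space. -/
def IsLocalLift {n : ℕ} (γ : Circle → RP n) (t : ℝ) (f : ℝ → Fin n → ℝ) : Prop :=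
  ContDiffAt ℝ ∞ f t ∧
    ∀ᶠ s in 𝓝 t, ∃ h : f s ≠ 0, γ (Circle.exp s) = Projectivization.mk ℝ (f s) h

/-- A closed curve in projective space is smooth if it has a smooth local lift to `ℝ^n \ {0}`
near every point. -/
def IsSmooth {n : ℕ} (γ : Circle → RP n) : Prop :=
  ∀ t : ℝ, ∃ f : ℝ → Fin n → ℝ, IsLocalLift γ t f

/-- The order of vanishing of a smooth function `g` at `t`: the least `m` with
`g^{(m)}(t) ≠ 0`, and `∞` if there is none. -/
noncomputable def vanishingOrder (g : ℝ → ℝ) (t : ℝ) : ℕ∞ :=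
  ⨅ (m : ℕ) (_ : iteratedDeriv m g t ≠ 0), (m : ℕ∞)

/-- The local multiplicity, at the point `z` of the circle, of the intersection of `γ` with the
hyperplane `ℓ = 0`: the order of vanishing of `ℓ ∘ f` for a smooth local lift `f` of `γ`
(all lifts give the same value, which is `0` when `γ z` is not on the hyperplane). -/
noncomputable def multiplicity {n : ℕ} (γ : Circle → RP n) (ℓ : (Fin n → ℝ) →L[ℝ] ℝ)
    (z : Circle) : ℕ∞ :=
  ⨆ (t : ℝ) (_ : Circle.exp t = z) (f : ℝ → Fin n → ℝ) (_ : IsLocalLift γ t f),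
    vanishingOrder (fun s => ℓ (f s)) t

/-- A closed curve in `ℝP^{n-1}` is (globally) convex if it is smooth and, for every hyperplane,
the sum of all local multiplicities of its intersection with the curve is at most `n - 1`.
The possibly infinite sum of elements of `ℕ∞` is bounded through all its finite partial sums. -/
def IsConvex {n : ℕ} (γ : Circle → RP n) : Prop :=
  IsSmooth γ ∧ ∀ ℓ : (Fin n → ℝ) →L[ℝ] ℝ, ℓ ≠ 0 →
    ∀ s : Finset Circle, ∑ z ∈ s, multiplicity γ ℓ z ≤ ((n - 1 : ℕ) : ℕ∞)

/-- The linear subspace of `ℝ^n` underlying the osculating `(k-1)`-dimensional projective subspace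
of `γ` at `z`: it is spanned by `f, f', …, f^{(k-1)}` for a smooth local lift `f` of `γ`
(all lifts give the same span). -/
def osculating {n : ℕ} (γ : Circle → RP n) (k : ℕ) (z : Circle) : Submodule ℝ (Fin n → ℝ) :=
  ⨆ (t : ℝ) (_ : Circle.exp t = z) (f : ℝ → Fin n → ℝ) (_ : IsLocalLift γ t f),
    Submodule.span ℝ {v | ∃ i < k, v = iteratedDeriv i f t}

/-- The standard discriminant `D_γ` of a closed curve in `ℝP^{n-1}`: the union of the osculating
projective subspaces of codimension 2, that is, of linear dimension `n - 2`. -/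
def discriminant {n : ℕ} (γ : Circle → RP n) : Set (RP n) :=
  {p | ∃ z : Circle, p.submodule ≤ osculating γ (n - 2) z}

/-- The set of points of the projective subspace given by a linear subspace `W`. -/
def points {n : ℕ} (W : Submodule ℝ (Fin n → ℝ)) : Set (RP n) :=
  {p | p.submodule ≤ W}

/-- The projective line given by the plane `W` crosses `𝓗` transversally at the point `[v]`, where
`v ∈ W`: in homogeneous coordinates near `v`, the set `𝓗` is a smooth hypersurface `g = 0` with
nonzero differential, and `W` is not contained in the tangent hyperplane `ker (dg v)`.
(As `g` vanishes along the ray of `v`, the kernel of `dg v` contains `v`.) -/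
def IsTransversalAt {n : ℕ} (W : Submodule ℝ (Fin n → ℝ)) (𝓗 : Set (RP n))
    (v : Fin n → ℝ) : Prop :=
  ∃ (U : Set (Fin n → ℝ)) (g : (Fin n → ℝ) → ℝ), IsOpen U ∧ v ∈ U ∧ ContDiffOn ℝ ∞ g U ∧
    (∀ (x : Fin n → ℝ) (hx : x ≠ 0), x ∈ U → (Projectivization.mk ℝ x hx ∈ 𝓗 ↔ g x = 0)) ∧
    ∃ w ∈ W, fderiv ℝ g v w ≠ 0

/-- The projective line given by the plane `W` intersects `𝓗` transversally: every common point is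
a point where `𝓗` is a smooth hypersurface, not tangent to the line. -/
def IsTransversal {n : ℕ} (W : Submodule ℝ (Fin n → ℝ)) (𝓗 : Set (RP n)) : Prop :=
  ∀ (v : Fin n → ℝ) (hv : v ≠ 0), v ∈ W → Projectivization.mk ℝ v hv ∈ 𝓗 →
    IsTransversalAt W 𝓗 v

/-- The `ℝ`-degree of a hypersurface in `ℝP^{n-1}`: the supremum of the number of its intersection
points with a projective line, over all projective lines that intersect it transversally. -/
noncomputable def realDegree {n : ℕ} (𝓗 : Set (RP n)) : ℕ∞ :=
  ⨆ (W : Submodule ℝ (Fin n → ℝ)) (_ : Module.finrank ℝ W = 2) (_ : IsTransversal W 𝓗),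
    (𝓗 ∩ points W).encard

end ProjCurve

/-! Remove a point `exp (i θ)` from the circle. On the remaining arc a convex curve admits linear
forms `q 0, …, q (n-1)` with `q i' = β i • q (i+1)`, `β i > 0` and `q n = 0`, such that the
osculating space of codimension `m` at `t` is the common kernel of `q 0 t, …, q (m-1) t` (`Chart`,
`IsConvex.nonempty_chart`). For a plane spanned by `x, y` put `V i = (q i x, q i y)`, a curve in the
Euclidean plane. Then `V i' = β i V (i+1)`, the curve `V (n-1)` is constant, and the plane meets the
osculating space of codimension two at `t` exactly when `area (V 0) (V 1)` vanishes there.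

Upper bound. Each `V i` is pushed towards `V (i+1)`, so its direction chases the next one and turns
left or right according to the sign of `area (V i) (V (i+1))`. The last direction is fixed, and each
further link of the chain allows at most two more reversals, so `area (V 0) (V 1)` changes sign at
most `2 (n-2)` times (`changes_chase_le`, `discrete_chain_le`, `continuous_chain_le`). A transversal
line need not produce simple zeros of this area. However, transversal intersection points survive
small perturbations (`IsTransversalAt.eventually`), and a generic plane has only simple zeros
(`IsConvex.dense_generic`), each of which is a sign change (`Chart.card_le`, `IsConvex.encard_le`).

Lower bound. A plane of vectors on which `q 0` vanishes at `n-2` prescribed points gives double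
zeros of the area there. A suitable perturbation splits each of them into two zeros. A nonzero
vector has fewer than `n` zeros of `q 0` with multiplicity (`IsConvex.eq_zero_of_mem_osculating`,
from Rolle's theorem), which keeps the plane away from the singular points of the discriminant. The
implicit function theorem then gives transversality (`IsConvex.isTransversalAt`,
`IsConvex.exists_transversal`). -/

namespace ProjCurve

/-! ### Turn counters for followers moving on a line. -/

/-- Record an upward move by `δ` in the turn counter `(A, B)`. -/
noncomputable def moveUp (δ : ℝ) (S : ℝ × ℝ) : ℝ × ℝ := (S.1 + δ, (⌊S.1 + δ⌋ : ℝ))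

/-- Record a downward move by `δ` in the turn counter `(A, B)`. -/
noncomputable def moveDown (δ : ℝ) (S : ℝ × ℝ) : ℝ × ℝ := ((⌊S.2 + δ⌋ : ℝ) + 1, S.2 + δ)

/-- The states of the turn counter: the last move went up or down. -/
def IsCounter (S : ℝ × ℝ) : Prop := S.2 = ⌊S.1⌋ ∨ S.1 = ⌊S.2⌋ + 1

/-- The counter of a follower at distance `Z` behind its leader exceeds the leader's counter by at
most one, even after the follower has completed its current move. -/
def CounterRel (Z : ℝ) (S S' : ℝ × ℝ) : Prop :=
  if Even ⌊Z⌋ then (moveUp (Int.fract Z) S).1 ≤ S'.1 + 1 ∧ (moveUp (Int.fract Z) S).2 ≤ S'.2 + 1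
  else (moveDown (1 - Int.fract Z) S).1 ≤ S'.1 + 1 ∧ (moveDown (1 - Int.fract Z) S).2 ≤ S'.2 + 1

lemma isCounter_moveUp (δ : ℝ) (S : ℝ × ℝ) : IsCounter (moveUp δ S) := Or.inl rfl

lemma isCounter_moveDown (δ : ℝ) (S : ℝ × ℝ) : IsCounter (moveDown δ S) := Or.inr rfl

lemma floor_fract_of {Z : ℝ} {m : ℤ} {f : ℝ} (h : Z = m + f) (h0 : 0 ≤ f) (h1 : f < 1) :
    ⌊Z⌋ = m ∧ Int.fract Z = f := by
  have : ⌊Z⌋ = m := Int.floor_eq_iff.2 ⟨by linarith, by linarith⟩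
  exact ⟨this, by rw [Int.fract, this]; linarith⟩

/-- With `IsCounter.fst_le_floor`, this says that no move lowers a component of the counter,
whichever direction the last move had. -/
lemma IsCounter.snd_le_floor {S : ℝ × ℝ} (h : IsCounter S) {f : ℝ} (hf : 0 ≤ f) :
    S.2 ≤ ⌊S.1 + f⌋ := by
  rcases h with h | h
  · rw [h]; exact_mod_cast Int.floor_mono (by linarith)
  · have h1 := Int.lt_floor_add_one S.2
    have : ((⌊S.2⌋ + 1 : ℤ) : ℝ) ≤ ⌊S.1 + f⌋ := by
      exact_mod_cast Int.le_floor.2 (by push_cast; linarith)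
    push_cast at this; linarith

lemma IsCounter.fst_le_floor {S : ℝ × ℝ} (h : IsCounter S) {f : ℝ} (hf : 0 ≤ f) :
    S.1 ≤ ⌊S.2 + f⌋ + 1 := by
  rcases h with h | h
  · have h1 := Int.lt_floor_add_one S.1
    have : ((⌊S.1⌋ : ℤ) : ℝ) ≤ ⌊S.2 + f⌋ := by
      exact_mod_cast Int.le_floor.2 (by linarith)
    linarith
  · rw [h]; have := Int.floor_mono (show S.2 ≤ S.2 + f by linarith)
    have : (⌊S.2⌋ : ℝ) ≤ ⌊S.2 + f⌋ := by exact_mod_cast this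
    linarith

/-- Completing the pending move of the follower can only raise its counter, so the bound after
completion holds before it too. -/
lemma CounterRel.le {Z : ℝ} {S S' : ℝ × ℝ} (h : CounterRel Z S S') (hS : IsCounter S) :
    S.1 ≤ S'.1 + 1 ∧ S.2 ≤ S'.2 + 1 := by
  have h0 := Int.fract_nonneg Z
  have h1 := Int.fract_lt_one Z
  unfold CounterRel moveUp moveDown at h
  split_ifs at h with he
  · exact ⟨by linarith [h.1], (hS.snd_le_floor h0).trans h.2⟩
  · exact ⟨(hS.fst_le_floor (by linarith)).trans h.1, by have := h.2; dsimp only at this; linarith⟩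

lemma counterRel_zero {Z : ℝ} (hZ : Int.fract Z ≠ 0) : CounterRel Z (0, 0) (0, 0) := by
  have h0 := Int.fract_nonneg Z
  have h1 := Int.fract_lt_one Z
  unfold CounterRel moveUp moveDown
  split_ifs with he
  · simp [h1.le]
  · have : ⌊1 - Int.fract Z⌋ = 0 := Int.floor_eq_iff.2 ⟨by push_cast; linarith,
      by push_cast; linarith [h0.lt_of_ne' hZ]⟩
    simp [this]

lemma floor_le_floor_add {x y : ℝ} {k : ℤ} (h : x ≤ y + k) : (⌊x⌋ : ℝ) ≤ ⌊y⌋ + k := by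
  have := Int.floor_mono h
  rw [Int.floor_add_intCast] at this
  exact_mod_cast this

lemma floor_le_floor_add_one {x y : ℝ} (h : x ≤ y + 1) : (⌊x⌋ : ℝ) ≤ ⌊y⌋ + 1 := by
  simpa using floor_le_floor_add (k := 1) (by simpa using h)

lemma int_le_floor {m : ℤ} {y : ℝ} (h : (m : ℝ) ≤ y) : (m : ℝ) ≤ ⌊y⌋ := by
  exact_mod_cast Int.le_floor.2 h

lemma counterRel_iff_even {Z : ℝ} {m : ℤ} {f : ℝ} (h : Z = m + f) (h0 : 0 ≤ f) (h1 : f < 1)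
    (hm : Even m) {S S' : ℝ × ℝ} :
    CounterRel Z S S' ↔ S.1 + f ≤ S'.1 + 1 ∧ (⌊S.1 + f⌋ : ℝ) ≤ S'.2 + 1 := by
  obtain ⟨h2, h3⟩ := floor_fract_of h h0 h1
  rw [CounterRel, h2, h3, if_pos hm]; rfl

lemma counterRel_iff_odd {Z : ℝ} {m : ℤ} {f : ℝ} (h : Z = m + f) (h0 : 0 ≤ f) (h1 : f < 1)
    (hm : ¬ Even m) {S S' : ℝ × ℝ} :
    CounterRel Z S S' ↔ (⌊S.2 + (1 - f)⌋ : ℝ) + 1 ≤ S'.1 + 1 ∧ S.2 + (1 - f) ≤ S'.2 + 1 := by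
  obtain ⟨h2, h3⟩ := floor_fract_of h h0 h1
  rw [CounterRel, h2, h3, if_neg hm]; rfl

/-- The split is on whether the distance crosses an integer. If it does not, the follower keeps its
direction: a pending upward move grows by the same `δ` as the leader's counter, and a pending
downward one shrinks. If it does, the follower has to reverse. When it was heading up, crossing
needs `δ > 1 - f`, which improves `S.1 + f ≤ S'.1 + 1` to `S.1 < S'.1 + δ`; the slack of one
regained in this way pays for the reversal. -/
lemma CounterRel.leader_up {Z δ : ℝ} {S S' : ℝ × ℝ} (h : CounterRel Z S S') (hS : IsCounter S)
    (hS' : IsCounter S') (hδ0 : 0 ≤ δ) (hδ1 : δ < 1) (hZ' : Int.fract (Z + δ) ≠ 0) :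
    CounterRel (Z + δ) S (moveUp δ S') := by
  have f0 := Int.fract_nonneg Z
  have f1 := Int.fract_lt_one Z
  have hZm : Z = ⌊Z⌋ + Int.fract Z := (Int.floor_add_fract Z).symm
  set m := ⌊Z⌋
  set f := Int.fract Z
  rcases lt_or_ge (f + δ) 1 with hlt | hge
  · have e : Z + δ = m + (f + δ) := by linarith
    by_cases hm : Even m
    · rw [counterRel_iff_even hZm f0 f1 hm] at h
      rw [counterRel_iff_even e (by linarith) hlt hm]
      refine ⟨by simp only [moveUp]; linarith, ?_⟩
      exact floor_le_floor_add_one (by linarith)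
    · rw [counterRel_iff_odd hZm f0 f1 hm] at h
      rw [counterRel_iff_odd e (by linarith) hlt hm]
      have h3 := floor_le_floor_add (x := S.2 + (1 - (f + δ))) (y := S.2 + (1 - f)) (k := 0)
        (by push_cast; linarith)
      have h4 := hS'.snd_le_floor hδ0
      refine ⟨?_, ?_⟩ <;> simp only [moveUp] <;> push_cast at h3 <;> linarith
  · have e : Z + δ = (m + 1 : ℤ) + (f + δ - 1) := by push_cast; linarith
    have hgt : 1 < f + δ := by
      refine lt_of_le_of_ne hge fun h1 => hZ' ?_
      rw [(floor_fract_of e (by linarith) (by linarith)).2]; linarith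
    by_cases hm : Even m
    · have hm' : ¬ Even (m + 1) := by simpa [Int.even_add_one] using hm
      rw [counterRel_iff_even hZm f0 f1 hm] at h
      rw [counterRel_iff_odd e (by linarith) (by linarith) hm']
      simp only [moveUp]
      rcases hS with hS | hS
      · have h5 : (⌊S.1⌋ : ℝ) ≤ ⌊S'.1 + δ⌋ := by
          apply int_le_floor; linarith [Int.floor_le S.1]
        have h6 : ⌊S.2 + (1 - (f + δ - 1))⌋ = ⌊S.1⌋ := by
          rw [hS]; exact Int.floor_eq_iff.2 ⟨by linarith, by linarith⟩
        rw [h6]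
        have := Int.floor_le (S'.1 + δ)
        constructor <;> linarith
      · have h5 : ((⌊S.2⌋ + 1 : ℤ) : ℝ) ≤ ⌊S'.1 + δ⌋ := by
          apply int_le_floor; push_cast; linarith
        push_cast at h5
        have h6 := floor_le_floor_add_one (x := S.2 + (1 - (f + δ - 1))) (y := S.2) (by linarith)
        have := Int.floor_le (S'.1 + δ)
        have := Int.lt_floor_add_one S.2
        constructor <;> linarith
    · have hm' : Even (m + 1) := by simpa [Int.even_add_one] using hm
      rw [counterRel_iff_odd hZm f0 f1 hm] at h
      rw [counterRel_iff_even e (by linarith) (by linarith) hm']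
      simp only [moveUp]
      have h5 := hS.fst_le_floor (f := 1 - f) (by linarith)
      exact ⟨by linarith, floor_le_floor_add_one (by linarith)⟩

/-- Mirror image of `CounterRel.leader_up`. The floor includes only the left end of its interval, so
here the initial distance, not the final one, has to avoid the integers. -/
lemma CounterRel.leader_down {Z δ : ℝ} {S S' : ℝ × ℝ} (h : CounterRel Z S S') (hS : IsCounter S)
    (hS' : IsCounter S') (hδ0 : 0 ≤ δ) (hδ1 : δ < 1) (hZ : Int.fract Z ≠ 0) :
    CounterRel (Z - δ) S (moveDown δ S') := by
  have f0 := (Int.fract_nonneg Z).lt_of_ne' hZ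
  have f1 := Int.fract_lt_one Z
  have hZm : Z = ⌊Z⌋ + Int.fract Z := (Int.floor_add_fract Z).symm
  set m := ⌊Z⌋
  set f := Int.fract Z
  rcases le_or_gt δ f with hlt | hge
  · have e : Z - δ = m + (f - δ) := by linarith
    by_cases hm : Even m
    · rw [counterRel_iff_even hZm f0.le f1 hm] at h
      rw [counterRel_iff_even e (by linarith) (by linarith) hm]
      have h3 := floor_le_floor_add (x := S.1 + (f - δ)) (y := S.1 + f) (k := 0)
        (by push_cast; linarith)
      have h4 := hS'.fst_le_floor hδ0
      refine ⟨?_, ?_⟩ <;> simp only [moveDown] <;> push_cast at h3 <;> linarith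
    · rw [counterRel_iff_odd hZm f0.le f1 hm] at h
      rw [counterRel_iff_odd e (by linarith) (by linarith) hm]
      have := floor_le_floor_add_one (x := S.2 + (1 - (f - δ))) (y := S'.2 + δ) (by linarith)
      simp only [moveDown]
      exact ⟨by linarith, by linarith⟩
  · have e : Z - δ = (m - 1 : ℤ) + (1 + f - δ) := by push_cast; linarith
    by_cases hm : Even m
    · have hm' : ¬ Even (m - 1) := by simpa [Int.even_sub_one] using hm
      rw [counterRel_iff_even hZm f0.le f1 hm] at h
      rw [counterRel_iff_odd e (by linarith) (by linarith) hm']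
      simp only [moveDown]
      have h5 := hS.snd_le_floor (f := f) (by linarith)
      have := floor_le_floor_add_one (x := S.2 + (1 - (1 + f - δ))) (y := S'.2 + δ) (by linarith)
      exact ⟨by linarith, by linarith⟩
    · have hm' : Even (m - 1) := by simpa [Int.even_sub_one] using hm
      rw [counterRel_iff_odd hZm f0.le f1 hm] at h
      rw [counterRel_iff_even e (by linarith) (by linarith) hm']
      simp only [moveDown]
      rcases hS with hS | hS
      · have h5 : (⌊S.1⌋ : ℝ) ≤ ⌊S'.2 + δ⌋ := by
          apply int_le_floor; linarith
        have h6 := floor_le_floor_add_one (x := S.1 + (1 + f - δ)) (y := S.1) (by linarith)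
        have := Int.floor_le (S'.2 + δ)
        have := Int.lt_floor_add_one S.1
        constructor <;> linarith
      · have h5 : (⌊S.2⌋ : ℝ) ≤ ⌊S'.2 + δ⌋ := by
          apply int_le_floor; linarith [Int.floor_le S.2]
        have h6 : ⌊S.1 + (1 + f - δ)⌋ = ⌊S.2⌋ + 1 := by
          rw [hS]; exact Int.floor_eq_iff.2 ⟨by push_cast; linarith, by push_cast; linarith⟩
        rw [h6]
        have := Int.floor_le (S'.2 + δ)
        push_cast
        constructor <;> linarith

/-- The counter after a move of a follower at distance `Z` behind its leader from `x` to `y`: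
followers move up when `⌊Z⌋` is even and down when it is odd. -/
noncomputable def counterStep (Z x y : ℝ) (S : ℝ × ℝ) : ℝ × ℝ :=
  if Even ⌊Z⌋ then moveUp (y - x) S else moveDown (x - y) S

/-- A follower at distance `Z` behind its leader may move from `x` to `y`. -/
def IsChase (Z x y : ℝ) : Prop :=
  if Even ⌊Z⌋ then x ≤ y ∧ y - x < Int.fract Z else y ≤ x ∧ x - y < 1 - Int.fract Z

lemma isCounter_counterStep (Z x y : ℝ) (S : ℝ × ℝ) : IsCounter (counterStep Z x y S) := by
  unfold counterStep; split_ifs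
  exacts [isCounter_moveUp _ _, isCounter_moveDown _ _]

/-- A follower stops short of the integer distance it is heading for, so its direction can be
reversed only by a move of its leader. -/
lemma IsChase.floor_eq {Z x y : ℝ} (h : IsChase Z x y) : ⌊Z - (y - x)⌋ = ⌊Z⌋ := by
  have f0 := Int.fract_nonneg Z
  have f1 := Int.fract_lt_one Z
  have hZm : Z = ⌊Z⌋ + Int.fract Z := (Int.floor_add_fract Z).symm
  unfold IsChase at h
  apply Int.floor_eq_iff.2
  split_ifs at h <;> constructor <;> linarith

/-- What the follower moves is subtracted from its pending move, so its counter after completion is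
unchanged. -/
lemma CounterRel.follower {Z x y : ℝ} {S S' : ℝ × ℝ} (h : CounterRel Z S S')
    (hc : IsChase Z x y) : CounterRel (Z - (y - x)) (counterStep Z x y S) S' := by
  have e := hc.floor_eq
  have e2 : Int.fract (Z - (y - x)) = Int.fract Z - (y - x) := by
    rw [Int.fract, e, Int.fract]; ring
  unfold CounterRel counterStep at *
  rw [e, e2]
  split_ifs at h ⊢ with hm
  · simp only [moveUp] at h ⊢
    rwa [show S.1 + (y - x) + (Int.fract Z - (y - x)) = S.1 + Int.fract Z by ring]
  · simp only [moveDown] at h ⊢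
    rwa [show S.2 + (x - y) + (1 - (Int.fract Z - (y - x))) = S.2 + (1 - Int.fract Z) by ring]

lemma CounterRel.leader {Z Z' x y : ℝ} {S S' : ℝ × ℝ} (h : CounterRel Z S S')
    (hS : IsCounter S) (hS' : IsCounter S') (hZ : Int.fract Z ≠ 0)
    (hZ' : Int.fract (Z + (y - x)) ≠ 0) (hc : IsChase Z' x y) :
    CounterRel (Z + (y - x)) S (counterStep Z' x y S') := by
  have f0 := Int.fract_nonneg Z'
  have f1 := Int.fract_lt_one Z'
  unfold IsChase counterStep at *
  split_ifs at hc ⊢ with hm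
  · exact h.leader_up hS hS' (by linarith) (by linarith) hZ'
  · have := h.leader_down hS hS' (δ := x - y) (by linarith) (by linarith) hZ
    convert this using 1; ring

/-! ### Turns in a chain of followers. -/

/-- The number of changes of a sequence of truth values up to time `k`. -/
noncomputable def changes (p : ℕ → Prop) : ℕ → ℕ
  | 0 => 0
  | k + 1 => changes p k + (by classical exact if (p (k + 1) ↔ p k) then 0 else 1)

/-- The counters of a chain of followers with positions `X k i` at time `k`. -/
noncomputable def counters (n : ℕ) (X : ℕ → ℕ → ℝ) : ℕ → ℕ → ℝ × ℝ
  | 0, _ => (0, 0)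
  | k + 1, i => if i + 1 < n then
      counterStep (X k (i + 1) - X k i) (X k i) (X (k + 1) i) (counters n X k i) else (0, 0)

section Chase

variable {n : ℕ} {X : ℕ → ℕ → ℝ}

lemma isCounter_counters (k i : ℕ) : IsCounter (counters n X k i) := by
  cases k with
  | zero => left; simp [counters]
  | succ k =>
    rw [counters]; split_ifs
    · exact isCounter_counterStep _ _ _ _
    · left; simp

lemma counters_last (k : ℕ) : counters n X k (n - 1) = (0, 0) := by
  cases k with
  | zero => rfl
  | succ k => rw [counters, if_neg (by omega)]

lemma counterRel_counters (hne : ∀ k i, i + 1 < n → Int.fract (X k (i + 1) - X k i) ≠ 0)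
    (hc : ∀ k i, i + 1 < n → IsChase (X k (i + 1) - X k i) (X k i) (X (k + 1) i))
    (hlast : ∀ k, X (k + 1) (n - 1) = X k (n - 1)) (k i : ℕ) (hi : i + 1 < n) :
    CounterRel (X k (i + 1) - X k i) (counters n X k i) (counters n X k (i + 1)) := by
  induction k generalizing i with
  | zero => exact counterRel_zero (hne 0 i hi)
  | succ k ih =>
    -- The simultaneous step is performed in two halves: the follower moves while its leader stands
    -- still, then the leader moves.
    have h1 := (ih i hi).follower (hc k i hi)
    have h2 : counters n X (k + 1) i = counterStep (X k (i + 1) - X k i) (X k i) (X (k + 1) i)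
        (counters n X k i) := by rw [counters, if_pos hi]
    rw [← h2] at h1
    have e : X (k + 1) (i + 1) - X (k + 1) i = X k (i + 1) - X k i - (X (k + 1) i - X k i)
      + (X (k + 1) (i + 1) - X k (i + 1)) := by ring
    by_cases hi' : i + 1 + 1 < n
    · have h3 := h1.leader (isCounter_counters _ _) (isCounter_counters _ _) (x := X k (i + 1))
        (y := X (k + 1) (i + 1)) (Z' := X k (i + 1 + 1) - X k (i + 1)) ?_ ?_ (hc k (i + 1) hi')
      · rw [e]
        rwa [show counters n X (k + 1) (i + 1) = counterStep (X k (i + 1 + 1) - X k (i + 1))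
          (X k (i + 1)) (X (k + 1) (i + 1)) (counters n X k (i + 1)) by
            rw [counters, if_pos hi']]
      · have hz := hne k i hi
        have hf := (hc k i hi).floor_eq
        intro h0
        rw [Int.fract, hf] at h0
        have h4 := hc k i hi
        have f0 := Int.fract_nonneg (X k (i + 1) - X k i)
        unfold IsChase at h4
        have h5 : Int.fract (X k (i + 1) - X k i) = X k (i + 1) - X k i - ⌊X k (i + 1) - X k i⌋ :=
          rfl
        have := f0.lt_of_ne' hz
        split_ifs at h4 <;> linarith
      · rw [← e]; exact hne (k + 1) i hi
    · obtain rfl : n = i + 2 := by omega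
      have h4 := counters_last (n := i + 2) (X := X) k
      have h5 := counters_last (n := i + 2) (X := X) (k + 1)
      have h6 := hlast k
      simp only [show i + 2 - 1 = i + 1 by omega] at h4 h5 h6
      rw [e, h5, ← h4, h6]
      simpa using h1

lemma counters_le (hne : ∀ k i, i + 1 < n → Int.fract (X k (i + 1) - X k i) ≠ 0)
    (hc : ∀ k i, i + 1 < n → IsChase (X k (i + 1) - X k i) (X k i) (X (k + 1) i))
    (hlast : ∀ k, X (k + 1) (n - 1) = X k (n - 1)) (k i : ℕ) (hi : i + 1 < n) :
    (counters n X k 0).1 ≤ (counters n X k i).1 + i ∧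
      (counters n X k 0).2 ≤ (counters n X k i).2 + i := by
  induction i with
  | zero => simp
  | succ i ih =>
    have h1 := ih (by omega)
    have h2 := (counterRel_counters hne hc hlast k i (by omega)).le (isCounter_counters _ _)
    push_cast
    constructor <;> linarith [h1.1, h1.2, h2.1, h2.2]

/-- **Chains of followers.** If the last follower moves up, the first one turns at most
`2 (n - 2)` times. -/
theorem changes_chase_le (hn : 2 ≤ n)
    (hne : ∀ k i, i + 1 < n → Int.fract (X k (i + 1) - X k i) ≠ 0)
    (hc : ∀ k i, i + 1 < n → IsChase (X k (i + 1) - X k i) (X k i) (X (k + 1) i))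
    (hlast : ∀ k, X (k + 1) (n - 1) = X k (n - 1))
    (h0 : Even ⌊X 0 (n - 1) - X 0 (n - 2)⌋) (k : ℕ) :
    changes (fun k => Even ⌊X k 1 - X k 0⌋) k ≤ 2 * (n - 2) := by
  obtain ⟨m, rfl⟩ : ∃ m, n = m + 2 := ⟨n - 2, by omega⟩
  simp only [show m + 2 - 1 = m + 1 by omega, show m + 2 - 2 = m by omega] at *
  -- The last position is fixed, so the follower next to it never reverses.
  have heven : ∀ k, Even ⌊X k (m + 1) - X k m⌋ := by
    intro k
    induction k with
    | zero => exact h0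
    | succ k ih =>
      have := (hc k m (by omega)).floor_eq
      rw [hlast, show X k (m + 1) - X (k + 1) m
        = X k (m + 1) - X k m - (X (k + 1) m - X k m) by ring, this]
      exact ih
  -- The bound by one holds even after adding the nonzero pending move, hence the strict inequality.
  -- This strictness makes the final count `2 m`.
  have hlt : ∀ k, (counters (m + 2) X k m).1 < 1 := by
    intro k
    have h1 := counterRel_counters hne hc hlast k m (by omega)
    have h2 := counters_last (n := m + 2) (X := X) k
    simp only [show m + 2 - 1 = m + 1 by omega] at h2
    rw [CounterRel, if_pos (heven k), h2] at h1
    have h3 := (Int.fract_nonneg (X k (m + 1) - X k m)).lt_of_ne' (hne k m (by omega))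
    have := h1.1
    simp only [moveUp] at this
    linarith
  have hA : ∀ k, (counters (m + 2) X k 0).1 < m + 1 := fun k => by
    have := (counters_le hne hc hlast k m (by omega)).1
    linarith [hlt k]
  -- Two turns raise the integer part by at least one: turning down restarts `B` from `⌊A⌋`, and
  -- turning up restarts `A` from `⌊B⌋ + 1`. The counter is read at time `k + 1`, after the move
  -- whose direction is determined at time `k`.
  have hinv : ∀ k, if Even ⌊X k 1 - X k 0⌋ then
      ((changes (fun k => Even ⌊X k 1 - X k 0⌋) k : ℕ) : ℤ) ≤ 2 * ⌊(counters (m + 2) X (k + 1) 0).1⌋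
      else ((changes (fun k => Even ⌊X k 1 - X k 0⌋) k : ℕ) : ℤ)
        ≤ 2 * ⌊(counters (m + 2) X (k + 1) 0).2⌋ + 1 := by
    intro k
    have hstep : ∀ k, counters (m + 2) X (k + 1) 0 = counterStep (X k 1 - X k 0) (X k 0)
      (X (k + 1) 0) (counters (m + 2) X k 0) := fun k => by rw [counters, if_pos (by omega)]
    induction k with
    | zero =>
      have h1 := hc 0 0 (by omega)
      rw [hstep]
      unfold IsChase at h1
      unfold counterStep
      split_ifs at h1 ⊢ with he
      · simp only [changes, moveUp, counters]
        have : 0 ≤ ⌊(0:ℝ) + (X (0 + 1) 0 - X 0 0)⌋ := Int.floor_nonneg.2 (by simp at h1 ⊢; linarith)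
        push_cast; linarith
      · simp only [changes, moveDown, counters]
        have : 0 ≤ ⌊(0:ℝ) + (X 0 0 - X (0 + 1) 0)⌋ := Int.floor_nonneg.2 (by simp at h1 ⊢; linarith)
        push_cast; linarith
    | succ k ih =>
      have h1 := hc (k + 1) 0 (by omega)
      have h2 : IsCounter (counters (m + 2) X (k + 1) 0) := isCounter_counters _ _
      have h3 := hstep k
      rw [hstep (k + 1)]
      unfold IsChase at h1
      simp only [changes, zero_add] at *
      set S := counters (m + 2) X (k + 1) 0
      unfold counterStep at h3 ⊢
      by_cases he : Even ⌊X (k + 1) 1 - X (k + 1) 0⌋ <;>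
        by_cases he' : Even ⌊X k 1 - X k 0⌋ <;>
        simp only [he, he', if_true, if_false, iff_self, iff_false, iff_true,
          not_true_eq_false, add_zero, moveUp, moveDown] at h1 h3 ih ⊢
      · have := Int.floor_mono (show S.1 ≤ S.1 + (X (k + 1 + 1) 0 - X (k + 1) 0) by linarith)
        linarith
      · have h4 : S.1 = ⌊S.2⌋ + 1 := by rw [h3]
        have : ⌊S.2⌋ + 1 ≤ ⌊S.1 + (X (k + 1 + 1) 0 - X (k + 1) 0)⌋ :=
          Int.le_floor.2 (by push_cast; linarith)
        push_cast
        linarith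
      · have h4 : S.2 = ⌊S.1⌋ := by rw [h3]
        have : ⌊S.1⌋ ≤ ⌊S.2 + (X (k + 1) 0 - X (k + 1 + 1) 0)⌋ :=
          Int.le_floor.2 (by linarith)
        push_cast
        linarith
      · have := Int.floor_mono (show S.2 ≤ S.2 + (X (k + 1) 0 - X (k + 1 + 1) 0) by linarith)
        linarith
  have h1 := hinv k
  have h2 := hA (k + 1)
  have h3 : counters (m + 2) X (k + 1) 0 = counterStep (X k 1 - X k 0) (X k 0)
      (X (k + 1) 0) (counters (m + 2) X k 0) := by rw [counters, if_pos (by omega)]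
  unfold counterStep at h3
  split_ifs at h1 h3
  · have : ⌊(counters (m + 2) X (k + 1) 0).1⌋ < (m : ℤ) + 1 := Int.floor_lt.2 (by push_cast; exact h2)
    omega
  · have h4 : (counters (m + 2) X (k + 1) 0).1 = ⌊(counters (m + 2) X (k + 1) 0).2⌋ + 1 := by
      rw [h3]; rfl
    rw [h4] at h2
    have : ⌊(counters (m + 2) X (k + 1) 0).2⌋ < (m : ℤ) := by
      have : (⌊(counters (m + 2) X (k + 1) 0).2⌋ : ℝ) < m := by linarith
      exact_mod_cast this
    omega

end Chase

/-! ### Plane vectors pushed towards one another, seen through their arguments. -/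

/-- The oriented area spanned by two plane vectors. -/
def area (c d : ℂ) : ℝ := c.re * d.im - c.im * d.re

lemma area_polar {c d : ℂ} {x y : ℝ} (hx : c = ‖c‖ * Complex.exp (Real.pi * x * Complex.I))
    (hy : d = ‖d‖ * Complex.exp (Real.pi * y * Complex.I)) :
    area c d = ‖c‖ * ‖d‖ * Real.sin (Real.pi * (y - x)) := by
  have h1 : ∀ (r z : ℝ), (r * Complex.exp (Real.pi * z * Complex.I)).re = r * Real.cos (Real.pi * z)
      ∧ (r * Complex.exp (Real.pi * z * Complex.I)).im = r * Real.sin (Real.pi * z) := by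
    intro r z
    rw [show ((Real.pi : ℂ) * z * Complex.I) = ((Real.pi * z : ℝ) : ℂ) * Complex.I by push_cast; ring]
    rw [Complex.re_ofReal_mul, Complex.im_ofReal_mul, Complex.exp_ofReal_mul_I_re,
      Complex.exp_ofReal_mul_I_im]
    exact ⟨rfl, rfl⟩
  have e1 : c.re = ‖c‖ * Real.cos (Real.pi * x) := by rw [← (h1 _ _).1, ← hx]
  have e2 : c.im = ‖c‖ * Real.sin (Real.pi * x) := by rw [← (h1 _ _).2, ← hx]
  have e3 : d.re = ‖d‖ * Real.cos (Real.pi * y) := by rw [← (h1 _ _).1, ← hy]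
  have e4 : d.im = ‖d‖ * Real.sin (Real.pi * y) := by rw [← (h1 _ _).2, ← hy]
  rw [area, e1, e2, e3, e4, mul_sub, Real.sin_sub]
  ring

lemma sin_pi_mul (Z : ℝ) :
    Real.sin (Real.pi * Z) = (-1 : ℝ) ^ ⌊Z⌋ * Real.sin (Real.pi * Int.fract Z) := by
  conv_lhs => rw [← Int.floor_add_fract Z]
  rw [mul_add, add_comm, mul_comm Real.pi (⌊Z⌋ : ℝ), Real.sin_add_int_mul_pi]

/-- Arguments are measured in units of `π`, so the sign of `sin (π (y - x))` is the parity of the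
floor. This is the parity that decides the direction of a follower. -/
lemma area_pos_iff {c d : ℂ} {x y : ℝ} (hx : c = ‖c‖ * Complex.exp (Real.pi * x * Complex.I))
    (hy : d = ‖d‖ * Complex.exp (Real.pi * y * Complex.I)) (h : area c d ≠ 0) :
    Int.fract (y - x) ≠ 0 ∧ (0 < area c d ↔ Even ⌊y - x⌋) := by
  rw [area_polar hx hy, sin_pi_mul] at *
  have h1 : Int.fract (y - x) ≠ 0 := by
    intro h0; simp [h0] at h
  refine ⟨h1, ?_⟩
  have f0 := (Int.fract_nonneg (y - x)).lt_of_ne' h1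
  have f1 := Int.fract_lt_one (y - x)
  have hs : 0 < Real.sin (Real.pi * Int.fract (y - x)) :=
    Real.sin_pos_of_pos_of_lt_pi (by positivity) (by nlinarith [Real.pi_pos])
  have hc : 0 < ‖c‖ * ‖d‖ := by
    refine lt_of_le_of_ne (by positivity) fun h0 => h ?_
    rw [← h0, zero_mul]
  by_cases he : Even ⌊y - x⌋
  · simp only [he.neg_one_zpow, one_mul, he, iff_true]; positivity
  · simp only [(Int.not_even_iff_odd.1 he).neg_one_zpow, he, iff_false, not_lt]
    have := mul_pos hc hs
    linarith

/-- After rotating by `-π x`, the vector `c + a d` becomes `w = ‖c‖ + a ‖d‖ exp (i π f)` with `0 < f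
< 1`. As `c ≠ 0`, its argument lies in `[0, π f)`, and this argument is the move. -/
lemma exists_isChase_of_pos {c d : ℂ} {x y a : ℝ}
    (hx : c = ‖c‖ * Complex.exp (Real.pi * x * Complex.I))
    (hy : d = ‖d‖ * Complex.exp (Real.pi * y * Complex.I)) (h : 0 < area c d) (ha : 0 ≤ a) :
    ∃ z : ℝ, c + a * d = ‖c + a * d‖ * Complex.exp (Real.pi * z * Complex.I) ∧
      IsChase (y - x) x z := by
  obtain ⟨h1, h2⟩ := area_pos_iff hx hy h.ne'
  have he := h2.1 h
  have f0 := (Int.fract_nonneg (y - x)).lt_of_ne' h1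
  have f1 := Int.fract_lt_one (y - x)
  have hpi := Real.pi_pos
  set f := Int.fract (y - x) with hf
  have hc : 0 < ‖c‖ := by
    refine norm_pos_iff.2 fun h0 => ?_
    simp [h0, area] at h
  set w : ℂ := ‖c‖ + a * ‖d‖ * Complex.exp (Real.pi * f * Complex.I) with hw
  have hexp : Complex.exp (Real.pi * y * Complex.I)
      = Complex.exp (Real.pi * x * Complex.I) * Complex.exp (Real.pi * f * Complex.I) := by
    obtain ⟨k, hk⟩ := he
    have hyx : y = x + f + (k + k : ℤ) := by
      have := Int.floor_add_fract (y - x)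
      rw [hk] at this; linarith
    rw [← Complex.exp_add, hyx]
    rw [show (Real.pi * ((x + f + (k + k : ℤ) : ℝ) : ℂ) * Complex.I)
      = Real.pi * x * Complex.I + Real.pi * f * Complex.I + k * (2 * Real.pi * Complex.I) by
        push_cast; ring]
    rw [Complex.exp_add _ (k * (2 * Real.pi * Complex.I)), Complex.exp_int_mul_two_pi_mul_I, mul_one]
  have hcd : c + a * d = Complex.exp (Real.pi * x * Complex.I) * w := by
    rw [hw]
    conv_lhs => rw [hx, hy, hexp]
    ring
  have hfe : (Real.pi * f * Complex.I : ℂ) = ((Real.pi * f : ℝ) : ℂ) * Complex.I := by push_cast; ring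
  have hre : w.re = ‖c‖ + a * ‖d‖ * Real.cos (Real.pi * f) := by
    rw [hw, hfe]
    rw [Complex.add_re, Complex.ofReal_re, ← Complex.ofReal_mul, Complex.re_ofReal_mul,
      Complex.exp_ofReal_mul_I_re]
  have him : w.im = a * ‖d‖ * Real.sin (Real.pi * f) := by
    rw [hw, hfe]
    rw [Complex.add_im, Complex.ofReal_im, ← Complex.ofReal_mul, Complex.im_ofReal_mul,
      Complex.exp_ofReal_mul_I_im, zero_add]
  have hs : 0 < Real.sin (Real.pi * f) :=
    Real.sin_pos_of_pos_of_lt_pi (by positivity) (by nlinarith)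
  have ψ0 : 0 ≤ w.arg := Complex.arg_nonneg_iff.2 (by rw [him]; positivity)
  have hw0 : w ≠ 0 := by
    intro h0
    have e1 : a * ‖d‖ = 0 := by
      have : w.im = 0 := by rw [h0]; rfl
      rw [him] at this
      exact (mul_eq_zero.1 this).resolve_right hs.ne'
    have : w.re = 0 := by rw [h0]; rfl
    rw [hre, e1] at this; linarith
  have ψ1 : w.arg < Real.pi * f := by
    by_contra hge
    push Not at hge
    have h3 : 0 ≤ Real.sin (w.arg - Real.pi * f) := Real.sin_nonneg_of_nonneg_of_le_pi (by linarith)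
      (by have := Complex.arg_le_pi w; nlinarith)
    have h4 : ‖w‖ * Real.sin (w.arg - Real.pi * f) = - (‖c‖ * Real.sin (Real.pi * f)) := by
      rw [Real.sin_sub, mul_sub, ← mul_assoc, ← mul_assoc, Complex.norm_mul_sin_arg,
        Complex.norm_mul_cos_arg, hre, him]
      ring
    have : 0 < ‖c‖ * Real.sin (Real.pi * f) := by positivity
    nlinarith [norm_nonneg w]
  refine ⟨x + w.arg / Real.pi, ?_, ?_⟩
  · have hn : ‖c + a * d‖ = ‖w‖ := by
      rw [hcd, norm_mul, show (Real.pi * x * Complex.I : ℂ) = ((Real.pi * x : ℝ) : ℂ) * Complex.I by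
        push_cast; ring, Complex.norm_exp_ofReal_mul_I, one_mul]
    rw [hn, hcd]
    conv_lhs => rw [← Complex.norm_mul_exp_arg_mul_I w]
    have : (Real.pi * ((x + w.arg / Real.pi : ℝ) : ℂ) * Complex.I)
        = Real.pi * x * Complex.I + w.arg * Complex.I := by
      have : (Real.pi : ℂ) ≠ 0 := by exact_mod_cast hpi.ne'
      push_cast; field_simp
    rw [this, Complex.exp_add]; ring
  · rw [IsChase, if_pos he]
    refine ⟨by have := div_nonneg ψ0 hpi.le; linarith, ?_⟩
    rw [add_sub_cancel_left, div_lt_iff₀ hpi]; linarith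

lemma exists_isChase {c d : ℂ} {x y a : ℝ}
    (hx : c = ‖c‖ * Complex.exp (Real.pi * x * Complex.I))
    (hy : d = ‖d‖ * Complex.exp (Real.pi * y * Complex.I)) (h : area c d ≠ 0) (ha : 0 ≤ a) :
    ∃ z : ℝ, c + a * d = ‖c + a * d‖ * Complex.exp (Real.pi * z * Complex.I) ∧
      IsChase (y - x) x z := by
  rcases lt_or_gt_of_ne h with hneg | hpos
  -- Complex conjugation negates areas and arguments, which reduces negative area to positive area.
  · have hconj : ∀ (c : ℂ) (x : ℝ), c = ‖c‖ * Complex.exp (Real.pi * x * Complex.I) →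
        (starRingEnd ℂ) c = ‖(starRingEnd ℂ) c‖ * Complex.exp (Real.pi * (-x : ℝ) * Complex.I) := by
      intro c x hx
      conv_lhs => rw [hx]
      rw [map_mul, Complex.conj_ofReal, ← Complex.exp_conj, Complex.norm_conj]
      congr 2
      simp
    obtain ⟨z, hz, hch⟩ := exists_isChase_of_pos (a := a) (hconj c x hx) (hconj d y hy)
      (by simp only [area, Complex.conj_re, Complex.conj_im] at hneg ⊢; linarith) ha
    refine ⟨-z, ?_, ?_⟩
    · have := hconj _ _ hz
      simpa using this
    · obtain ⟨h1, h2⟩ := area_pos_iff hx hy h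
      have hodd : ¬ Even ⌊y - x⌋ := fun he => absurd (h2.2 he) (by linarith)
      have f0 := (Int.fract_nonneg (y - x)).lt_of_ne' h1
      have f1 := Int.fract_lt_one (y - x)
      have hdec := Int.floor_add_fract (y - x)
      obtain ⟨h3, h4⟩ := floor_fract_of (Z := -y - -x) (m := -⌊y - x⌋ - 1)
        (f := 1 - Int.fract (y - x)) (by push_cast; linarith) (by linarith) (by linarith)
      have heven : Even ⌊-y - -x⌋ := by
        rw [h3, Int.even_sub_one, even_neg]; exact hodd
      rw [IsChase, if_pos heven, h4] at hch
      rw [IsChase, if_neg hodd]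
      constructor <;> linarith [hch.1, hch.2]
  · exact exists_isChase_of_pos hx hy hpos ha

lemma exists_polar (c : ℂ) : ∃ x : ℝ, c = ‖c‖ * Complex.exp (Real.pi * x * Complex.I) := by
  refine ⟨c.arg / Real.pi, ?_⟩
  have : (Real.pi : ℂ) ≠ 0 := by exact_mod_cast Real.pi_pos.ne'
  conv_lhs => rw [← Complex.norm_mul_exp_arg_mul_I c]
  congr 3
  push_cast; field_simp

lemma changes_mono (p : ℕ → Prop) : Monotone (changes p) :=
  monotone_nat_of_le_succ fun k => by simp [changes]

lemma changes_lt {p : ℕ → Prop} {k l : ℕ} (hkl : k ≤ l) (h : ¬ (p k ↔ p l)) :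
    changes p k < changes p l := by
  induction l, hkl using Nat.le_induction with
  | base => exact absurd Iff.rfl h
  | succ l hl ih =>
    by_cases h1 : p k ↔ p l
    · have h2 : ¬ (p (l + 1) ↔ p l) := fun h3 => h (h1.trans h3.symm)
      have := changes_mono p hl
      rw [changes]; simp only [h2, if_false]; omega
    · exact (ih h1).trans_le (changes_mono p (Nat.le_succ l))

/-- Only the change inside each pair of samples `2j, 2j + 1` is counted. Samples may coincide, so
`κ` need not be strictly monotone. -/
lemma le_changes {p : ℕ → Prop} {κ : ℕ → ℕ} (hκ : Monotone κ) {N : ℕ}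
    (h : ∀ j < N, ¬ (p (κ (2 * j)) ↔ p (κ (2 * j + 1)))) : N ≤ changes p (κ (2 * N)) := by
  induction N with
  | zero => exact Nat.zero_le _
  | succ N ih =>
    have h1 := ih fun j hj => h j (hj.trans (Nat.lt_succ_self N))
    have h2 := changes_lt (hκ (Nat.le_succ (2 * N))) (h N (Nat.lt_succ_self N))
    have h3 := changes_mono p (hκ (show 2 * N + 1 ≤ 2 * (N + 1) by omega))
    simp only [Nat.succ_eq_add_one] at h2
    omega

/-- A chain of plane vectors, each of which is pushed towards the next one: the area of the first
two changes its sign at most `2 (n - 2)` times. -/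
theorem discrete_chain_le {n : ℕ} (hn : 2 ≤ n) {c : ℕ → ℕ → ℂ} {a : ℕ → ℕ → ℝ}
    (ha : ∀ k i, 0 ≤ a k i) (hc : ∀ k i, i + 1 < n → c (k + 1) i = c k i + a k i * c k (i + 1))
    (hlast : ∀ k, c (k + 1) (n - 1) = c k (n - 1))
    (hne : ∀ k i, i + 1 < n → area (c k i) (c k (i + 1)) ≠ 0)
    {κ : ℕ → ℕ} (hκ : Monotone κ) {N : ℕ}
    (h : ∀ j < N, area (c (κ (2 * j)) 0) (c (κ (2 * j)) 1)
      * area (c (κ (2 * j + 1)) 0) (c (κ (2 * j + 1)) 1) < 0) : N ≤ 2 * (n - 2) := by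
  wlog hpos : 0 < area (c 0 (n - 2)) (c 0 (n - 1)) generalizing c
  · have hconj : ∀ x y : ℂ, area ((starRingEnd ℂ) x) ((starRingEnd ℂ) y) = - area x y := by
      intro x y; simp only [area, Complex.conj_re, Complex.conj_im]; ring
    refine this (c := fun k i => (starRingEnd ℂ) (c k i)) ?_ ?_ ?_ ?_ ?_
    · intro k i hi; rw [hc k i hi]; simp
    · intro k; rw [hlast]
    · intro k i hi; simp only [hconj]; exact neg_ne_zero.2 (hne k i hi)
    · intro j hj; simp only [hconj, neg_mul_neg]; exact h j hj
    · have h1 := hne 0 (n - 2) (by omega)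
      rw [show n - 2 + 1 = n - 1 by omega] at h1
      simp only [hconj]
      have := lt_of_le_of_ne (not_lt.1 hpos) h1
      linarith
  -- A choice of arguments for a whole configuration. The choices are continued step by step so that
  -- every move is a chase and the last argument stays fixed.
  let Pol : (ℕ → ℂ) → Type := fun c =>
    {X : ℕ → ℝ // ∀ i, c i = ‖c i‖ * Complex.exp (Real.pi * X i * Complex.I)}
  have hstep : ∀ k (P : Pol (c k)), ∃ Q : Pol (c (k + 1)),
      (∀ i, i + 1 < n → IsChase (P.1 (i + 1) - P.1 i) (P.1 i) (Q.1 i)) ∧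
        Q.1 (n - 1) = P.1 (n - 1) := by
    intro k P
    have h1 : ∀ i, ∃ z : ℝ, c (k + 1) i = ‖c (k + 1) i‖ * Complex.exp (Real.pi * z * Complex.I) ∧
        (i + 1 < n → IsChase (P.1 (i + 1) - P.1 i) (P.1 i) z) ∧ (i = n - 1 → z = P.1 (n - 1)) := by
      intro i
      by_cases hi : i + 1 < n
      · obtain ⟨z, hz, hz'⟩ := exists_isChase (P.2 i) (P.2 (i + 1)) (hne k i hi) (ha k i)
        refine ⟨z, ?_, fun _ => hz', fun h => by omega⟩
        rw [hc k i hi]; exact hz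
      · by_cases hi' : i = n - 1
        · refine ⟨P.1 (n - 1), ?_, fun h => absurd h hi, fun _ => rfl⟩
          rw [hi', hlast]; exact P.2 _
        · obtain ⟨z, hz⟩ := exists_polar (c (k + 1) i)
          exact ⟨z, hz, fun h => absurd h hi, fun h => absurd h hi'⟩
    choose z hz using h1
    exact ⟨⟨z, fun i => (hz i).1⟩, fun i hi => (hz i).2.1 hi, (hz _).2.2 rfl⟩
  choose Q hQ using hstep
  let P0 : Pol (c 0) := ⟨fun i => (exists_polar (c 0 i)).choose,
    fun i => (exists_polar (c 0 i)).choose_spec⟩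
  let P : ∀ k, Pol (c k) := fun k => Nat.rec P0 (fun k P => Q k P) k
  have hsgn := fun k i (hi : i + 1 < n) => area_pos_iff ((P k).2 i) ((P k).2 (i + 1)) (hne k i hi)
  have key := changes_chase_le (X := fun k => (P k).1) hn (fun k i hi => (hsgn k i hi).1)
    (fun k i hi => (hQ k (P k)).1 i hi)
    (fun k => (hQ k (P k)).2)
    (by
      have := (hsgn 0 (n - 2) (by omega)).2
      rw [show n - 2 + 1 = n - 1 by omega] at this
      exact this.1 hpos) (κ (2 * N))
  refine (le_changes hκ fun j hj hiff => ?_).trans key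
  have h1 := h j hj
  rw [← (hsgn _ 0 (by omega)).2, ← (hsgn _ 0 (by omega)).2] at hiff
  by_cases h2 : 0 < area (c (κ (2 * j)) 0) (c (κ (2 * j)) 1)
  · exact absurd h1 (not_lt.2 (mul_pos h2 (hiff.1 h2)).le)
  · have h3 := mt hiff.2 h2
    push Not at h2 h3
    exact absurd h1 (not_lt.2 (mul_nonneg_of_nonpos_of_nonpos h2 h3))

/-! ### Perturbing a discrete chain into general position. -/

/-- The configurations obtained from `c` by pushing, in step `k`, each vector towards the next one
with coefficients `a k`. -/
def evolve (a : ℕ → ℕ → ℝ) (c : ℕ → ℂ) : ℕ → ℕ → ℂ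
  | 0 => c
  | k + 1 => fun i => evolve a c k i + a k i * evolve a c k (i + 1)

lemma evolve_add_smul (a : ℕ → ℕ → ℝ) (c u : ℕ → ℂ) (s : ℝ) (k i : ℕ) :
    evolve a (fun i => c i + s * u i) k i = evolve a c k i + s * evolve a u k i := by
  induction k generalizing i with
  | zero => rfl
  | succ k ih => simp only [evolve, ih]; ring

/-- The vectors `(1, i)` are ordered counterclockwise, and pushing preserves this: the new area is
the old one plus nonnegative multiples of areas of ordered pairs. They serve as the direction of
perturbation. -/
lemma area_evolve_pos {a : ℕ → ℕ → ℝ} (ha : ∀ k i, 0 ≤ a k i) (k : ℕ) {i j : ℕ} (hij : i < j) :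
    0 < area (evolve a (fun i => ⟨1, i⟩) k i) (evolve a (fun i => ⟨1, i⟩) k j) := by
  induction k generalizing i j with
  | zero => simp only [evolve, area]; simpa using hij
  | succ k ih =>
    set c := evolve a (fun i => ⟨1, i⟩) k with hc
    have h0 : 0 ≤ area (c (i + 1)) (c j) := by
      rcases (Nat.succ_le_of_lt hij).eq_or_lt with h | h
      · rw [← h, Nat.succ_eq_add_one]; simp only [area]; apply le_of_eq; ring
      · exact (ih h).le
    have h1 := ih hij
    have h2 := ih (show i < j + 1 by omega)
    have h3 := ih (show i + 1 < j + 1 by omega)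
    have e : area (evolve a (fun i => ⟨1, i⟩) (k + 1) i) (evolve a (fun i => ⟨1, i⟩) (k + 1) j)
        = area (c i) (c j) + a k j * area (c i) (c (j + 1)) + a k i * area (c (i + 1)) (c j)
          + a k i * a k j * area (c (i + 1)) (c (j + 1)) := by
      simp only [evolve, ← hc, area, Complex.add_re, Complex.add_im, Complex.re_ofReal_mul,
        Complex.im_ofReal_mul]
      ring
    rw [e]
    have := mul_nonneg (ha k j) h2.le
    have := mul_nonneg (ha k i) h0
    have := mul_nonneg (mul_nonneg (ha k i) (ha k j)) h3.le
    linarith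

lemma eventually_quadratic_ne_zero (A B : ℝ) {C : ℝ} (hC : C ≠ 0) :
    ∀ᶠ s in 𝓝[>] (0 : ℝ), A + B * s + C * s ^ 2 ≠ 0 := by
  have hpos : ∀ᶠ s in 𝓝[>] (0 : ℝ), 0 < s := eventually_mem_nhdsWithin
  by_cases hA : A = 0
  · by_cases hB : B = 0
    · filter_upwards [hpos] with s hs
      rw [hA, hB]
      have : C * s ^ 2 ≠ 0 := mul_ne_zero hC (pow_ne_zero 2 hs.ne')
      simpa using this
    · have h1 : ∀ᶠ s in 𝓝[>] (0 : ℝ), B + C * s ≠ 0 := by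
        apply eventually_nhdsWithin_of_eventually_nhds
        have : ContinuousAt (fun s : ℝ => B + C * s) 0 := by fun_prop
        exact this.eventually_ne (by simpa using hB)
      filter_upwards [hpos, h1] with s hs h1
      rw [hA, show 0 + B * s + C * s ^ 2 = s * (B + C * s) by ring]
      exact mul_ne_zero hs.ne' h1
  · apply eventually_nhdsWithin_of_eventually_nhds
    have : ContinuousAt (fun s : ℝ => A + B * s + C * s ^ 2) 0 := by fun_prop
    exact this.eventually_ne (by simpa using hA)

lemma evolve_of_le {a : ℕ → ℕ → ℝ} {M : ℕ} (hM : ∀ k ≥ M, ∀ i, a k i = 0) (c : ℕ → ℂ) {k : ℕ}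
    (hk : M ≤ k) : evolve a c k = evolve a c M := by
  induction k, hk using Nat.le_induction with
  | base => rfl
  | succ k hk ih => funext i; simp [evolve, hM k hk, ih]

/-- Each area is a quadratic polynomial in `s` whose leading coefficient is positive by
`area_evolve_pos`. Only finitely many pairs `k, i` matter, because the evolution is stationary from
time `M` on. -/
lemma eventually_area_evolve_ne_zero {a : ℕ → ℕ → ℝ} (ha : ∀ k i, 0 ≤ a k i) {M : ℕ}
    (hM : ∀ k ≥ M, ∀ i, a k i = 0) (n : ℕ) (c : ℕ → ℂ) :
    ∀ᶠ s : ℝ in 𝓝[>] (0 : ℝ), ∀ k i, i + 1 < n →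
      area (evolve a (fun i => c i + s * (⟨1, i⟩ : ℂ)) k i)
        (evolve a (fun i => c i + s * (⟨1, i⟩ : ℂ)) k (i + 1)) ≠ 0 := by
  have h1 : ∀ k i : ℕ, ∀ᶠ s : ℝ in 𝓝[>] (0 : ℝ),
      area (evolve a (fun i => c i + s * (⟨1, i⟩ : ℂ)) k i)
        (evolve a (fun i => c i + s * (⟨1, i⟩ : ℂ)) k (i + 1)) ≠ 0 := by
    intro k i
    have h2 := area_evolve_pos ha k (Nat.lt_succ_self i)
    set u : ℕ → ℂ := fun i => ⟨1, i⟩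
    filter_upwards [eventually_quadratic_ne_zero (area (evolve a c k i) (evolve a c k (i + 1)))
      (area (evolve a c k i) (evolve a u k (i + 1)) + area (evolve a u k i) (evolve a c k (i + 1)))
      h2.ne'] with s hs
    have e := evolve_add_smul a c u s k
    rw [e, e]
    convert hs using 1
    simp only [area, Complex.add_re, Complex.add_im, Complex.re_ofReal_mul,
        Complex.im_ofReal_mul]
    ring
  have h3 : ∀ᶠ s : ℝ in 𝓝[>] (0 : ℝ), ∀ k ∈ Finset.range (M + 1), ∀ i ∈ Finset.range n,
      area (evolve a (fun i => c i + s * (⟨1, i⟩ : ℂ)) k i)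
        (evolve a (fun i => c i + s * (⟨1, i⟩ : ℂ)) k (i + 1)) ≠ 0 :=
    (Filter.eventually_all_finset _).2 fun k _ => (Filter.eventually_all_finset _).2 fun i _ => h1 k i
  filter_upwards [h3] with s hs k i hi
  rcases le_total k M with hk | hk
  · exact hs k (Finset.mem_range.2 (by omega)) i (Finset.mem_range.2 (by omega))
  · rw [evolve_of_le hM _ hk]
    exact hs M (Finset.mem_range.2 (by omega)) i (Finset.mem_range.2 (by omega))

/-! ### From discrete to continuous chains by the Euler scheme. -/

/-- The coefficients of the Euler scheme with `M` steps on `[a, b]`. -/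
noncomputable def eulerCoeff (n : ℕ) (a b : ℝ) (β : ℕ → ℝ → ℝ) (M k i : ℕ) : ℝ :=
  if k < M ∧ i + 1 < n then (b - a) / M * β i (a + k * ((b - a) / M)) else 0

section Euler

variable {n : ℕ} {a b : ℝ} {V : ℕ → ℝ → ℂ} {β : ℕ → ℝ → ℝ}

lemma grid_mem (hab : a < b) {M k : ℕ} (hM : 0 < M) (hk : k ≤ M) :
    a + k * ((b - a) / M) ∈ Set.Icc a b := by
  have hM' : (0 : ℝ) < M := by exact_mod_cast hM
  have h : 0 < (b - a) / M := div_pos (by linarith) hM'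
  have hk' : (k : ℝ) ≤ M := by exact_mod_cast hk
  refine ⟨by have : 0 ≤ (k : ℝ) * ((b - a) / M) := by positivity
             linarith, ?_⟩
  have : (k : ℝ) * ((b - a) / M) ≤ M * ((b - a) / M) := by gcongr
  rw [mul_div_cancel₀ _ hM'.ne'] at this
  linarith

/-- Convergence of the explicit Euler scheme by a discrete Grönwall argument: a step amplifies the
error by at most `1 + h L ≤ exp (h L)` and adds at most `δ h`, by uniform continuity of the
derivatives. -/
lemma euler_error (hab : a < b)
    (hβc : ∀ i, ContinuousOn (β i) (Set.Icc a b))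
    (hV : ∀ i, ∀ t ∈ Set.Icc a b, HasDerivAt (V i) (β i t * V (i + 1) t) t)
    (hVn : ∀ i ≥ n, ∀ t ∈ Set.Icc a b, V i t = 0) {ε : ℝ} (hε : 0 < ε) :
    ∃ M₀ : ℕ, 0 < M₀ ∧ ∀ M ≥ M₀, ∀ k ≤ M, ∀ i < n,
      ‖evolve (eulerCoeff n a b β M) (fun i => V i a) k i - V i (a + k * ((b - a) / M))‖ ≤ ε := by
  have hVc : ∀ i, ContinuousOn (V i) (Set.Icc a b) := fun i t ht =>
    (hV i t ht).continuousAt.continuousWithinAt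
  obtain ⟨L, hL⟩ : ∃ L, ∀ t ∈ Set.Icc a b, ‖(fun i : Fin n => β i t)‖ ≤ L :=
    isCompact_Icc.exists_bound_of_continuousOn (continuousOn_pi.2 fun i => hβc i)
  have hL0 : 0 ≤ L := (norm_nonneg _).trans (hL a ⟨le_rfl, hab.le⟩)
  -- Chosen so that the accumulated error `δ (b - a) exp (L (b - a))` equals `ε`.
  set δ := ε / ((b - a) * Real.exp (L * (b - a))) with hδ
  have hba : 0 < b - a := by linarith
  have hδ0 : 0 < δ := by positivity
  have huc := isCompact_Icc.uniformContinuousOn_of_continuous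
    (f := fun t => fun i : Fin n => (β i t : ℂ) * V (i + 1) t) (s := Set.Icc a b)
    (continuousOn_pi.2 fun i => (Complex.continuous_ofReal.comp_continuousOn (hβc i)).mul
      (hVc (i + 1)))
  obtain ⟨η, hη, hη'⟩ := Metric.uniformContinuousOn_iff_le.1 huc δ hδ0
  obtain ⟨M₀, hM₀⟩ := exists_nat_gt ((b - a) / η)
  have hM₀0 : 0 < M₀ := by
    have : (0 : ℝ) < M₀ := lt_of_le_of_lt (by positivity) hM₀
    exact_mod_cast this
  refine ⟨M₀, hM₀0, fun M hM => ?_⟩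
  have hM0 : 0 < M := by omega
  have hM' : (0 : ℝ) < M := by exact_mod_cast hM0
  set h := (b - a) / M with hh
  have h0 : 0 < h := by positivity
  have hhη : h ≤ η := by
    rw [hh, div_le_iff₀ hM']
    rw [div_lt_iff₀ hη] at hM₀
    have : (M₀ : ℝ) ≤ M := by exact_mod_cast hM
    nlinarith
  have key : ∀ k ≤ M, ∀ i < n,
      ‖evolve (eulerCoeff n a b β M) (fun i => V i a) k i - V i (a + k * h)‖
        ≤ δ * (k * h) * Real.exp (L * (k * h)) := by
    intro k
    induction k with
    | zero => intro _ i _; simp [evolve]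
    | succ k ih =>
      intro hk i hi
      have ih' := ih (by omega)
      have ht := grid_mem hab hM0 (show k ≤ M by omega)
      have ht' := grid_mem hab hM0 hk
      rw [← hh] at ht ht'
      push_cast at ht' ⊢
      set t := a + k * h with htdef
      have e : a + (k + 1 : ℝ) * h = t + h := by rw [htdef]; ring
      rw [e] at ht' ⊢
      have hloc : ‖V i (t + h) - V i t - h * (β i t * V (i + 1) t)‖ ≤ δ * h := by
        have hsub : Set.Icc t (t + h) ⊆ Set.Icc a b := Set.Icc_subset_Icc ht.1 ht'.2
        have := Convex.norm_image_sub_le_of_norm_hasDerivWithin_le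
          (f := fun s : ℝ => V i s - (s : ℂ) * (β i t * V (i + 1) t))
          (f' := fun s => β i s * V (i + 1) s - β i t * V (i + 1) t) (C := δ)
          (s := Set.Icc t (t + h)) (x := t) (y := t + h) ?_ ?_ (convex_Icc _ _)
          ⟨le_rfl, by linarith⟩ ⟨by linarith, le_rfl⟩
        · have e3 : V i (t + h) - ((t + h : ℝ) : ℂ) * (β i t * V (i + 1) t)
              - (V i t - (t : ℂ) * (β i t * V (i + 1) t))
              = V i (t + h) - V i t - h * (β i t * V (i + 1) t) := by push_cast; ring
          rwa [e3, add_sub_cancel_left, Real.norm_eq_abs, abs_of_pos h0] at this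
        · intro s hs
          have h1 := ((hV i s (hsub hs)).sub
            ((Complex.ofRealCLM.hasDerivAt (x := s)).mul_const (β i t * V (i + 1) t)))
          exact (h1.congr_deriv (by simp)).hasDerivWithinAt
        · intro s hs
          have := hη' s (hsub hs) t ht (by
            rw [Real.dist_eq, abs_of_nonneg (by linarith [hs.1])]; linarith [hs.2])
          rw [dist_eq_norm] at this
          exact (norm_le_pi_norm _ (⟨i, hi⟩ : Fin n)).trans this
      have hstep : evolve (eulerCoeff n a b β M) (fun i => V i a) (k + 1) i - V i (t + h)
          = (evolve (eulerCoeff n a b β M) (fun i => V i a) k i - V i t)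
            + (if i + 1 < n then (h * β i t : ℂ) *
              (evolve (eulerCoeff n a b β M) (fun i => V i a) k (i + 1) - V (i + 1) t) else 0)
            - (V i (t + h) - V i t - h * (β i t * V (i + 1) t)) := by
        simp only [evolve, eulerCoeff, show k < M by omega, true_and]
        split_ifs with hin
        · rw [← hh, ← htdef]; push_cast; ring
        · rw [hVn (i + 1) (by omega) t ht]; push_cast; ring
      set D := δ * (k * h) * Real.exp (L * (k * h)) with hD
      have hD0 : 0 ≤ D := by positivity
      have hmid : ‖(if i + 1 < n then (h * β i t : ℂ) *
              (evolve (eulerCoeff n a b β M) (fun i => V i a) k (i + 1) - V (i + 1) t) else 0)‖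
          ≤ h * L * D := by
        split_ifs with hin
        · rw [norm_mul, norm_mul, Complex.norm_real, Complex.norm_real, Real.norm_eq_abs,
            abs_of_pos h0]
          have h1 := ih' (i + 1) hin
          have h2 := (norm_le_pi_norm (fun i : Fin n => β i t) (⟨i, hi⟩ : Fin n)).trans (hL t ht)
          dsimp only at h2
          gcongr
        · simp; positivity
      rw [hstep]
      refine (norm_sub_le _ _).trans ?_
      have h1 := norm_add_le (evolve (eulerCoeff n a b β M) (fun i => V i a) k i - V i t)
        (if i + 1 < n then (h * β i t : ℂ) *
              (evolve (eulerCoeff n a b β M) (fun i => V i a) k (i + 1) - V (i + 1) t) else 0)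
      have h2 := ih' i hi
      have h3 : 1 + h * L ≤ Real.exp (h * L) := by
        have := Real.add_one_le_exp (h * L); linarith
      have h4 : Real.exp (L * ((k + 1) * h)) = Real.exp (L * (k * h)) * Real.exp (h * L) := by
        rw [← Real.exp_add]; ring_nf
      have h5 : 1 ≤ Real.exp (L * ((k + 1) * h)) := Real.one_le_exp (by positivity)
      calc _ ≤ D + h * L * D + δ * h := by linarith
        _ = (1 + h * L) * D + δ * h * 1 := by ring
        _ ≤ Real.exp (h * L) * D + δ * h * Real.exp (L * ((k + 1) * h)) := by gcongr
        _ = δ * ((k + 1) * h) * Real.exp (L * ((k + 1) * h)) := by rw [hD, h4]; ring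
  intro k hk i hi
  refine (key k hk i hi).trans ?_
  have h1 := (grid_mem hab hM0 hk).2
  rw [← hh] at h1
  calc δ * (k * h) * Real.exp (L * (k * h)) ≤ δ * (b - a) * Real.exp (L * (b - a)) := by
        gcongr <;> linarith
    _ = ε := by rw [hδ]; field_simp

/-- A chain of plane curves, each of which is pushed towards the next one: the area of the first
two changes its sign at most `2 (n - 2)` times. -/
theorem continuous_chain_le (hn : 2 ≤ n) (hab : a < b)
    (hβ : ∀ i, ∀ t ∈ Set.Icc a b, 0 ≤ β i t) (hβc : ∀ i, ContinuousOn (β i) (Set.Icc a b))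
    (hV : ∀ i, ∀ t ∈ Set.Icc a b, HasDerivAt (V i) (β i t * V (i + 1) t) t)
    (hVn : ∀ i ≥ n, ∀ t ∈ Set.Icc a b, V i t = 0)
    {τ : ℕ → ℝ} (hτ : Monotone τ) (hτm : ∀ j, τ j ∈ Set.Icc a b) {N : ℕ}
    (h : ∀ j < N, area (V 0 (τ (2 * j))) (V 1 (τ (2 * j)))
      * area (V 0 (τ (2 * j + 1))) (V 1 (τ (2 * j + 1))) < 0) : N ≤ 2 * (n - 2) := by
  have hVc : ∀ i, ContinuousOn (V i) (Set.Icc a b) := fun i t ht =>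
    (hV i t ht).continuousAt.continuousWithinAt
  have hsgn : ∀ j < 2 * N, area (V 0 (τ j)) (V 1 (τ j)) ≠ 0 := by
    intro j hj h0
    rcases Nat.even_or_odd' j with ⟨i, rfl | rfl⟩
    · have := h i (by omega); rw [h0, zero_mul] at this; exact lt_irrefl _ this
    · have := h i (by omega); rw [h0, mul_zero] at this; exact lt_irrefl _ this
  have hcont : Continuous fun p : ℂ × ℂ => area p.1 p.2 := by unfold area; fun_prop
  -- The signs at the samples survive a displacement smaller than `ρ`. The mesh, the Euler scheme
  -- and the perturbation into general position will contribute at most `ρ / 4` each.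
  have h1 : ∀ᶠ ρ : ℝ in 𝓝[>] 0, ∀ j ∈ Finset.range (2 * N), ∀ p : ℂ × ℂ,
      dist p (V 0 (τ j), V 1 (τ j)) < ρ → 0 < area p.1 p.2 * area (V 0 (τ j)) (V 1 (τ j)) := by
    refine (Filter.eventually_all_finset _).2 fun j hj => ?_
    have h2 : ∀ᶠ p in 𝓝 (V 0 (τ j), V 1 (τ j)), 0 < area p.1 p.2 * area (V 0 (τ j)) (V 1 (τ j)) := by
      have : ContinuousAt (fun p : ℂ × ℂ => area p.1 p.2 * area (V 0 (τ j)) (V 1 (τ j)))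
        (V 0 (τ j), V 1 (τ j)) := (hcont.mul continuous_const).continuousAt
      exact this.eventually_const_lt (mul_self_pos.2 (hsgn j (Finset.mem_range.1 hj)))
    obtain ⟨r, hr, hr'⟩ := Metric.eventually_nhds_iff.1 h2
    filter_upwards [Ioo_mem_nhdsGT hr] with ρ hρ p hp
    exact hr' (hp.trans hρ.2)
  obtain ⟨ρ, hρ1, hρ⟩ := (h1.and eventually_mem_nhdsWithin).exists
  have hρ0 : (0 : ℝ) < ρ := hρ
  have huc := isCompact_Icc.uniformContinuousOn_of_continuous
    (f := fun t => (V 0 t, V 1 t)) (s := Set.Icc a b) ((hVc 0).prodMk (hVc 1))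
  obtain ⟨η, hη, hη'⟩ := Metric.uniformContinuousOn_iff_le.1 huc (ρ / 4) (by positivity)
  obtain ⟨M₀, hM₀, hE⟩ := euler_error hab hβc hV hVn (ε := ρ / 4) (by positivity)
  obtain ⟨M₁, hM₁⟩ := exists_nat_gt ((b - a) / η)
  set M := max M₀ M₁
  have hM0 : 0 < M := hM₀.trans_le (le_max_left _ _)
  have hM' : (0 : ℝ) < M := by exact_mod_cast hM0
  have hE := hE M (le_max_left _ _)
  set s := (b - a) / M with hs
  have hba : 0 < b - a := by linarith
  have hs0 : 0 < s := by positivity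
  have hsη : s ≤ η := by
    rw [hs, div_le_iff₀ hM']
    rw [div_lt_iff₀ hη] at hM₁
    have : (M₁ : ℝ) ≤ M := by exact_mod_cast le_max_right _ _
    nlinarith
  set α := eulerCoeff n a b β M with hα
  have hα0 : ∀ k i, 0 ≤ α k i := by
    intro k i
    rw [hα, eulerCoeff]
    split_ifs with hk
    · exact mul_nonneg hs0.le (hβ i _ (grid_mem hab hM0 hk.1.le))
    · exact le_rfl
  have hαM : ∀ k ≥ M, ∀ i, α k i = 0 := by
    intro k hk i
    rw [hα, eulerCoeff, if_neg (by omega)]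
  have hαn : ∀ k, α k (n - 1) = 0 := by
    intro k
    rw [hα, eulerCoeff, if_neg (by omega)]
  have hsmall : ∀ᶠ r : ℝ in 𝓝[>] (0 : ℝ), ∀ k ∈ Finset.range (M + 1), ∀ i ∈ Finset.range 2,
      ‖(r : ℂ) * evolve α (fun i => (⟨1, i⟩ : ℂ)) k i‖ < ρ / 4 := by
    refine (Filter.eventually_all_finset _).2 fun k _ => (Filter.eventually_all_finset _).2 fun i _ => ?_
    apply eventually_nhdsWithin_of_eventually_nhds
    have : ContinuousAt (fun r : ℝ => ‖(r : ℂ) * evolve α (fun i => (⟨1, i⟩ : ℂ)) k i‖) 0 := by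
      fun_prop
    exact this.eventually_lt_const (by simpa using hρ0)
  obtain ⟨r, hr1, hr2⟩ := (hsmall.and
    (eventually_area_evolve_ne_zero hα0 hαM n fun i => V i a)).exists
  -- Sample times rounded down to the grid.
  let κ : ℕ → ℕ := fun j => ⌊(τ j - a) / s⌋₊
  have hκ : Monotone κ := fun i j hij => Nat.floor_mono (by have := hτ hij; gcongr)
  have hκM : ∀ j, κ j ≤ M := by
    intro j
    apply Nat.floor_le_of_le
    rw [div_le_iff₀ hs0, hs, mul_div_cancel₀ _ hM'.ne']
    linarith [(hτm j).2]
  have hclose : ∀ j, dist (evolve α (fun i => V i a + r * (⟨1, i⟩ : ℂ)) (κ j) 0,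
      evolve α (fun i => V i a + r * (⟨1, i⟩ : ℂ)) (κ j) 1) (V 0 (τ j), V 1 (τ j)) < ρ := by
    intro j
    have h2 := hη' (a + κ j * s) (grid_mem hab hM0 (hκM j)) (τ j) (hτm j) (by
      have h3 : (κ j : ℝ) ≤ (τ j - a) / s :=
        Nat.floor_le (div_nonneg (by linarith [(hτm j).1]) hs0.le)
      have h4 := Nat.lt_floor_add_one ((τ j - a) / s)
      rw [le_div_iff₀ hs0] at h3
      rw [div_lt_iff₀ hs0] at h4
      rw [Real.dist_eq, abs_le]
      constructor
      · have : (⌊(τ j - a) / s⌋₊ : ℝ) = κ j := rfl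
        rw [this] at h4
        nlinarith
      · linarith)
    rw [Prod.dist_eq, max_le_iff] at h2
    rw [Prod.dist_eq, max_lt_iff]
    have h5 : ∀ i < 2, dist (V i (a + κ j * s)) (V i (τ j)) ≤ ρ / 4 →
        dist (evolve α (fun i => V i a + r * (⟨1, i⟩ : ℂ)) (κ j) i) (V i (τ j)) < ρ := by
      intro i hi h6
      have h7 := hE (κ j) (hκM j) i (by omega)
      have h8 := hr1 (κ j) (Finset.mem_range.2 (by have := hκM j; omega)) i (Finset.mem_range.2 hi)
      rw [evolve_add_smul, dist_eq_norm]
      rw [dist_eq_norm] at h6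
      have e : evolve α (fun i => V i a) (κ j) i
          + r * evolve α (fun i => (⟨1, i⟩ : ℂ)) (κ j) i - V i (τ j)
          = (evolve α (fun i => V i a) (κ j) i - V i (a + κ j * s))
            + r * evolve α (fun i => (⟨1, i⟩ : ℂ)) (κ j) i + (V i (a + κ j * s) - V i (τ j)) := by
        ring
      rw [e]
      refine (norm_add₃_le).trans_lt ?_
      linarith
    exact ⟨h5 0 (by norm_num) h2.1, h5 1 (by norm_num) h2.2⟩
  refine discrete_chain_le hn (c := evolve α (fun i => V i a + r * (⟨1, i⟩ : ℂ))) hα0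
    (fun k i _ => rfl) (fun k => by simp [evolve, hαn]) hr2 hκ fun j hj => ?_
  have h2 := hρ1 (2 * j) (Finset.mem_range.2 (by omega)) _ (hclose _)
  have h3 := hρ1 (2 * j + 1) (Finset.mem_range.2 (by omega)) _ (hclose _)
  have h4 := h j hj
  dsimp only at h2 h3
  by_contra hge
  push Not at hge
  have := mul_pos h2 h3
  nlinarith

end Euler

/-! ### Local lifts, osculating spaces and what convexity says about them. -/

section Lifts

variable {n : ℕ} {γ : Circle → RP n} {t : ℝ} {f g : ℝ → Fin n → ℝ}

lemma IsLocalLift.ne_zero (h : IsLocalLift γ t f) : f t ≠ 0 := by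
  obtain ⟨h, -⟩ := h.2.self_of_nhds
  exact h

/-- The factor is the quotient of a coordinate in which `g` does not vanish at `t`, hence smooth. -/
lemma IsLocalLift.exists_smul (hf : IsLocalLift γ t f) (hg : IsLocalLift γ t g) :
    ∃ c : ℝ → ℝ, ContDiffAt ℝ ∞ c t ∧ f =ᶠ[𝓝 t] c • g := by
  obtain ⟨i, hi⟩ := Function.ne_iff.1 hg.ne_zero
  have hgi : ContDiffAt ℝ ∞ (fun s => g s i) t := contDiffAt_pi.1 hg.1 i
  refine ⟨fun s => f s i / g s i, (contDiffAt_pi.1 hf.1 i).div hgi hi, ?_⟩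
  filter_upwards [hf.2, hg.2, hgi.continuousAt.eventually_ne hi] with s ⟨h1, e1⟩ ⟨h2, e2⟩ hs
  obtain ⟨a, ha⟩ := (Projectivization.mk_eq_mk_iff' ℝ _ _ h1 h2).1 (e1.symm.trans e2)
  have : a = f s i / g s i := by rw [← ha]; simp at hs ⊢; field_simp
  simp only [Pi.smul_apply', ← this, ha]

lemma span_derivs_le (hf : ContDiffAt ℝ ∞ g t) {c : ℝ → ℝ} (hc : ContDiffAt ℝ ∞ c t)
    (h : f =ᶠ[𝓝 t] c • g) (k : ℕ) :
    Submodule.span ℝ {v | ∃ i < k, v = iteratedDeriv i f t}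
      ≤ Submodule.span ℝ {v | ∃ i < k, v = iteratedDeriv i g t} := by
  rw [Submodule.span_le]
  rintro v ⟨i, hi, rfl⟩
  rw [h.iteratedDeriv_eq]
  rw [SetLike.mem_coe, ← iteratedDerivWithin_univ, iteratedDerivWithin_smul (Set.mem_univ t) uniqueDiffOn_univ
    (hc.of_le (by exact_mod_cast le_top)).contDiffWithinAt
    (hf.of_le (by exact_mod_cast le_top)).contDiffWithinAt]
  refine Submodule.sum_mem _ fun j hj => ?_
  have : iteratedDerivWithin (i - j) g Set.univ t ∈
      Submodule.span ℝ {v | ∃ i < k, v = iteratedDeriv i g t} :=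
    Submodule.subset_span ⟨i - j, by omega, by rw [iteratedDerivWithin_univ]⟩
  exact nsmul_mem (Submodule.smul_mem _ _ this) _

lemma IsLocalLift.comp_add {s : ℝ} {m : ℤ} (hf : IsLocalLift γ s f)
    (h : s = t + m * (2 * Real.pi)) : IsLocalLift γ t fun u => f (u + m * (2 * Real.pi)) := by
  refine ⟨?_, ?_⟩
  · refine ContDiffAt.comp t (g := f) (by rw [← h]; exact hf.1) (by fun_prop)
  · have h1 : Filter.Tendsto (fun u => u + m * (2 * Real.pi)) (𝓝 t) (𝓝 s) := by
      rw [h]; exact (continuous_add_const _).tendsto t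
    filter_upwards [h1.eventually hf.2] with u ⟨h2, h3⟩
    refine ⟨h2, ?_⟩
    rw [← h3]
    congr 1
    exact Circle.exp_eq_exp.2 ⟨-m, by push_cast; ring⟩

/-- Any single lift suffices: by the Leibniz rule, multiplication by a smooth function and
translation by a period do not enlarge the span of the derivatives. -/
lemma osculating_eq_span (hf : IsLocalLift γ t f) (k : ℕ) :
    osculating γ k (Circle.exp t) = Submodule.span ℝ {v | ∃ i < k, v = iteratedDeriv i f t} := by
  refine le_antisymm ?_ ?_
  · refine iSup_le fun s => iSup_le fun hs => iSup_le fun g => iSup_le fun hg => ?_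
    obtain ⟨m, hm⟩ := Circle.exp_eq_exp.1 hs
    have h1 := hg.comp_add hm
    obtain ⟨c, hc, hc'⟩ := h1.exists_smul hf
    have h2 := span_derivs_le hf.1 hc hc' k
    simp only [iteratedDeriv_comp_add_const] at h2
    rwa [hm]
  · exact le_iSup_of_le t (le_iSup_of_le rfl (le_iSup_of_le f (le_iSup_of_le hf le_rfl)))

lemma le_vanishingOrder {g : ℝ → ℝ} {t : ℝ} {k : ℕ} (h : ∀ j < k, iteratedDeriv j g t = 0) :
    (k : ℕ∞) ≤ vanishingOrder g t := by
  refine le_iInf fun m => le_iInf fun hm => ?_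
  by_contra hlt
  push Not at hlt
  exact hm (h m (by exact_mod_cast hlt))

lemma iteratedDeriv_clm (ℓ : (Fin n → ℝ) →L[ℝ] ℝ) (hf : ContDiffAt ℝ ∞ f t) (k : ℕ) :
    iteratedDeriv k (fun s => ℓ (f s)) t = ℓ (iteratedDeriv k f t) := by
  rw [iteratedDeriv_eq_iteratedFDeriv, iteratedDeriv_eq_iteratedFDeriv]
  have := ℓ.iteratedFDeriv_comp_left (hf.of_le (m := k) (by exact_mod_cast le_top)) le_rfl
  change (iteratedFDeriv ℝ k (ℓ ∘ f) t) _ = _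
  rw [this]; rfl

lemma le_multiplicity (hγ : IsSmooth γ) {ℓ : (Fin n → ℝ) →L[ℝ] ℝ} {z : Circle} {k : ℕ}
    (h : ∀ v ∈ osculating γ k z, ℓ v = 0) : (k : ℕ∞) ≤ multiplicity γ ℓ z := by
  obtain ⟨t, rfl⟩ := Circle.exp_surjective z
  obtain ⟨f, hf⟩ := hγ t
  refine le_trans ?_ (le_iSup_of_le t (le_iSup_of_le rfl (le_iSup_of_le f (le_iSup_of_le hf le_rfl))))
  refine le_vanishingOrder fun j hj => ?_
  rw [iteratedDeriv_clm ℓ hf.1]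
  apply h
  rw [osculating_eq_span hf]
  exact Submodule.subset_span ⟨j, hj, rfl⟩

/-- A linear form that vanishes on osculating subspaces of total dimension `n` of a convex curve
is zero. -/
lemma IsConvex.form_eq_zero (hn : 1 ≤ n) (hγ : IsConvex γ) (s : Finset Circle) (m : Circle → ℕ)
    (hm : n ≤ ∑ z ∈ s, m z) (ℓ : (Fin n → ℝ) →L[ℝ] ℝ)
    (h : ∀ z ∈ s, ∀ v ∈ osculating γ (m z) z, ℓ v = 0) : ℓ = 0 := by
  by_contra h0
  have h1 := hγ.2 ℓ h0 s
  have h2 : ((n : ℕ) : ℕ∞) ≤ ((n - 1 : ℕ) : ℕ∞) := by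
    calc ((n : ℕ) : ℕ∞) ≤ ((∑ z ∈ s, m z : ℕ) : ℕ∞) := by exact_mod_cast hm
      _ = ∑ z ∈ s, (m z : ℕ∞) := by push_cast; rfl
      _ ≤ ∑ z ∈ s, multiplicity γ ℓ z := Finset.sum_le_sum fun z hz => le_multiplicity hγ.1 (h z hz)
      _ ≤ _ := h1
  have h3 : n ≤ n - 1 := by exact_mod_cast h2
  omega

lemma eq_top_of_forms {W : Submodule ℝ (Fin n → ℝ)}
    (h : ∀ ℓ : (Fin n → ℝ) →L[ℝ] ℝ, (∀ v ∈ W, ℓ v = 0) → ℓ = 0) : W = ⊤ := by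
  by_contra hW
  obtain ⟨ℓ, h0, h1⟩ := W.exists_le_ker_of_lt_top (lt_top_iff_ne_top.2 hW)
  refine h0 ?_
  have := h (LinearMap.toContinuousLinearMap ℓ) fun v hv => h1 hv
  ext v
  simpa using congrArg (fun g => g (Pi.single v 1)) this

lemma IsConvex.osculating_eq_top (hn : 1 ≤ n) (hγ : IsConvex γ) (z : Circle) :
    osculating γ n z = ⊤ :=
  eq_top_of_forms fun ℓ h => hγ.form_eq_zero hn {z} (fun _ => n) (by simp) ℓ (by simpa using h)

lemma IsConvex.linearIndependent (hn : 1 ≤ n) (hγ : IsConvex γ) (hf : IsLocalLift γ t f) :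
    LinearIndependent ℝ fun i : Fin n => iteratedDeriv i f t := by
  refine linearIndependent_of_top_le_span_of_card_eq_finrank ?_ (by simp)
  rw [← hγ.osculating_eq_top hn (Circle.exp t), osculating_eq_span hf]
  refine Submodule.span_mono ?_
  rintro v ⟨i, hi, rfl⟩
  exact ⟨⟨i, hi⟩, rfl⟩

lemma span_derivs_eq_range (f : ℝ → Fin n → ℝ) (t : ℝ) (k : ℕ) :
    {v | ∃ i < k, v = iteratedDeriv i f t} = Set.range fun i : Fin k => iteratedDeriv i f t := by
  ext v
  constructor
  · rintro ⟨i, hi, rfl⟩; exact ⟨⟨i, hi⟩, rfl⟩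
  · rintro ⟨i, rfl⟩; exact ⟨i, i.2, rfl⟩

lemma IsConvex.finrank_osculating (hn : 1 ≤ n) (hγ : IsConvex γ) {k : ℕ} (hk : k ≤ n)
    (z : Circle) : Module.finrank ℝ (osculating γ k z) = k := by
  obtain ⟨t, rfl⟩ := Circle.exp_surjective z
  obtain ⟨f, hf⟩ := hγ.1 t
  rw [osculating_eq_span hf, span_derivs_eq_range, finrank_span_eq_card, Fintype.card_fin]
  exact (hγ.linearIndependent hn hf).comp (Fin.castLE hk) (Fin.castLE_injective hk)

/-- A form vanishing on both spaces would have total multiplicity `n`, so they span everything;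
their dimensions add up to `n`, so they meet trivially. -/
lemma IsConvex.disjoint_osculating (hn : 1 ≤ n) (hγ : IsConvex γ) {k : ℕ} (hk : k ≤ n)
    {z w : Circle} (hzw : z ≠ w) : osculating γ (n - k) z ⊓ osculating γ k w = ⊥ := by
  classical
  have h1 : osculating γ (n - k) z ⊔ osculating γ k w = ⊤ := by
    refine eq_top_of_forms fun ℓ h => ?_
    refine hγ.form_eq_zero hn {z, w} (fun x => if x = z then n - k else k) ?_ ℓ ?_
    · rw [Finset.sum_pair hzw]; simp [hzw.symm]; omega
    · intro x hx v hv
      simp only [Finset.mem_insert, Finset.mem_singleton] at hx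
      rcases hx with rfl | rfl
      · rw [if_pos rfl] at hv; exact h v (Submodule.mem_sup_left hv)
      · rw [if_neg hzw.symm] at hv; exact h v (Submodule.mem_sup_right hv)
  have h2 := Submodule.finrank_sup_add_finrank_inf_eq (osculating γ (n - k) z) (osculating γ k w)
  rw [h1, hγ.finrank_osculating hn (by omega), hγ.finrank_osculating hn hk, finrank_top,
    Module.finrank_fin_fun] at h2
  exact Submodule.finrank_eq_zero.1 (by omega)

lemma osculating_mono (γ : Circle → RP n) {k l : ℕ} (h : k ≤ l) (z : Circle) :
    osculating γ k z ≤ osculating γ l z := by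
  refine iSup_mono fun t => iSup_mono fun _ => iSup_mono fun f => iSup_mono fun _ => ?_
  refine Submodule.span_mono ?_
  rintro v ⟨i, hi, rfl⟩
  exact ⟨i, hi.trans_le h, rfl⟩

end Lifts

/-! ### Moving frames on the circle without a point. -/

/-- The parameters of the circle without the point `exp (i θ)`. -/
def arc (θ : ℝ) : Set ℝ := Set.Ioo θ (θ + 2 * Real.pi)

lemma isOpen_arc (θ : ℝ) : IsOpen (arc θ) := isOpen_Ioo

lemma exp_ne_of_mem_arc {θ t : ℝ} (ht : t ∈ arc θ) : Circle.exp θ ≠ Circle.exp t := by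
  intro h
  obtain ⟨m, hm⟩ := Circle.exp_eq_exp.1 h
  have h1 := ht.1
  have h2 := ht.2
  have hpi := Real.pi_pos
  have h3 : (m : ℝ) < 0 := by
    by_contra hge; push Not at hge
    have : 0 ≤ (m : ℝ) * (2 * Real.pi) := by positivity
    linarith
  have h4 : m ≤ -1 := by
    have : m < 0 := by exact_mod_cast h3
    omega
  have h5 : (m : ℝ) ≤ -1 := by exact_mod_cast h4
  nlinarith

lemma exp_injOn_arc (θ : ℝ) : Set.InjOn Circle.exp (arc θ) := by
  intro s hs t ht h
  obtain ⟨m, hm⟩ := Circle.exp_eq_exp.1 h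
  have hpi := Real.pi_pos
  have h1 := hs.1
  have h2 := hs.2
  have h3 := ht.1
  have h4 := ht.2
  have h5 : (m : ℝ) < 1 := by
    by_contra hge; push Not at hge
    nlinarith
  have h6 : -1 < (m : ℝ) := by
    by_contra hge; push Not at hge
    nlinarith
  have : m = 0 := by
    have : m < 1 := by exact_mod_cast h5
    have : -1 < m := by exact_mod_cast h6
    omega
  rw [hm, this]; simp

lemma exists_mem_arc {θ : ℝ} {z : Circle} (hz : z ≠ Circle.exp θ) :
    ∃ t ∈ arc θ, Circle.exp t = z := by
  obtain ⟨s, rfl⟩ := Circle.exp_surjective z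
  have hpi := Real.pi_pos
  obtain ⟨m, hm, -⟩ := existsUnique_add_zsmul_mem_Ico (show 0 < 2 * Real.pi by positivity) s θ
  rw [zsmul_eq_mul] at hm
  have he : Circle.exp (s + m * (2 * Real.pi)) = Circle.exp s := Circle.exp_eq_exp.2 ⟨m, rfl⟩
  refine ⟨_, ⟨lt_of_le_of_ne hm.1 fun h => hz ?_, hm.2⟩, he⟩
  rw [← he, ← h]

section Comb

variable {E : Type*} [NormedAddCommGroup E] [NormedSpace ℝ E] {I : Set ℝ}

lemma contDiffOn_deriv {f : ℝ → E} (hI : IsOpen I) (hf : ContDiffOn ℝ ∞ f I) :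
    ContDiffOn ℝ ∞ (deriv f) I :=
  hf.deriv_of_isOpen hI (by simp)

lemma hasDerivAt_of_contDiffOn {f : ℝ → E} (hI : IsOpen I) (hf : ContDiffOn ℝ ∞ f I) {t : ℝ}
    (ht : t ∈ I) : HasDerivAt f (deriv f t) t :=
  ((hf.contDiffAt (hI.mem_nhds ht)).differentiableAt (by simp)).hasDerivAt

lemma exists_deriv_eq_sum (hI : IsOpen I) {e : ℕ → ℝ → E} {c x : ℕ → ℝ → ℝ} {m : ℕ}
    (he : ∀ j < m, ContDiffOn ℝ ∞ (e j) I) (hc : ∀ j < m, ContDiffOn ℝ ∞ (c j) I)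
    (hx : ∀ j < m, ContDiffOn ℝ ∞ (x j) I)
    (hd : ∀ j < m, ∀ t ∈ I, deriv (e j) t = c j t • e (j + 1) t) {g : ℝ → E}
    (hg : ∀ t ∈ I, g t = ∑ j ∈ Finset.range m, x j t • e j t) :
    ∃ y : ℕ → ℝ → ℝ, (∀ j < m + 1, ContDiffOn ℝ ∞ (y j) I) ∧
      ∀ t ∈ I, deriv g t = ∑ j ∈ Finset.range (m + 1), y j t • e j t := by
  refine ⟨fun j t => (if j < m then deriv (x j) t else 0)
    + (if 0 < j then x (j - 1) t * c (j - 1) t else 0), ?_, ?_⟩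
  · intro j hj
    refine ContDiffOn.add ?_ ?_
    · split_ifs with h
      exacts [contDiffOn_deriv hI (hx j h), contDiffOn_const]
    · split_ifs with h
      exacts [(hx _ (by omega)).mul (hc _ (by omega)), contDiffOn_const]
  · intro t ht
    have h1 : g =ᶠ[𝓝 t] fun t => ∑ j ∈ Finset.range m, x j t • e j t :=
      Filter.eventually_of_mem (hI.mem_nhds ht) hg
    have h2 : HasDerivAt (fun t => ∑ j ∈ Finset.range m, x j t • e j t)
        (∑ j ∈ Finset.range m, (x j t • deriv (e j) t + deriv (x j) t • e j t)) t :=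
      HasDerivAt.fun_sum fun j hj =>
        (hasDerivAt_of_contDiffOn hI (hx j (Finset.mem_range.1 hj)) ht).smul
          (hasDerivAt_of_contDiffOn hI (he j (Finset.mem_range.1 hj)) ht)
    rw [h1.deriv_eq, h2.deriv, Finset.sum_add_distrib]
    simp only [add_smul, Finset.sum_add_distrib]
    rw [add_comm]
    congr 1
    · rw [Finset.sum_range_succ]
      simp only [lt_irrefl, if_false, zero_smul, add_zero]
      exact Finset.sum_congr rfl fun j hj => by rw [if_pos (Finset.mem_range.1 hj)]
    · rw [Finset.sum_range_succ']
      simp only [lt_irrefl, if_false, zero_smul, add_zero, Nat.succ_pos, if_true,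
        Nat.add_sub_cancel]
      exact Finset.sum_congr rfl fun j hj => by
        rw [hd j (Finset.mem_range.1 hj) t ht, smul_smul]

lemma exists_iteratedDeriv_eq_sum (hI : IsOpen I) {e : ℕ → ℝ → E} {c : ℕ → ℝ → ℝ} {k : ℕ}
    (he : ∀ j < k, ContDiffOn ℝ ∞ (e j) I) (hc : ∀ j < k, ContDiffOn ℝ ∞ (c j) I)
    (hd : ∀ j < k, ∀ t ∈ I, deriv (e j) t = c j t • e (j + 1) t) (s : ℕ) (hs : s ≤ k) :
    ∃ x : ℕ → ℝ → ℝ, (∀ j < s + 1, ContDiffOn ℝ ∞ (x j) I) ∧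
      ∀ t ∈ I, iteratedDeriv s (e 0) t = ∑ j ∈ Finset.range (s + 1), x j t • e j t := by
  induction s with
  | zero => exact ⟨fun _ _ => 1, fun _ _ => contDiffOn_const, fun t _ => by simp⟩
  | succ s ih =>
    obtain ⟨x, hx, hx'⟩ := ih (by omega)
    obtain ⟨y, hy, hy'⟩ := exists_deriv_eq_sum hI (fun j hj => he j (by omega))
      (fun j hj => hc j (by omega)) hx (fun j hj => hd j (by omega)) hx'
    exact ⟨y, hy, fun t ht => by rw [iteratedDeriv_succ, hy' t ht]⟩

end Comb

section Frame

variable {n : ℕ} {γ : Circle → RP n}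

/-- The derivatives of `e 0` of order below `m` are combinations of the first `m` vectors, and
convexity makes the osculating space `m`-dimensional. Independence of the vectors is thus a
consequence, not an assumption. -/
lemma IsConvex.osculating_eq_span_frame (hn : 1 ≤ n) (hγ : IsConvex γ) {I : Set ℝ} (hI : IsOpen I)
    {e : ℕ → ℝ → Fin n → ℝ} {c : ℕ → ℝ → ℝ} {k : ℕ} (hlift : ∀ t ∈ I, IsLocalLift γ t (e 0))
    (he : ∀ j < k, ContDiffOn ℝ ∞ (e j) I) (hc : ∀ j < k, ContDiffOn ℝ ∞ (c j) I)
    (hd : ∀ j < k, ∀ t ∈ I, deriv (e j) t = c j t • e (j + 1) t) {m : ℕ} (hm : m ≤ k + 1)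
    (hmn : m ≤ n) {t : ℝ} (ht : t ∈ I) :
    osculating γ m (Circle.exp t) = Submodule.span ℝ (Set.range fun j : Fin m => e j t) := by
  refine Submodule.eq_of_le_of_finrank_le ?_ ?_
  · rw [osculating_eq_span (hlift t ht), Submodule.span_le]
    rintro v ⟨s, hs, rfl⟩
    obtain ⟨x, -, hx⟩ := exists_iteratedDeriv_eq_sum hI he hc hd s (by omega)
    rw [hx t ht]
    refine Submodule.sum_mem _ fun j hj => Submodule.smul_mem _ _ (Submodule.subset_span ?_)
    exact ⟨⟨j, by have := Finset.mem_range.1 hj; omega⟩, rfl⟩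
  · rw [hγ.finrank_osculating hn hmn]
    exact (finrank_range_le_card _).trans (by simp)

/-- Coordinates adapted to the osculating flag at a point. -/
lemma IsConvex.exists_flag_coord (hn : 1 ≤ n) (hγ : IsConvex γ) (z : Circle) :
    ∃ α : ℕ → (Fin n → ℝ) →L[ℝ] ℝ, ∀ k ≤ n, ∀ v, v ∈ osculating γ k z ↔
      ∀ j, k ≤ j → j < n → α j v = 0 := by
  obtain ⟨t, rfl⟩ := Circle.exp_surjective z
  obtain ⟨f, hf⟩ := hγ.1 t
  have hli := hγ.linearIndependent hn hf
  let B := basisOfLinearIndependentOfCardEqFinrank' _ hli (by simp)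
  have hB : ∀ i : Fin n, B i = iteratedDeriv i f t := fun i => by simp [B]
  refine ⟨fun j => if h : j < n then LinearMap.toContinuousLinearMap (B.coord ⟨j, h⟩) else 0,
    fun k hk v => ?_⟩
  have h1 : osculating γ k (Circle.exp t) = Submodule.span ℝ (B '' {i : Fin n | (i : ℕ) < k}) := by
    rw [osculating_eq_span hf]
    congr 1
    ext v
    constructor
    · rintro ⟨i, hi, rfl⟩; exact ⟨⟨i, by omega⟩, hi, hB _⟩
    · rintro ⟨i, hi, rfl⟩; exact ⟨i, hi, hB _⟩
  rw [h1, B.mem_span_image]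
  constructor
  · intro h j hkj hj
    simp only [hj, dif_pos]
    by_contra h0
    have : (⟨j, hj⟩ : Fin n) ∈ (B.repr v).support := by
      rw [Finsupp.mem_support_iff]; simpa using h0
    have := h this
    simp only [Set.mem_ofPred_eq] at this
    omega
  · intro h i hi
    by_contra h0
    simp only [Set.mem_ofPred_eq, not_lt] at h0
    have := h i h0 i.2
    simp only [i.2, dif_pos] at this
    simp only [Finset.mem_coe, Finsupp.mem_support_iff] at hi
    exact hi (by simpa using this)

/-- A curve with its derivatives, each normalized by a linear form. -/
noncomputable def normalizedDerivs (α : ℕ → (Fin n → ℝ) →L[ℝ] ℝ) (F : ℝ → Fin n → ℝ) :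
    ℕ → ℝ → Fin n → ℝ
  | 0 => F
  | i + 1 => fun t => (α i (deriv (normalizedDerivs α F i) t))⁻¹ •
      deriv (normalizedDerivs α F i) t

/-- The form `α (n - 1)` defines the osculating hyperplane at `exp (i θ)`, where it already vanishes
to order `n - 1`. Convexity leaves it no other zero on the curve, so the rest of the curve lies in
an affine chart. -/
lemma IsConvex.exists_lift (hn : 1 ≤ n) (hγ : IsConvex γ) {θ : ℝ}
    {α : ℕ → (Fin n → ℝ) →L[ℝ] ℝ} (hα : ∀ k ≤ n, ∀ v, v ∈ osculating γ k (Circle.exp θ) ↔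
      ∀ j, k ≤ j → j < n → α j v = 0) :
    ∃ F : ℝ → Fin n → ℝ, ∀ t ∈ arc θ, IsLocalLift γ t F ∧ α (n - 1) (F t) = 1 := by
  classical
  have hα0 : α (n - 1) ≠ 0 := by
    intro h0
    have h1 : osculating γ (n - 1) (Circle.exp θ) = ⊤ := by
      refine Submodule.eq_top_iff'.2 fun v => (hα (n - 1) (by omega) v).2 fun j h2 h3 => ?_
      rw [show j = n - 1 by omega, h0]; rfl
    have h2 := hγ.finrank_osculating hn (show n - 1 ≤ n by omega) (Circle.exp θ)
    rw [h1, finrank_top, Module.finrank_fin_fun] at h2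
    omega
  have key : ∀ t ∈ arc θ, ∀ f, IsLocalLift γ t f → α (n - 1) (f t) ≠ 0 := by
    intro t ht f hf h0
    have hne := exp_ne_of_mem_arc ht
    refine hα0 (hγ.form_eq_zero hn {Circle.exp θ, Circle.exp t}
      (fun z => if z = Circle.exp θ then n - 1 else 1) ?_ _ ?_)
    · rw [Finset.sum_pair hne]; simp [hne.symm]; omega
    · intro z hz v hv
      simp only [Finset.mem_insert, Finset.mem_singleton] at hz
      rcases hz with rfl | rfl
      · rw [if_pos rfl] at hv
        exact (hα (n - 1) (by omega) v).1 hv _ le_rfl (by omega)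
      · rw [if_neg hne.symm, osculating_eq_span hf] at hv
        have : {v | ∃ i < 1, v = iteratedDeriv i f t} = {f t} := by
          ext v; simp
        rw [this] at hv
        obtain ⟨c, rfl⟩ := Submodule.mem_span_singleton.1 hv
        rw [map_smul, h0, smul_zero]
  refine ⟨fun t => (α (n - 1) (γ (Circle.exp t)).rep)⁻¹ • (γ (Circle.exp t)).rep, fun t ht => ?_⟩
  obtain ⟨f, hf⟩ := hγ.1 t
  have hft := key t ht f hf
  have hev : (fun t => (α (n - 1) (γ (Circle.exp t)).rep)⁻¹ • (γ (Circle.exp t)).rep)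
      =ᶠ[𝓝 t] fun s => (α (n - 1) (f s))⁻¹ • f s := by
    filter_upwards [hf.2] with s ⟨h1, h2⟩
    obtain ⟨a, ha⟩ := Projectivization.exists_smul_eq_mk_rep ℝ (f s) h1
    rw [h2, ← ha, Units.smul_def, map_smul, smul_smul, smul_eq_mul, mul_inv]
    congr 1
    have := a.ne_zero
    field_simp
  have hsm : ContDiffAt ℝ ∞ (fun s => (α (n - 1) (f s))⁻¹ • f s) t := by
    have : ContDiffAt ℝ ∞ (fun s => α (n - 1) (f s)) t := (α (n - 1)).contDiff.contDiffAt.comp t hf.1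
    exact (this.inv hft).smul hf.1
  refine ⟨⟨hsm.congr_of_eventuallyEq hev, ?_⟩, ?_⟩
  · have h3 : ∀ᶠ s in 𝓝 t, α (n - 1) (f s) ≠ 0 :=
      ((α (n - 1)).continuous.continuousAt.comp hf.1.continuousAt).eventually_ne hft
    filter_upwards [hf.2, h3, hev] with s ⟨h1, h2⟩ h3 h4
    have h5 : (α (n - 1) (γ (Circle.exp s)).rep)⁻¹ • (γ (Circle.exp s)).rep ≠ 0 := by
      rw [h4]; exact smul_ne_zero (inv_ne_zero h3) h1
    refine ⟨h5, ?_⟩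
    refine h2.trans ?_
    rw [Projectivization.mk_eq_mk_iff']
    refine ⟨α (n - 1) (f s), ?_⟩
    rw [h4, smul_smul, mul_inv_cancel₀ h3, one_smul]
  · rw [hev.self_of_nhds, map_smul, smul_eq_mul, inv_mul_cancel₀ hft]

/-- A moving frame on the circle without a point, adapted to the osculating flags of a convex
curve, in which each vector moves in the direction of the next one. -/
lemma IsConvex.exists_frame (hn : 1 ≤ n) (hγ : IsConvex γ) (θ : ℝ) :
    ∃ (e : ℕ → ℝ → Fin n → ℝ) (b : ℕ → ℝ → ℝ), (∀ i < n, ContDiffOn ℝ ∞ (e i) (arc θ)) ∧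
      (∀ i, i + 1 < n → ContDiffOn ℝ ∞ (b i) (arc θ) ∧ ∀ t ∈ arc θ, b i t ≠ 0) ∧
      (∀ i, i + 1 < n → ∀ t ∈ arc θ, HasDerivAt (e i) (b i t • e (i + 1) t) t) ∧
      (∀ t ∈ arc θ, HasDerivAt (e (n - 1)) 0 t) ∧
      ∀ m ≤ n, ∀ t ∈ arc θ, osculating γ m (Circle.exp t)
        = Submodule.span ℝ (Set.range fun j : Fin m => e j t) := by
  obtain ⟨α, hα⟩ := hγ.exists_flag_coord hn (Circle.exp θ)
  obtain ⟨F, hF⟩ := hγ.exists_lift hn hα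
  have hI := isOpen_arc θ
  -- The coordinates `α (n - 1), …, α (n - 1 - i)` of `e i` are constant, so they vanish on `deriv
  -- (e i)`; `α (n - 2 - i)` is the next one in the flag.
  set α' : ℕ → (Fin n → ℝ) →L[ℝ] ℝ := fun i => α (n - 2 - i) with hα'
  set e := normalizedDerivs α' F with he
  set b : ℕ → ℝ → ℝ := fun i t => α' i (deriv (e i) t) with hb
  have hsucc : ∀ i t, e (i + 1) t = (b i t)⁻¹ • deriv (e i) t := fun i t => rfl
  have hdiff : ∀ (f : ℝ → Fin n → ℝ), ContDiffOn ℝ ∞ f (arc θ) → ∀ t ∈ arc θ,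
      HasDerivAt f (deriv f t) t := fun f hf t ht =>
    ((hf.contDiffAt (hI.mem_nhds ht)).differentiableAt (by simp)).hasDerivAt
  have hbsm : ∀ i, ContDiffOn ℝ ∞ (e i) (arc θ) → ContDiffOn ℝ ∞ (b i) (arc θ) := fun i hi =>
    (α' i).contDiff.comp_contDiffOn (contDiffOn_deriv hI hi)
  have hlift : ∀ t ∈ arc θ, IsLocalLift γ t (e 0) := fun t ht => (hF t ht).1
  have main : ∀ i < n, ContDiffOn ℝ ∞ (e i) (arc θ) ∧ (∀ t ∈ arc θ, α (n - 1 - i) (e i t) = 1) ∧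
      (∀ r < i, ∀ t ∈ arc θ, α (n - 1 - r) (e i t) = 0) ∧ ∀ j < i, ∀ t ∈ arc θ, b j t ≠ 0 := by
    intro i
    induction i using Nat.strong_induction_on with
    | _ i ih =>
      intro hi
      rcases i with _ | i
      · exact ⟨fun t ht => (hF t ht).1.1.contDiffWithinAt, fun t ht => (hF t ht).2,
          fun r hr => absurd hr (by omega), fun j hj => absurd hj (by omega)⟩
      obtain ⟨h1, h2, h3, h4⟩ := ih i (by omega) (by omega)
      have hsm : ∀ j < i + 1, ContDiffOn ℝ ∞ (e j) (arc θ) := fun j hj => (ih j hj (by omega)).1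
      have hz : ∀ r ≤ i, ∀ t ∈ arc θ, α (n - 1 - r) (deriv (e i) t) = 0 := by
        intro r hr t ht
        have hder : HasDerivAt (fun s => α (n - 1 - r) (e i s))
          (α (n - 1 - r) (deriv (e i) t)) t :=
          (α (n - 1 - r)).hasFDerivAt.comp_hasDerivAt t (hdiff _ h1 t ht)
        obtain ⟨C, hC⟩ : ∃ C, ∀ s ∈ arc θ, α (n - 1 - r) (e i s) = C := by
          rcases hr.lt_or_eq with h | rfl
          · exact ⟨0, h3 r h⟩
          · exact ⟨1, h2⟩
        have hconst : (fun s => α (n - 1 - r) (e i s)) =ᶠ[𝓝 t] fun _ => C :=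
          Filter.eventually_of_mem (hI.mem_nhds ht) hC
        exact hder.unique ((hasDerivAt_const t C).congr_of_eventuallyEq hconst)
      -- If `b i t` vanished, `deriv (e i) t` would lie in the osculating spaces of dimension `n -
      -- (i + 2)` at `exp (i θ)` and `i + 2` at `exp (i t)`, which meet trivially. Yet it completes
      -- a basis of the latter, as the family `E` shows.
      have hb0 : ∀ t ∈ arc θ, b i t ≠ 0 := by
        intro t ht h0
        set E : ℕ → ℝ → Fin n → ℝ := fun j => if j ≤ i then e j else deriv (e i) with hE
        have hspan := hγ.osculating_eq_span_frame hn hI (e := E)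
          (c := fun j => if j < i then b j else fun _ => 1) (k := i + 1) (m := i + 2)
          (by simpa [E] using hlift)
          (fun j hj => by simp only [hE, show j ≤ i by omega, if_true]; exact hsm j hj)
          (fun j hj => by
            split_ifs
            exacts [hbsm j (hsm j hj), contDiffOn_const])
          (fun j hj s hs => by
            rcases (show j ≤ i by omega).lt_or_eq with h | rfl
            · simp only [hE, h, h.le, show j + 1 ≤ i by omega, if_true]
              rw [hsucc, smul_smul, mul_inv_cancel₀ (h4 j h s hs), one_smul]
            · simp [hE])
          le_rfl (by omega) ht
        have hfr := hγ.finrank_osculating hn (show i + 2 ≤ n by omega) (Circle.exp t)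
        rw [hspan] at hfr
        have hli : LinearIndependent ℝ fun j : Fin (i + 2) => E j t :=
          linearIndependent_iff_card_eq_finrank_span.2 (by simpa [Set.finrank] using hfr.symm)
        have hne := hli.ne_zero (⟨i + 1, by omega⟩ : Fin (i + 2))
        apply hne
        have hEi : E (i + 1) t = deriv (e i) t := by simp [hE]
        change E (i + 1) t = 0
        rw [hEi]
        have hmem : deriv (e i) t ∈ osculating γ (n - (i + 2)) (Circle.exp θ)
            ⊓ osculating γ (i + 2) (Circle.exp t) := by
          refine ⟨(hα _ (by omega) _).2 fun j h5 h6 => ?_, ?_⟩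
          · by_cases h7 : j = n - 2 - i
            · rw [h7]; exact h0
            · have := hz (n - 1 - j) (by omega) t ht
              rwa [show n - 1 - (n - 1 - j) = j by omega] at this
          · rw [hspan]
            exact Submodule.subset_span ⟨⟨i + 1, by omega⟩, hEi⟩
        rw [hγ.disjoint_osculating hn (by omega) (exp_ne_of_mem_arc ht)] at hmem
        exact hmem
      refine ⟨((hbsm i h1).inv hb0).smul (contDiffOn_deriv hI h1), ?_, ?_, ?_⟩
      · intro t ht
        rw [hsucc, map_smul, show n - 1 - (i + 1) = n - 2 - i by omega, smul_eq_mul]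
        exact inv_mul_cancel₀ (hb0 t ht)
      · intro r hr t ht
        rw [hsucc, map_smul, hz r (by omega) t ht, smul_zero]
      · intro j hj
        rcases (show j ≤ i by omega).lt_or_eq with h | rfl
        exacts [h4 j h, hb0]
  have hb0 : ∀ i, i + 1 < n → ∀ t ∈ arc θ, b i t ≠ 0 := fun i hi => (main (i + 1) hi).2.2.2 i (by omega)
  have hder : ∀ i, i + 1 < n → ∀ t ∈ arc θ, deriv (e i) t = b i t • e (i + 1) t := by
    intro i hi t ht
    rw [hsucc, smul_smul, mul_inv_cancel₀ (hb0 i hi t ht), one_smul]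
  refine ⟨e, b, fun i hi => (main i hi).1, fun i hi => ⟨hbsm i (main i (by omega)).1, hb0 i hi⟩,
    fun i hi t ht => ?_, fun t ht => ?_, fun m hm t ht => ?_⟩
  · rw [← hder i hi t ht]
    exact hdiff _ (main i (by omega)).1 t ht
  · obtain ⟨h1, h2, h3, h4⟩ := main (n - 1) (by omega)
    have h5 := hdiff _ h1 t ht
    -- All flag coordinates of the last frame vector are constant.
    have h6 : deriv (e (n - 1)) t = 0 := by
      have h7 : deriv (e (n - 1)) t ∈ osculating γ 0 (Circle.exp θ) := by
        refine (hα 0 (by omega) _).2 fun j _ hj => ?_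
        have hder : HasDerivAt (fun s => α j (e (n - 1) s)) (α j (deriv (e (n - 1)) t)) t :=
          (α j).hasFDerivAt.comp_hasDerivAt t h5
        obtain ⟨C, hC⟩ : ∃ C, ∀ s ∈ arc θ, α j (e (n - 1) s) = C := by
          rcases Nat.eq_zero_or_pos j with rfl | h
          · refine ⟨1, ?_⟩
            simpa using h2
          · refine ⟨0, ?_⟩
            have := h3 (n - 1 - j) (by omega)
            rwa [show n - 1 - (n - 1 - j) = j by omega] at this
        have hconst : (fun s => α j (e (n - 1) s)) =ᶠ[𝓝 t] fun _ => C :=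
          Filter.eventually_of_mem (hI.mem_nhds ht) hC
        exact hder.unique ((hasDerivAt_const t C).congr_of_eventuallyEq hconst)
      have h8 := hγ.finrank_osculating hn (Nat.zero_le n) (Circle.exp θ)
      rw [Submodule.finrank_eq_zero.1 h8] at h7
      exact h7
    rwa [h6] at h5
  · refine hγ.osculating_eq_span_frame hn hI (k := n - 1) hlift (fun j hj => (main j (by omega)).1)
      (fun j hj => hbsm j (main j (by omega)).1) (fun j hj => hder j (by omega)) (by omega) hm ht

end Frame

/-! ### Charts: the dual frame with normalized signs. -/

/-- Linear forms describing the osculating flags of a curve on the circle without the point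
`exp (i θ)`, the derivative of each being a positive multiple of the next one. -/
structure Chart {n : ℕ} (γ : Circle → RP n) (θ : ℝ) where
  /-- the linear forms -/
  q : ℕ → ℝ → (Fin n → ℝ) →L[ℝ] ℝ
  /-- the factors -/
  β : ℕ → ℝ → ℝ
  contDiffOn_q : ∀ i, ContDiffOn ℝ ∞ (q i) (arc θ)
  contDiffOn_β : ∀ i, ContDiffOn ℝ ∞ (β i) (arc θ)
  β_pos : ∀ i, ∀ t ∈ arc θ, 0 < β i t
  hasDerivAt_q : ∀ i, ∀ t ∈ arc θ, HasDerivAt (q i) (β i t • q (i + 1) t) t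
  q_eq_zero : ∀ i ≥ n, ∀ t, q i t = 0
  mem_iff : ∀ m ≤ n, ∀ t ∈ arc θ, ∀ v, v ∈ osculating γ (n - m) (Circle.exp t) ↔
    ∀ j < m, q j t v = 0

lemma exists_sign {b : ℝ → ℝ} {s : Set ℝ} (hs : IsPreconnected s) (hb : ContinuousOn b s)
    (h0 : ∀ t ∈ s, b t ≠ 0) : ∃ σ : ℝ, σ * σ = 1 ∧ ∀ t ∈ s, 0 < σ * b t := by
  by_cases h : ∀ t ∈ s, 0 < b t
  · exact ⟨1, by norm_num, fun t ht => by simpa using h t ht⟩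
  · push Not at h
    obtain ⟨u, hu, hu'⟩ := h
    refine ⟨-1, by norm_num, fun t ht => ?_⟩
    by_contra hc
    have h1 : 0 ≤ b t := by linarith
    obtain ⟨w, hw, hw'⟩ := hs.intermediate_value hu ht hb ⟨hu', h1⟩
    exact h0 w hw hw'

section

variable {n : ℕ} {γ : Circle → RP n}

-- Differentiating the constants `p i (e j)` for the dual basis `p` of the frame gives `p i' = -b
-- (i-1) • p (i-1)`. Reversing the order of the indices makes each derivative a multiple of the next
-- form, and signs make the factors positive.
open ContinuousLinearMap in
theorem IsConvex.nonempty_chart (hn : 1 ≤ n) (hγ : IsConvex γ) (θ : ℝ) : Nonempty (Chart γ θ) := by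
  obtain ⟨e, b, he, hb, hd, hd', hosc⟩ := hγ.exists_frame hn θ
  have hI := isOpen_arc θ
  -- the frame as a linear map and its inverse
  let T : ℝ → (Fin n → ℝ) →L[ℝ] (Fin n → ℝ) := fun t =>
    ∑ j : Fin n, (proj (R := ℝ) (φ := fun _ : Fin n => ℝ) j).smulRight (e j t)
  have hT : ContDiffOn ℝ ∞ T (arc θ) := by
    refine ContDiffOn.sum fun j _ => ?_
    exact (smulRightL ℝ (Fin n → ℝ) (Fin n → ℝ)
      (proj (R := ℝ) (φ := fun _ : Fin n => ℝ) j)).contDiff.comp_contDiffOn (he j j.2)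
  have hTs : ∀ t (j : Fin n), T t (Pi.single j 1) = e j t := by
    intro t j
    simp only [T, _root_.sum_apply, smulRight_apply, proj_apply]
    rw [Finset.sum_eq_single j]
    · simp
    · intro i _ hi; simp [hi]
    · simp
  have hTe : ∀ t ∈ arc θ, ∃ L : (Fin n → ℝ) ≃L[ℝ] (Fin n → ℝ), (L : _ →L[ℝ] _) = T t := by
    intro t ht
    have hsurj : Function.Surjective (T t : (Fin n → ℝ) →ₗ[ℝ] (Fin n → ℝ)) := by
      rw [← LinearMap.range_eq_top, eq_top_iff, ← hγ.osculating_eq_top hn (Circle.exp t),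
        hosc n le_rfl t ht, Submodule.span_le]
      rintro _ ⟨j, rfl⟩
      exact ⟨Pi.single j 1, hTs t j⟩
    have hinj := LinearMap.injective_iff_surjective.2 hsurj
    exact ⟨(LinearEquiv.ofBijective _ ⟨hinj, hsurj⟩).toContinuousLinearEquiv, by ext; rfl⟩
  let P : ℝ → (Fin n → ℝ) →L[ℝ] (Fin n → ℝ) := fun t => inverse (T t)
  have hP : ContDiffOn ℝ ∞ P (arc θ) := by
    intro t ht
    obtain ⟨L, hL⟩ := hTe t ht
    have := contDiffAt_map_inverse (n := ∞) L
    rw [hL] at this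
    exact this.comp_contDiffWithinAt t (hT t ht)
  have hPe : ∀ t ∈ arc θ, ∀ j : Fin n, P t (e j t) = Pi.single j 1 := by
    intro t ht j
    obtain ⟨L, hL⟩ := hTe t ht
    simp only [P]
    rw [← hL, inverse_equiv, ← hTs t j, ← hL]
    simp
  let p : ℕ → ℝ → (Fin n → ℝ) →L[ℝ] ℝ := fun i t =>
    if h : i < n then (proj (R := ℝ) (φ := fun _ : Fin n => ℝ) ⟨i, h⟩).comp (P t) else 0
  have hp : ∀ i, ContDiffOn ℝ ∞ (p i) (arc θ) := by
    intro i
    by_cases h : i < n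
    · simp only [p, h, dif_pos]
      exact contDiffOn_const.clm_comp hP
    · simp only [p, h, dif_neg, not_false_eq_true]
      exact contDiffOn_const
  have hpe : ∀ i, ∀ j < n, ∀ t ∈ arc θ, p i t (e j t) = if i = j then 1 else 0 := by
    intro i j hj t ht
    by_cases h : i < n
    · simp only [p, h, dif_pos, comp_apply, proj_apply]
      rw [hPe t ht ⟨j, hj⟩]
      simp [Pi.single_apply]
    · simp only [p, h, dif_neg, not_false_eq_true]
      rw [if_neg (by omega)]; rfl
  -- extensionality along the frame
  have hext : ∀ t ∈ arc θ, ∀ f g : (Fin n → ℝ) →L[ℝ] ℝ, (∀ j < n, f (e j t) = g (e j t)) →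
      f = g := by
    intro t ht f g h
    ext v
    have hv : v ∈ Submodule.span ℝ (Set.range fun j : Fin n => e j t) := by
      rw [← hosc n le_rfl t ht, hγ.osculating_eq_top hn]; trivial
    induction hv using Submodule.span_induction with
    | mem x hx => obtain ⟨j, rfl⟩ := hx; exact h j j.2
    | zero => simp
    | add x y _ _ hx hy => rw [map_add, map_add, hx, hy]
    | smul a x _ hx => rw [map_smul, map_smul, hx]
  have hpd : ∀ i, ∀ t ∈ arc θ, HasDerivAt (p i)
      (if 0 < i ∧ i < n then -b (i - 1) t • p (i - 1) t else 0) t := by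
    intro i t ht
    have h1 := hasDerivAt_of_contDiffOn hI (hp i) ht
    refine h1.congr_deriv (hext t ht _ _ fun j hj => ?_)
    have hej : HasDerivAt (e j) (if j + 1 < n then b j t • e (j + 1) t else 0) t := by
      split_ifs with h
      · exact hd j h t ht
      · rw [show j = n - 1 by omega]; exact hd' t ht
    have h2 := h1.clm_apply hej
    have h3 : (fun t => p i t (e j t)) =ᶠ[𝓝 t] fun _ => if i = j then 1 else 0 :=
      Filter.eventually_of_mem (hI.mem_nhds ht) fun s hs => hpe i j hj s hs
    have h4 := h2.unique ((hasDerivAt_const t _).congr_of_eventuallyEq h3)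
    have h5 : deriv (p i) t (e j t) = - p i t (if j + 1 < n then b j t • e (j + 1) t else 0) := by
      linarith
    rw [h5]
    by_cases hjn : j + 1 < n
    · rw [if_pos hjn, map_smul, hpe i (j + 1) hjn t ht]
      by_cases hi : 0 < i ∧ i < n
      · rw [if_pos hi, smul_apply, hpe (i - 1) j hj t ht]
        by_cases hij : i = j + 1
        · subst hij; simp
        · rw [if_neg hij, if_neg (by omega)]; simp
      · rw [if_neg hi, if_neg (by omega)]; simp
    · rw [if_neg hjn, map_zero, neg_zero]
      by_cases hi : 0 < i ∧ i < n
      · rw [if_pos hi, smul_apply, hpe (i - 1) j hj t ht, if_neg (by omega), smul_zero]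
      · rw [if_neg hi]; simp
  have hmem : ∀ k ≤ n, ∀ t ∈ arc θ, ∀ v, v ∈ osculating γ k (Circle.exp t) ↔
      ∀ j, k ≤ j → j < n → p j t v = 0 := by
    intro k hk t ht v
    rw [hosc k hk t ht]
    constructor
    · intro hv j hkj hj
      induction hv using Submodule.span_induction with
      | mem x hx => obtain ⟨i, rfl⟩ := hx; rw [hpe j i (by omega) t ht, if_neg (by omega)]
      | zero => simp
      | add x y _ _ hx hy => rw [map_add, hx, hy, add_zero]
      | smul a x _ hx => rw [map_smul, hx, smul_zero]
    · intro h
      obtain ⟨L, hL⟩ := hTe t ht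
      have hv : v = T t (P t v) := by
        simp only [P]; rw [← hL, inverse_equiv]; simp
      rw [hv]
      simp only [T, _root_.sum_apply, smulRight_apply, proj_apply]
      refine Submodule.sum_mem _ fun j _ => ?_
      by_cases hj : (j : ℕ) < k
      · exact Submodule.smul_mem _ _ (Submodule.subset_span ⟨⟨j, hj⟩, rfl⟩)
      · have := h j (by omega) j.2
        simp only [p, j.2, dif_pos, comp_apply, proj_apply] at this
        rw [this, zero_smul]; exact Submodule.zero_mem _
  -- signs
  have hσ : ∀ i, ∃ σ : ℝ, σ * σ = 1 ∧ (i + 1 < n → ∀ t ∈ arc θ, 0 < σ * b i t) := by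
    intro i
    by_cases h : i + 1 < n
    · obtain ⟨σ, h1, h2⟩ := exists_sign isPreconnected_Ioo (hb i h).1.continuousOn (hb i h).2
      exact ⟨σ, h1, fun _ => h2⟩
    · exact ⟨1, by norm_num, fun h' => absurd h' h⟩
  choose σ hσ1 hσ2 using hσ
  -- The recursion absorbs both the minus sign of the dual equation and the constant sign `σ` of `b
  -- (n - 2 - j)`.
  let ε : ℕ → ℝ := fun j => Nat.rec 1 (fun j r => -r * σ (n - 2 - j)) j
  have hε : ∀ j, ε (j + 1) = -ε j * σ (n - 2 - j) := fun j => rfl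
  have hε1 : ∀ j, ε j * ε j = 1 := by
    intro j
    induction j with
    | zero => exact one_mul _
    | succ j ih =>
      rw [hε, show -ε j * σ (n - 2 - j) * (-ε j * σ (n - 2 - j))
        = (ε j * ε j) * (σ (n - 2 - j) * σ (n - 2 - j)) by ring, ih, hσ1, one_mul]
  have hε0 : ∀ j, ε j ≠ 0 := fun j h => by have := hε1 j; rw [h] at this; norm_num at this
  refine ⟨⟨fun j t => if j < n then ε j • p (n - 1 - j) t else 0,
    fun j t => if j + 1 < n then σ (n - 2 - j) * b (n - 2 - j) t else 1, ?_, ?_, ?_, ?_, ?_, ?_⟩⟩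
  · intro i
    by_cases h : i < n
    · simp only [h, if_true]; exact (hp _).const_smul _
    · simp only [h, if_false]; exact contDiffOn_const
  · intro i
    by_cases h : i + 1 < n
    · simp only [h, if_true]; exact contDiffOn_const.mul (hb _ (by omega)).1
    · simp only [h, if_false]; exact contDiffOn_const
  · intro i t ht
    by_cases h : i + 1 < n
    · simp only [h, if_true]; exact hσ2 _ (by omega) t ht
    · simp only [h, if_false]; norm_num
  · intro i t ht
    by_cases h : i < n
    · simp only [h, if_true]
      have h1 := (hpd (n - 1 - i) t ht).const_smul (ε i)
      refine h1.congr_deriv ?_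
      by_cases h2 : i + 1 < n
      · rw [if_pos (by omega), if_pos h2, if_pos h2, hε, show n - 1 - i - 1 = n - 2 - i by omega,
          show n - 1 - (i + 1) = n - 2 - i by omega, smul_smul, smul_smul]
        congr 1
        linear_combination (ε i * b (n - 2 - i) t) * hσ1 (n - 2 - i)
      · rw [if_neg (by omega), if_neg h2, if_neg h2, smul_zero, smul_zero]
    · simp only [h, if_false, show ¬ (i + 1 < n) by omega, smul_zero]
      exact hasDerivAt_const _ _
  · intro i hi t
    simp only [show ¬ i < n by omega, if_false]
  · intro m hm t ht v
    rw [hmem (n - m) (by omega) t ht v]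
    constructor
    · intro h j hj
      rw [if_pos (by omega), smul_apply, h _ (by omega) (by omega), smul_zero]
    · intro h j hj hjn
      have := h (n - 1 - j) (by omega)
      rw [if_pos (by omega), smul_apply, show n - 1 - (n - 1 - j) = j by omega, smul_eq_mul] at this
      exact (mul_eq_zero.1 this).resolve_left (hε0 _)

end

/-! ### Counting zeros by Rolle's theorem, and its consequences for vectors. -/

section Rolle

/-- Rolle's theorem between consecutive points of `S`. The last clause carries the induction: it
places the new critical point to the right of all earlier ones. -/
lemma exists_deriv_zeros {I : Set ℝ} (hI : I.OrdConnected) {f f' : ℝ → ℝ}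
    (hf : ∀ t ∈ I, HasDerivAt f (f' t) t) (S : Finset ℝ) (hS : ↑S ⊆ I) (h0 : ∀ t ∈ S, f t = 0) :
    ∃ G : Finset ℝ, ↑G ⊆ I ∧ Disjoint S G ∧ S.card ≤ G.card + 1 ∧ (∀ t ∈ G, f' t = 0) ∧
      ∀ g ∈ G, ∃ s ∈ S, g < s := by
  induction S using Finset.induction_on_max with
  | empty => exact ⟨∅, by simp, by simp, by simp, by simp, by simp⟩
  | insert a S ha ih =>
    obtain ⟨G, hG, hd, hc, hz, hl⟩ := ih (fun t ht => hS (by simp_all))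
      (fun t ht => h0 t (by simp [ht]))
    have haS : a ∉ S := fun h => lt_irrefl a (ha a h)
    rcases S.eq_empty_or_nonempty with rfl | hne
    · exact ⟨∅, by simp, by simp, by simp, by simp, by simp⟩
    set b := S.max' hne with hb
    have hbS : b ∈ S := S.max'_mem hne
    have hbI : b ∈ I := hS (by simp [hbS])
    have haI : a ∈ I := hS (by simp)
    have hsub : Set.Icc b a ⊆ I := hI.out hbI haI
    obtain ⟨c, hcI, hc0⟩ := exists_hasDerivAt_eq_zero (ha b hbS)
      (fun t ht => (hf t (hsub ht)).continuousAt.continuousWithinAt)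
      (by rw [h0 b (by simp [hbS]), h0 a (by simp)])
      (fun t ht => hf t (hsub ⟨ht.1.le, ht.2.le⟩))
    have hGb : ∀ g ∈ G, g < b := fun g hg => by
      obtain ⟨s, hs, hgs⟩ := hl g hg
      exact hgs.trans_le (S.le_max' s hs)
    have hcG : c ∉ G := fun h => lt_irrefl c ((hGb c h).trans hcI.1)
    refine ⟨insert c G, ?_, ?_, ?_, ?_, ?_⟩
    · rw [Finset.coe_insert, Set.insert_subset_iff]
      exact ⟨hsub ⟨hcI.1.le, hcI.2.le⟩, hG⟩
    · rw [Finset.disjoint_insert_left, Finset.disjoint_insert_right, Finset.mem_insert]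
      refine ⟨?_, ?_, hd⟩
      · rintro (h | h)
        · exact hcI.2.ne h.symm
        · exact lt_irrefl a (((hGb a h).trans hcI.1).trans hcI.2)
      · exact fun h => (S.le_max' c h).not_gt hcI.1
    · rw [Finset.card_insert_of_notMem haS, Finset.card_insert_of_notMem hcG]
      omega
    · intro t ht
      rcases Finset.mem_insert.1 ht with rfl | h
      exacts [hc0, hz t h]
    · intro g hg
      rcases Finset.mem_insert.1 hg with rfl | h
      · exact ⟨a, by simp, hcI.2⟩
      · exact ⟨b, by simp [hbS], hGb g h⟩

/-- Passing from `φ 0` to `φ 1` costs at most one zero, counted with multiplicity: every zero loses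
one, and Rolle's theorem returns at least all but one of these losses. -/
lemma exists_zero_of_chain {I : Set ℝ} (hI : I.OrdConnected) (k : ℕ) {φ β : ℕ → ℝ → ℝ}
    (hβ : ∀ i, ∀ t ∈ I, 0 < β i t) (hφ : ∀ i, ∀ t ∈ I, HasDerivAt (φ i) (β i t * φ (i + 1) t) t)
    (S : Finset ℝ) (hS : ↑S ⊆ I) (m : ℝ → ℕ) (hm : ∀ t ∈ S, ∀ j < m t, φ j t = 0)
    (hk : k < ∑ t ∈ S, m t) : ∃ t ∈ I, φ k t = 0 := by
  classical
  induction k generalizing φ β S m with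
  | zero =>
    obtain ⟨t, ht, h⟩ := Finset.exists_ne_zero_of_sum_ne_zero hk.ne'
    exact ⟨t, hS ht, hm t ht 0 (Nat.pos_of_ne_zero h)⟩
  | succ k ih =>
    set S₁ := S.filter fun t => m t ≠ 0 with hS₁
    have hsum : ∑ t ∈ S₁, m t = ∑ t ∈ S, m t := Finset.sum_filter_ne_zero S
    have hS₁' : ∀ t ∈ S₁, t ∈ S ∧ m t ≠ 0 := fun t ht => Finset.mem_filter.1 ht
    obtain ⟨G, hG, hd, hc, hz, -⟩ := exists_deriv_zeros hI (hφ 0) S₁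
      (fun t ht => hS (hS₁' t ht).1)
      (fun t ht => hm t (hS₁' t ht).1 0 (Nat.pos_of_ne_zero (hS₁' t ht).2))
    refine ih (φ := fun i => φ (i + 1)) (β := fun i => β (i + 1)) (fun i => hβ (i + 1))
      (fun i => hφ (i + 1)) (S₁ ∪ G) ?_ (fun t => if t ∈ G then 1 else m t - 1) ?_ ?_
    · rw [Finset.coe_union]
      exact Set.union_subset (fun t ht => hS (hS₁' t ht).1) hG
    · intro t ht j hj
      by_cases h : t ∈ G
      · rw [if_pos h] at hj
        rw [show j = 0 by omega]
        exact (mul_eq_zero.1 (hz t h)).resolve_left (hβ 0 t (hG h)).ne'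
      · rw [if_neg h] at hj
        have ht' := (Finset.mem_union.1 ht).resolve_right h
        exact hm t (hS₁' t ht').1 (j + 1) (by omega)
    · rw [Finset.sum_union hd, Finset.sum_congr rfl
        (fun t ht => if_neg (Finset.disjoint_left.1 hd ht)),
        Finset.sum_congr (s₁ := G) rfl (fun t ht => if_pos ht), Finset.sum_const, smul_eq_mul,
        mul_one]
      have h1 : ∑ t ∈ S₁, (m t - 1) + S₁.card = ∑ t ∈ S₁, m t := by
        rw [Finset.card_eq_sum_ones, ← Finset.sum_add_distrib]
        exact Finset.sum_congr rfl fun t ht => by have := (hS₁' t ht).2; omega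
      omega

end Rolle

section

variable {n : ℕ} {γ : Circle → RP n}

lemma exists_exp_notMem (S : Finset Circle) : ∃ θ : ℝ, Circle.exp θ ∉ S := by
  have h : (arc 0).Infinite := Set.Ioo_infinite (by have := Real.pi_pos; linarith)
  obtain ⟨z, ⟨t, -, rfl⟩, hz⟩ := (h.image (exp_injOn_arc 0)).exists_notMem_finset S
  exact ⟨t, hz⟩

lemma Chart.hasDerivAt_apply {θ : ℝ} (C : Chart γ θ) (v : Fin n → ℝ) (i : ℕ) {t : ℝ}
    (ht : t ∈ arc θ) : HasDerivAt (fun s => C.q i s v) (C.β i t * C.q (i + 1) t v) t := by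
  simpa using (C.hasDerivAt_q i t ht).clm_apply (hasDerivAt_const t v)

/-- A vector cannot lie in osculating spaces of total codimension `n`. -/
theorem IsConvex.eq_zero_of_mem_osculating (hn : 1 ≤ n) (hγ : IsConvex γ) (S : Finset Circle)
    (m : Circle → ℕ) (hm : ∀ z ∈ S, m z ≤ n) (hsum : n ≤ ∑ z ∈ S, m z) {v : Fin n → ℝ}
    (hv : ∀ z ∈ S, v ∈ osculating γ (n - m z) z) : v = 0 := by
  classical
  obtain ⟨θ, hθ⟩ := exists_exp_notMem S
  obtain ⟨C⟩ := hγ.nonempty_chart hn θ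
  have hex : ∀ z ∈ S, ∃ t ∈ arc θ, Circle.exp t = z := fun z hz =>
    exists_mem_arc (by rintro rfl; exact hθ hz)
  choose! p hp hpz using hex
  have hinj : Set.InjOn p S := fun z hz w hw h => by rw [← hpz z hz, ← hpz w hw, h]
  have hzero : ∀ k < n, ∃ t ∈ arc θ, C.q k t v = 0 := by
    intro k hk
    refine exists_zero_of_chain Set.ordConnected_Ioo k (φ := fun i t => C.q i t v) C.β_pos
      (fun i t ht => C.hasDerivAt_apply v i ht) (S.image p) ?_ (fun t => m (Circle.exp t)) ?_ ?_
    · rw [Finset.coe_image]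
      rintro _ ⟨z, hz, rfl⟩
      exact hp z hz
    · intro t ht j hj
      obtain ⟨z, hz, rfl⟩ := Finset.mem_image.1 ht
      have h1 := hv z hz
      rw [hpz z hz] at hj
      rw [← hpz z hz, hpz z hz] at h1
      have h2 := (C.mem_iff (m z) (hm z hz) (p z) (hp z hz) v).1 (by rw [hpz z hz]; exact h1)
      exact h2 j hj
    · rw [Finset.sum_image hinj, Finset.sum_congr rfl fun z hz => by rw [hpz z hz]]
      exact hk.trans_le hsum
  -- Descent from `q n = 0`: each function in the chain has derivative zero by the previous step, so
  -- it is constant, and it vanishes somewhere.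
  have hall : ∀ r, ∀ t ∈ arc θ, C.q (n - r) t v = 0 := by
    intro r
    induction r with
    | zero => intro t _; rw [C.q_eq_zero _ (by omega)]; rfl
    | succ r ih =>
      intro t ht
      by_cases hr : r < n
      · obtain ⟨s, hs, hs0⟩ := hzero (n - (r + 1)) (by omega)
        rw [← hs0]
        refine isOpen_Ioo.is_const_of_deriv_eq_zero isPreconnected_Ioo (𝕜 := ℝ)
          (f := fun t => C.q (n - (r + 1)) t v) ?_ ?_ ht hs
        · exact fun u hu => (C.hasDerivAt_apply v _ hu).differentiableAt.differentiableWithinAt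
        · intro u hu
          rw [(C.hasDerivAt_apply v _ hu).deriv, show n - (r + 1) + 1 = n - r by omega, ih u hu,
            mul_zero]
          rfl
      · rw [show n - (r + 1) = n - r by omega]; exact ih t ht
  obtain ⟨z, hz⟩ : S.Nonempty := by
    rw [Finset.nonempty_iff_ne_empty]; rintro rfl; simp at hsum; omega
  have h1 : v ∈ osculating γ (n - n) (Circle.exp (p z)) :=
    (C.mem_iff n le_rfl _ (hp z hz) v).2 fun j hj => by
      have := hall (n - j) (p z) (hp z hz)
      rwa [show n - (n - j) = j by omega] at this
  have h2 := hγ.finrank_osculating hn (Nat.zero_le n) (Circle.exp (p z))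
  rw [Nat.sub_self, Submodule.finrank_eq_zero.1 h2] at h1
  exact h1

lemma exists_arc_center (z : Circle) : ∃ θ t, t ∈ arc θ ∧ Circle.exp t = z := by
  obtain ⟨t, rfl⟩ := Circle.exp_surjective z
  have := Real.pi_pos
  exact ⟨t - Real.pi, t, ⟨by linarith, by linarith⟩, rfl⟩

lemma Chart.continuousAt_apply {θ : ℝ} (C : Chart γ θ) (i : ℕ) {t : ℝ} (ht : t ∈ arc θ)
    (v : Fin n → ℝ) : ContinuousAt (fun p : ℝ × (Fin n → ℝ) => C.q i p.1 p.2) (t, v) := by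
  have h1 : ContinuousAt (C.q i) t := (C.hasDerivAt_q i t ht).continuousAt
  have h2 : ContinuousAt (fun p : ℝ × (Fin n → ℝ) => C.q i p.1) (t, v) :=
    ContinuousAt.comp (g := C.q i) (f := Prod.fst) h1 continuousAt_fst
  exact h2.clm_apply continuousAt_snd

theorem IsConvex.isClosed_osculating (hn : 1 ≤ n) (hγ : IsConvex γ) (k : ℕ) (hk : k ≤ n) :
    IsClosed {p : Circle × (Fin n → ℝ) | p.2 ∈ osculating γ k p.1} := by
  rw [← isOpen_compl_iff, isOpen_iff_eventually]
  rintro ⟨z, v⟩ hv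
  obtain ⟨θ, t, ht, rfl⟩ := exists_arc_center z
  obtain ⟨C⟩ := hγ.nonempty_chart hn θ
  have hiff : ∀ s ∈ arc θ, ∀ u, u ∈ osculating γ k (Circle.exp s) ↔ ∀ j < n - k, C.q j s u = 0 := by
    intro s hs u
    have := C.mem_iff (n - k) (by omega) s hs u
    rwa [show n - (n - k) = k by omega] at this
  simp only [Set.mem_compl_iff, Set.mem_ofPred_eq] at hv
  rw [hiff t ht] at hv
  push Not at hv
  obtain ⟨j, hj, hv⟩ := hv
  rw [nhds_prod_eq, ← isLocalHomeomorph_circleExp.map_nhds_eq t]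
  rw [← Filter.map_id (f := 𝓝 v), Filter.prod_map_map_eq, Filter.eventually_map,
    ← nhds_prod_eq]
  filter_upwards [(C.continuousAt_apply j ht v).eventually_ne hv,
    continuousAt_fst.eventually_mem (show arc θ ∈ 𝓝 (t, v).1 from (isOpen_arc θ).mem_nhds ht)]
    with p hp1 hp2 hmem
  exact hp1 ((hiff p.1 hp2 p.2).1 hmem j hj)

/-- Vectors lying in two codimension-two osculating spaces at colliding points converge to the
osculating space of codimension three. -/
theorem IsConvex.eventually_notMem_of_collision (hn : 3 ≤ n) (hγ : IsConvex γ) {z : Circle}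
    {v : Fin n → ℝ} (hv : v ∉ osculating γ (n - 3) z) :
    ∀ᶠ p : (Circle × Circle) × (Fin n → ℝ) in 𝓝 ((z, z), v), p.1.1 ≠ p.1.2 →
      ¬ (p.2 ∈ osculating γ (n - 2) p.1.1 ∧ p.2 ∈ osculating γ (n - 2) p.1.2) := by
  obtain ⟨θ, t, ht, rfl⟩ := exists_arc_center z
  obtain ⟨C⟩ := hγ.nonempty_chart (by omega) θ
  rw [C.mem_iff 3 hn t ht] at hv
  push Not at hv
  obtain ⟨j, hj, hv⟩ := hv
  rw [nhds_prod_eq, nhds_prod_eq, ← isLocalHomeomorph_circleExp.map_nhds_eq t]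
  rw [← Filter.map_id (f := 𝓝 v), Filter.prod_map_map_eq, Filter.prod_map_map_eq,
    Filter.eventually_map]
  have h1 : ∀ᶠ p : ℝ × (Fin n → ℝ) in 𝓝 t ×ˢ 𝓝 v, p.1 ∈ arc θ ∧ C.q j p.1 p.2 ≠ 0 := by
    rw [← nhds_prod_eq]
    filter_upwards [(C.continuousAt_apply j ht v).eventually_ne hv,
      continuousAt_fst.eventually_mem (show arc θ ∈ 𝓝 (t, v).1 from (isOpen_arc θ).mem_nhds ht)]
      with p hp1 hp2 using ⟨hp2, hp1⟩
  obtain ⟨P, hP, Q, hQ, hPQ⟩ := Filter.eventually_prod_iff.1 h1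
  obtain ⟨ε, hε, hball⟩ := Metric.eventually_nhds_iff_ball.1 hP
  have hball' : ∀ᶠ s in 𝓝 t, s ∈ Metric.ball t ε := Metric.ball_mem_nhds t hε
  filter_upwards [(hball'.prod_mk hball').prod_mk hQ] with p hp hne hmem
  obtain ⟨⟨hp1, hp2⟩, hp3⟩ := hp
  simp only [id] at hne hmem
  have hmem1 := (C.mem_iff 2 (by omega) _ (hPQ (hball _ hp1) hp3).1 _).1 hmem.1
  have hmem2 := (C.mem_iff 2 (by omega) _ (hPQ (hball _ hp2) hp3).1 _).1 hmem.2
  by_cases hj2 : j < 2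
  · exact (hPQ (hball _ hp1) hp3).2 (hmem1 j hj2)
  have hj2 : j = 2 := by omega
  subst hj2
  -- Two zeros of `q 1` would enclose a zero of `q 2`, which does not vanish on the ball.
  have key : ∀ x y : ℝ, x ∈ Metric.ball t ε → y ∈ Metric.ball t ε → x < y → C.q 1 x p.2 = 0 →
      C.q 1 y p.2 = 0 → False := by
    intro x y hx hy hxy h1 h2
    have hsub : Set.Icc x y ⊆ Metric.ball t ε := by
      rw [Real.ball_eq_Ioo] at hx hy ⊢
      exact fun s hs => ⟨hx.1.trans_le hs.1, hs.2.trans_lt hy.2⟩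
    have harc : ∀ s ∈ Set.Icc x y, s ∈ arc θ ∧ C.q 2 s p.2 ≠ 0 := fun s hs =>
      hPQ (hball s (hsub hs)) hp3
    obtain ⟨c, hc, hc0⟩ := exists_hasDerivAt_eq_zero hxy
      (fun s hs => (C.hasDerivAt_apply p.2 1 (harc s hs).1).continuousAt.continuousWithinAt)
      (h1.trans h2.symm) (fun s hs => C.hasDerivAt_apply p.2 1 (harc s ⟨hs.1.le, hs.2.le⟩).1)
    have hc' := harc c ⟨hc.1.le, hc.2.le⟩
    exact (mul_ne_zero (C.β_pos 1 c hc'.1).ne' hc'.2) hc0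
  have hne' : p.1.1 ≠ p.1.2 := fun h => hne (by rw [h])
  rcases hne'.lt_or_gt with h | h
  · exact key _ _ hp1 hp2 h (hmem1 1 (by omega)) (hmem2 1 (by omega))
  · exact key _ _ hp2 hp1 h (hmem2 1 (by omega)) (hmem1 1 (by omega))

end

/-! ### Stability of transversal intersections and generic planes. -/

section

variable {n : ℕ} {γ : Circle → RP n}

lemma eventually_mul_neg_of_deriv_ne_zero {f : ℝ → ℝ} {f' x : ℝ} (hf : HasDerivAt f f' x)
    (h' : f' ≠ 0) (h0 : f x = 0) : ∀ᶠ s in 𝓝[>] (0 : ℝ), f (x - s) * f (x + s) < 0 := by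
  have main : ∀ g : ℝ → ℝ, ∀ g' : ℝ, HasDerivAt g g' x → 0 < g' → g x = 0 →
      ∀ᶠ s in 𝓝[>] (0 : ℝ), g (x - s) * g (x + s) < 0 := by
    intro g g' hg hpos hg0
    have h1 := eventually_nhdsWithin_sign_eq_of_deriv_pos (f := g) (by rwa [hg.deriv]) hg0
    have h2 : Filter.Tendsto (fun s : ℝ => x - s) (𝓝 0) (𝓝 x) := by
      simpa using (continuous_const.sub continuous_id).tendsto (0 : ℝ) (f := fun s : ℝ => x - s)
    have h3 : Filter.Tendsto (fun s : ℝ => x + s) (𝓝 0) (𝓝 x) := by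
      simpa using (continuous_const.add continuous_id).tendsto (0 : ℝ) (f := fun s : ℝ => x + s)
    filter_upwards [nhdsWithin_le_nhds (h2.eventually h1), nhdsWithin_le_nhds (h3.eventually h1),
      self_mem_nhdsWithin] with s h4 h5 h6
    have h6 : 0 < s := h6
    rw [show x - s - x = -s by ring, sign_neg (by linarith : -s < 0), sign_eq_neg_one_iff] at h4
    rw [show x + s - x = s by ring, sign_pos h6, sign_eq_one_iff] at h5
    exact mul_neg_of_neg_of_pos h4 h5
  rcases h'.lt_or_gt with h | h
  · filter_upwards [main (-f) (-f') hf.neg (by linarith) (by simp [h0])] with s hs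
    simpa using hs
  · exact main f f' hf h h0

/-- Transversal intersection points persist when the line is moved. -/
lemma IsTransversalAt.eventually {𝓗 : Set (RP n)} {w₁ w₂ v : Fin n → ℝ}
    (h : IsTransversalAt (Submodule.span ℝ {w₁, w₂}) 𝓗 v) (hv : v ∈ Submodule.span ℝ {w₁, w₂})
    (hv0 : v ≠ 0) (hmem : Projectivization.mk ℝ v hv0 ∈ 𝓗) {O : Set (Fin n → ℝ)} (hO : O ∈ 𝓝 v) :
    ∀ᶠ p : (Fin n → ℝ) × (Fin n → ℝ) in 𝓝 (w₁, w₂), ∃ a b : ℝ, a • p.1 + b • p.2 ∈ O ∧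
      ∃ h0 : a • p.1 + b • p.2 ≠ 0, Projectivization.mk ℝ _ h0 ∈ 𝓗 := by
  obtain ⟨U, g, hU, hvU, hg, hiff, w, hw, hgw⟩ := h
  obtain ⟨a, b, rfl⟩ := Submodule.mem_span_pair.1 hv
  obtain ⟨c, d, rfl⟩ := Submodule.mem_span_pair.1 hw
  set v := a • w₁ + b • w₂ with hvdef
  set w := c • w₁ + d • w₂ with hwdef
  have hN : U ∩ O ∩ {0}ᶜ ∈ 𝓝 v :=
    Filter.inter_mem (Filter.inter_mem (hU.mem_nhds hvU) hO) (isOpen_compl_singleton.mem_nhds hv0)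
  obtain ⟨r, hr, hball⟩ := Metric.mem_nhds_iff.1 hN
  have hg0 : g v = 0 := (hiff v hv0 hvU).1 hmem
  have hgd : HasFDerivAt g (fderiv ℝ g v) v :=
    ((hg.contDiffAt (hU.mem_nhds hvU)).differentiableAt (by simp)).hasFDerivAt
  have hline : HasDerivAt (fun s : ℝ => v + s • w) w 0 := by
    simpa using ((hasDerivAt_id (0 : ℝ)).smul_const w).const_add v
  have hder : HasDerivAt (fun s : ℝ => g (v + s • w)) (fderiv ℝ g v w) 0 := by
    refine HasFDerivAt.comp_hasDerivAt (f := fun s : ℝ => v + s • w) (0 : ℝ) ?_ hline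
    simpa using hgd
  have hsgn := eventually_mul_neg_of_deriv_ne_zero hder hgw (by simpa using hg0)
  simp only [zero_sub, zero_add] at hsgn
  have hin : ∀ᶠ s in 𝓝 (0 : ℝ), v + s • w ∈ Metric.ball v r :=
    hline.continuousAt.eventually_mem (by simpa using Metric.ball_mem_nhds v hr)
  have hin' : ∀ᶠ s in 𝓝 (0 : ℝ), v + (-s) • w ∈ Metric.ball v r := by
    have : Filter.Tendsto (fun s : ℝ => -s) (𝓝 0) (𝓝 0) := by
      simpa using (continuous_neg (G := ℝ)).tendsto 0
    exact this.eventually hin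
  obtain ⟨s, hs1, hs2, hs3⟩ := (hsgn.and ((hin.filter_mono nhdsWithin_le_nhds).and
    (hin'.filter_mono nhdsWithin_le_nhds))).exists
  -- The point `v + s • w` with the same coefficients in a moved basis. Opposite signs of `g` at
  -- parameters `-s` and `s` persist, giving a zero on the segment between them.
  let ψ : ℝ → (Fin n → ℝ) × (Fin n → ℝ) → Fin n → ℝ := fun s p =>
    (a + s * c) • p.1 + (b + s * d) • p.2
  have hψ : ∀ s, ψ s (w₁, w₂) = v + s • w := by
    intro s; simp only [ψ, hvdef, hwdef]; module
  have hψc : ∀ s, Continuous (ψ s) := fun s => by simp only [ψ]; fun_prop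
  have hcont : ∀ u ∈ Metric.ball v r, ContinuousAt g u := fun u hu =>
    (hg.contDiffAt (hU.mem_nhds (hball hu).1.1)).continuousAt
  have e1 : ∀ᶠ p in 𝓝 (w₁, w₂), ψ s p ∈ Metric.ball v r :=
    (hψc s).continuousAt.eventually_mem (Metric.isOpen_ball.mem_nhds (by rwa [hψ]))
  have e2 : ∀ᶠ p in 𝓝 (w₁, w₂), ψ (-s) p ∈ Metric.ball v r :=
    (hψc (-s)).continuousAt.eventually_mem (Metric.isOpen_ball.mem_nhds (by rwa [hψ]))
  have e3 : ∀ᶠ p in 𝓝 (w₁, w₂), g (ψ (-s) p) * g (ψ s p) < 0 := by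
    have c1 : ContinuousAt (fun p => g (ψ (-s) p)) (w₁, w₂) :=
      ContinuousAt.comp (g := g) (f := ψ (-s)) (hcont _ (by rwa [hψ])) (hψc _).continuousAt
    have c2 : ContinuousAt (fun p => g (ψ s p)) (w₁, w₂) :=
      ContinuousAt.comp (g := g) (f := ψ s) (hcont _ (by rwa [hψ])) (hψc _).continuousAt
    refine (c1.mul c2).eventually_lt continuousAt_const ?_
    simp only [Pi.mul_apply]
    rw [hψ, hψ]; exact hs1
  filter_upwards [e1, e2, e3] with p h1 h2 h3
  have hseg : segment ℝ (ψ (-s) p) (ψ s p) ⊆ Metric.ball v r :=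
    (convex_ball v r).segment_subset h2 h1
  have hgc : ContinuousOn g (segment ℝ (ψ (-s) p) (ψ s p)) := fun u hu =>
    (hcont u (hseg hu)).continuousWithinAt
  obtain ⟨u, hu, hu0⟩ : ∃ u ∈ segment ℝ (ψ (-s) p) (ψ s p), g u = 0 := by
    have hpre := (convex_segment (𝕜 := ℝ) (ψ (-s) p) (ψ s p)).isPreconnected
    rcases mul_neg_iff.1 h3 with ⟨h4, h5⟩ | ⟨h4, h5⟩
    · exact hpre.intermediate_value (right_mem_segment ℝ _ _) (left_mem_segment ℝ _ _) hgc
        ⟨h5.le, h4.le⟩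
    · exact hpre.intermediate_value (left_mem_segment ℝ _ _) (right_mem_segment ℝ _ _) hgc
        ⟨h4.le, h5.le⟩
  obtain ⟨x, y, hx, hy, hxy, rfl⟩ := hu
  have hub := hball (hseg ⟨x, y, hx, hy, hxy, rfl⟩)
  have heq : x • ψ (-s) p + y • ψ s p
      = (x * (a + -s * c) + y * (a + s * c)) • p.1 + (x * (b + -s * d) + y * (b + s * d)) • p.2 := by
    simp only [ψ]; module
  rw [heq] at hub hu0
  exact ⟨_, _, hub.1.2, hub.2, (hiff _ hub.2 hub.1.1).2 hu0⟩

lemma contDiffOn_sum_frame {e : ℕ → ℝ → Fin n → ℝ} {I : Set ℝ} {k : ℕ}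
    (he : ∀ i < k, ContDiffOn ℝ ∞ (e i) I) {P : Type*} [NormedAddCommGroup P] [NormedSpace ℝ P]
    {f : P → ℝ} {x : P → Fin k → ℝ} (hf : ContDiff ℝ 1 f) (hx : ContDiff ℝ 1 x) :
    ContDiffOn ℝ 1 (fun p => ∑ j : Fin k, x p j • e j (f p)) (f ⁻¹' I) := by
  refine ContDiffOn.sum fun j _ => ?_
  exact ((contDiff_pi.1 hx j).contDiffOn).smul
    (((he j j.2).of_le (by norm_cast)).comp hf.contDiffOn fun p hp => hp)

lemma mem_span_range_iff {k : ℕ} {e : ℕ → Fin n → ℝ} {v : Fin n → ℝ} :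
    v ∈ Submodule.span ℝ (Set.range fun j : Fin k => e j) ↔
      ∃ x : Fin k → ℝ, ∑ j : Fin k, x j • e j = v :=
  Submodule.mem_span_range_iff_exists_fun ℝ

/-- Generic planes are contained in no osculating hyperplane and meet no osculating space of
codimension three. -/
theorem IsConvex.dense_generic (hn : 3 ≤ n) (hγ : IsConvex γ) :
    Dense {p : (Fin n → ℝ) × (Fin n → ℝ) |
      (∀ z, ¬ (p.1 ∈ osculating γ (n - 1) z ∧ p.2 ∈ osculating γ (n - 1) z)) ∧
      ∀ z, ∀ a b : ℝ, a • p.1 + b • p.2 ∈ osculating γ (n - 3) z → a = 0 ∧ b = 0} := by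
  have key : ∀ θ, ∃ B : Set ((Fin n → ℝ) × (Fin n → ℝ)), dimH B < (2 * n : ℕ) ∧ ∀ p ∉ B,
      (∀ t ∈ arc θ, ¬ (p.1 ∈ osculating γ (n - 1) (Circle.exp t)
        ∧ p.2 ∈ osculating γ (n - 1) (Circle.exp t))) ∧
      ∀ t ∈ arc θ, ∀ a b : ℝ, a • p.1 + b • p.2 ∈ osculating γ (n - 3) (Circle.exp t) →
        a = 0 ∧ b = 0 := by
    intro θ
    obtain ⟨e, -, he, -, -, -, hosc⟩ := hγ.exists_frame (by omega) θ
    have hdim : ∀ {P : Type} [NormedAddCommGroup P] [NormedSpace ℝ P] [FiniteDimensional ℝ P]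
        {s : Set P} {F : P → (Fin n → ℝ) × (Fin n → ℝ)} (hF : ContDiffOn ℝ 1 F s)
        (hs : Convex ℝ s) (h : Module.finrank ℝ P < 2 * n), dimH (F '' s) < (2 * n : ℕ) := by
      intro P _ _ _ s F hF hs h
      refine (hF.dimH_image_le hs subset_rfl).trans_lt ?_
      refine (dimH_mono (Set.subset_univ s)).trans_lt ?_
      rw [Real.dimH_univ_eq_finrank]
      exact_mod_cast h
    -- The bad pairs are images of `C¹` maps from spaces of dimension `1 + 2 (n - 1)` and, for `G`
    -- together with the free vector, `1 + (n - 3) + 1 + n`. Both numbers are `2 n - 1`.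
    let F₁ : ℝ × (Fin (n - 1) → ℝ) × (Fin (n - 1) → ℝ) → (Fin n → ℝ) × (Fin n → ℝ) := fun p =>
      (∑ j, p.2.1 j • e j p.1, ∑ j, p.2.2 j • e j p.1)
    let G : ℝ × (Fin (n - 3) → ℝ) × ℝ × (Fin n → ℝ) → Fin n → ℝ := fun p =>
      ∑ j, p.2.1 j • e j p.1 + p.2.2.1 • p.2.2.2
    have hF₁ : ContDiffOn ℝ 1 F₁ (Prod.fst ⁻¹' arc θ) :=
      (contDiffOn_sum_frame (fun i hi => he i (by omega)) contDiff_fst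
        contDiff_snd.fst).prodMk
      (contDiffOn_sum_frame (fun i hi => he i (by omega)) contDiff_fst contDiff_snd.snd)
    have hG : ContDiffOn ℝ 1 G (Prod.fst ⁻¹' arc θ) :=
      (contDiffOn_sum_frame (fun i hi => he i (by omega)) contDiff_fst contDiff_snd.fst).add
      (contDiff_snd.snd.fst.smul contDiff_snd.snd.snd).contDiffOn
    have hconv : ∀ {P : Type} [AddCommGroup P] [Module ℝ P],
        Convex ℝ (Prod.fst ⁻¹' arc θ : Set (ℝ × P)) := fun {P} _ _ =>
      (convex_Ioo _ _).linear_preimage (LinearMap.fst ℝ ℝ P)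
    refine ⟨F₁ '' (Prod.fst ⁻¹' arc θ) ∪ ((fun p => (G p, p.2.2.2)) '' (Prod.fst ⁻¹' arc θ)
      ∪ (fun p => (p.2.2.2, G p)) '' (Prod.fst ⁻¹' arc θ)), ?_, ?_⟩
    · rw [dimH_union, dimH_union, max_lt_iff, max_lt_iff]
      refine ⟨hdim hF₁ hconv ?_, hdim (hG.prodMk contDiff_snd.snd.snd.contDiffOn) hconv ?_,
        hdim (contDiff_snd.snd.snd.contDiffOn.prodMk hG) hconv ?_⟩
      · simp; omega
      · simp; omega
      · simp; omega
    · intro p hp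
      simp only [Set.mem_union, not_or] at hp
      obtain ⟨h1, h2, h3⟩ := hp
      refine ⟨?_, ?_⟩
      · rintro t ht ⟨h4, h5⟩
        rw [hosc _ (by omega) t ht, mem_span_range_iff (e := fun j => e j t)] at h4 h5
        obtain ⟨x, hx⟩ := h4
        obtain ⟨y, hy⟩ := h5
        exact h1 ⟨(t, x, y), ht, Prod.ext hx hy⟩
      · intro t ht a b hab
        rw [hosc _ (by omega) t ht, mem_span_range_iff (e := fun j => e j t)] at hab
        obtain ⟨x, hx⟩ := hab
        by_contra hne
        by_cases ha : a = 0
        · have hb : b ≠ 0 := fun hb => hne ⟨ha, hb⟩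
          refine h3 ⟨(t, b⁻¹ • x, 0, p.1), ht, Prod.ext rfl ?_⟩
          simp only [G, Pi.smul_apply, smul_eq_mul, mul_smul, ← Finset.smul_sum, hx]
          rw [ha, smul_add, smul_smul, smul_smul, inv_mul_cancel₀ hb]
          module
        · refine h2 ⟨(t, a⁻¹ • x, -(a⁻¹ * b), p.2), ht, Prod.ext ?_ rfl⟩
          simp only [G, Pi.smul_apply, smul_eq_mul, mul_smul, ← Finset.smul_sum, hx]
          rw [smul_add, smul_smul, inv_mul_cancel₀ ha, smul_smul]
          module
  -- The arcs omitting `1` and `exp (i π)` cover the circle.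
  obtain ⟨B, hB, hB'⟩ := key 0
  obtain ⟨B', hBd, hBd'⟩ := key Real.pi
  have hdense : Dense (B ∪ B')ᶜ := by
    apply dense_compl_of_dimH_lt_finrank
    rw [dimH_union, max_lt_iff]
    have : Module.finrank ℝ ((Fin n → ℝ) × (Fin n → ℝ)) = 2 * n := by simp; omega
    rw [this]
    exact ⟨hB, hBd⟩
  refine hdense.mono fun p hp => ?_
  simp only [Set.mem_compl_iff, Set.mem_union, not_or] at hp
  have hcover : ∀ z : Circle, (∃ t ∈ arc 0, Circle.exp t = z) ∨ ∃ t ∈ arc Real.pi, Circle.exp t = z := by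
    intro z
    by_cases hz : z = Circle.exp 0
    · right
      refine exists_mem_arc ?_
      rw [hz, Circle.exp_zero]
      exact fun h => Circle.exp_pi_ne_one h.symm
    · exact Or.inl (exists_mem_arc hz)
  refine ⟨fun z => ?_, fun z => ?_⟩
  · rcases hcover z with ⟨t, ht, rfl⟩ | ⟨t, ht, rfl⟩
    exacts [(hB' p hp.1).1 t ht, (hBd' p hp.2).1 t ht]
  · rcases hcover z with ⟨t, ht, rfl⟩ | ⟨t, ht, rfl⟩
    exacts [(hB' p hp.1).2 t ht, (hBd' p hp.2).2 t ht]

end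

/-! ### The upper bound. -/

section

variable {n : ℕ} {γ : Circle → RP n}

/-- The samples are `t j - s, t j + s` for one small `s`. From index `2 N` on, `τ` stays at its last
value, which keeps it monotone on all of `ℕ`. -/
lemma exists_monotone_samples {d : ℝ → ℝ} {N : ℕ} (hN : 0 < N) {t : Fin N → ℝ} (ht : StrictMono t)
    {I : Set ℝ} (hI : IsOpen I) (hI' : I.OrdConnected) (htI : ∀ j, t j ∈ I)
    (hd : ∀ j, ∀ᶠ s in 𝓝[>] (0 : ℝ), d (t j - s) * d (t j + s) < 0) :
    ∃ (a b : ℝ) (τ : ℕ → ℝ), a < b ∧ Set.Icc a b ⊆ I ∧ Monotone τ ∧ (∀ k, τ k ∈ Set.Icc a b) ∧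
      ∀ j < N, d (τ (2 * j)) * d (τ (2 * j + 1)) < 0 := by
  have h1 : ∀ j, ∀ᶠ s in 𝓝[>] (0 : ℝ), t j - s ∈ I ∧ t j + s ∈ I := by
    intro j
    have h2 : Filter.Tendsto (fun s : ℝ => t j - s) (𝓝 0) (𝓝 (t j)) := by
      simpa using (continuous_const.sub continuous_id).tendsto (0 : ℝ) (f := fun s : ℝ => t j - s)
    have h3 : Filter.Tendsto (fun s : ℝ => t j + s) (𝓝 0) (𝓝 (t j)) := by
      simpa using (continuous_const.add continuous_id).tendsto (0 : ℝ) (f := fun s : ℝ => t j + s)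
    exact (h2.eventually (hI.mem_nhds (htI j))).filter_mono nhdsWithin_le_nhds |>.and
      ((h3.eventually (hI.mem_nhds (htI j))).filter_mono nhdsWithin_le_nhds)
  have h2 : ∀ j k, ∀ᶠ s in 𝓝[>] (0 : ℝ), j < k → t j + s ≤ t k - s := by
    intro j k
    by_cases hjk : j < k
    · have h3 : ∀ᶠ s in 𝓝 (0 : ℝ), s < (t k - t j) / 2 :=
        eventually_lt_nhds (by have := ht hjk; linarith)
      filter_upwards [h3.filter_mono nhdsWithin_le_nhds] with s hs _
      linarith
    · exact Filter.Eventually.of_forall fun s h => absurd h hjk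
  obtain ⟨s, hs1, hs2, hs3, hs0⟩ := ((Filter.eventually_all.2 h1).and
    ((Filter.eventually_all.2 fun j => Filter.eventually_all.2 (h2 j)).and
    ((Filter.eventually_all.2 hd).and self_mem_nhdsWithin))).exists
  have hs0 : 0 < s := hs0
  let ι : ℕ → Fin N := fun k => ⟨min (k / 2) (N - 1), by omega⟩
  let τ : ℕ → ℝ := fun k => if k % 2 = 0 ∧ k < 2 * N then t (ι k) - s else t (ι k) + s
  have hτ : Monotone τ := by
    refine monotone_nat_of_le_succ fun k => ?_
    by_cases hk : k % 2 = 0 ∧ k < 2 * N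
    · have : ι (k + 1) = ι k := by simp only [ι, Fin.mk.injEq]; omega
      simp only [τ]
      rw [if_pos hk, if_neg (by omega), this]
      linarith
    · by_cases hk' : (k + 1) % 2 = 0 ∧ k + 1 < 2 * N
      · simp only [τ]
        rw [if_neg hk, if_pos hk']
        refine hs2 _ _ ?_
        simp only [ι, Fin.mk_lt_mk]; omega
      · simp only [τ]
        rw [if_neg hk, if_neg hk']
        have : ι (k + 1) = ι k := by simp only [ι, Fin.mk.injEq]; omega
        rw [this]
  have hτ0 : ∀ k (hk : k < N), τ (2 * k) = t ⟨k, hk⟩ - s := by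
    intro k hk
    simp only [τ]
    rw [if_pos (by omega)]
    congr 2
    simp only [ι, Fin.mk.injEq]; omega
  have hτ1 : ∀ k (hk : k < N), τ (2 * k + 1) = t ⟨k, hk⟩ + s := by
    intro k hk
    simp only [τ]
    rw [if_neg (by omega)]
    congr 2
    simp only [ι, Fin.mk.injEq]; omega
  have hle : ∀ k, τ k ≤ τ (2 * (N - 1) + 1) := by
    intro k
    rw [hτ1 _ (by omega)]
    have h3 : ι k ≤ ⟨N - 1, by omega⟩ := by
      rw [Fin.le_def]; simp only [ι]; omega
    have h4 := ht.monotone h3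
    simp only [τ]
    split_ifs <;> linarith
  refine ⟨τ 0, τ (2 * (N - 1) + 1), τ, ?_, ?_, hτ, fun k => ⟨hτ (Nat.zero_le k), hle k⟩, ?_⟩
  · have h3 := hτ0 0 hN
    rw [Nat.mul_zero] at h3
    have h4 : τ 1 ≤ _ := hle 1
    have h5 := hτ1 0 hN
    rw [Nat.mul_zero] at h5
    rw [h5] at h4
    rw [h3]
    linarith
  · refine hI'.out ?_ ?_
    · have h3 := hτ0 0 hN
      rw [Nat.mul_zero] at h3
      rw [h3]; exact (hs1 _).1
    · rw [hτ1 _ (by omega)]; exact (hs1 _).2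
  · intro j hj
    rw [hτ0 j hj, hτ1 j hj]
    exact hs3 _

/-- The coordinates of a pair of vectors, as complex numbers. -/
noncomputable def Chart.pair {θ : ℝ} (C : Chart γ θ) (v w : Fin n → ℝ) (i : ℕ) (t : ℝ) : ℂ :=
  (C.q i t v : ℂ) + (C.q i t w : ℂ) * Complex.I

lemma Chart.area_pair {θ : ℝ} (C : Chart γ θ) (v w : Fin n → ℝ) (i j : ℕ) (s t : ℝ) :
    area (C.pair v w i s) (C.pair v w j t)
      = C.q i s v * C.q j t w - C.q i s w * C.q j t v := by
  simp [area, Chart.pair]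

lemma Chart.hasDerivAt_pair {θ : ℝ} (C : Chart γ θ) (v w : Fin n → ℝ) (i : ℕ) {t : ℝ}
    (ht : t ∈ arc θ) :
    HasDerivAt (C.pair v w i) (C.β i t * C.pair v w (i + 1) t) t := by
  have h1 := (C.hasDerivAt_apply v i ht).ofReal_comp
  have h2 := (C.hasDerivAt_apply w i ht).ofReal_comp
  refine (h1.add (h2.mul_const Complex.I)).congr_deriv ?_
  simp only [Chart.pair]; push_cast; ring

/-- The other term of the product rule is a multiple of the area of `V 1` with itself. -/
lemma Chart.hasDerivAt_area {θ : ℝ} (C : Chart γ θ) (v w : Fin n → ℝ) {t : ℝ} (ht : t ∈ arc θ) :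
    HasDerivAt (fun t => area (C.pair v w 0 t) (C.pair v w 1 t))
      (C.β 1 t * area (C.pair v w 0 t) (C.pair v w 2 t)) t := by
  simp only [Chart.area_pair]
  have h := ((C.hasDerivAt_apply v 0 ht).mul (C.hasDerivAt_apply w 1 ht)).sub
    ((C.hasDerivAt_apply w 0 ht).mul (C.hasDerivAt_apply v 1 ht))
  refine h.congr_deriv ?_
  ring

/-- A plane meets at most `2n - 4` codimension-two osculating spaces, if it meets them simply. -/
theorem Chart.card_le {θ : ℝ} (C : Chart γ θ) (hn : 2 ≤ n) (v w : Fin n → ℝ) (S : Finset ℝ)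
    (hS : ↑S ⊆ arc θ) (h0 : ∀ t ∈ S, area (C.pair v w 0 t) (C.pair v w 1 t) = 0)
    (h2 : ∀ t ∈ S, area (C.pair v w 0 t) (C.pair v w 2 t) ≠ 0) : S.card ≤ 2 * (n - 2) := by
  rcases Nat.eq_zero_or_pos S.card with h | hpos
  · omega
  obtain ⟨a, b, τ, hab, hsub, hτ, hτm, hneg⟩ := exists_monotone_samples
    (d := fun t => area (C.pair v w 0 t) (C.pair v w 1 t)) hpos (S.orderEmbOfFin rfl).strictMono
    (isOpen_arc θ) Set.ordConnected_Ioo (fun j => hS (S.orderEmbOfFin_mem rfl j)) (fun j => by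
      have hj := S.orderEmbOfFin_mem rfl j
      exact eventually_mul_neg_of_deriv_ne_zero (C.hasDerivAt_area v w (hS hj))
        (mul_ne_zero (C.β_pos 1 _ (hS hj)).ne' (h2 _ hj)) (h0 _ hj))
  exact continuous_chain_le hn hab (β := C.β) (V := C.pair v w)
    (fun i t ht => (C.β_pos i t (hsub ht)).le)
    (fun i => (C.contDiffOn_β i).continuousOn.mono hsub)
    (fun i t ht => C.hasDerivAt_pair v w i (hsub ht))
    (fun i hi t _ => by simp [Chart.pair, C.q_eq_zero i hi]) hτ hτm hneg

theorem mem_discriminant {v : Fin n → ℝ} (hv : v ≠ 0) :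
    Projectivization.mk ℝ v hv ∈ discriminant γ ↔ ∃ z, v ∈ osculating γ (n - 2) z := by
  simp [discriminant]

/-- Several nonproportional vectors remain nonproportional under small perturbations. -/
lemma exists_nhds_linearIndependent {N : ℕ} {v : Fin N → Fin n → ℝ}
    (h : ∀ i j, i ≠ j → LinearIndependent ℝ ![v i, v j]) :
    ∃ O : Fin N → Set (Fin n → ℝ), (∀ i, O i ∈ 𝓝 (v i)) ∧ ∀ u : Fin N → Fin n → ℝ,
      (∀ i, u i ∈ O i) → ∀ i j, i ≠ j → LinearIndependent ℝ ![u i, u j] := by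
  have hev : ∀ᶠ u in 𝓝 v, ∀ i j, i ≠ j → LinearIndependent ℝ ![u i, u j] := by
    refine Filter.eventually_all.2 fun i => Filter.eventually_all.2 fun j => ?_
    by_cases hij : i = j
    · exact Filter.Eventually.of_forall fun u hne => absurd hij hne
    · have hc : Continuous fun u : Fin N → Fin n → ℝ => ![u i, u j] := by
        refine continuous_pi fun k => ?_
        fin_cases k
        exacts [continuous_apply i, continuous_apply j]
      filter_upwards [hc.continuousAt.eventually (h i j hij).eventually] with u hu _ using hu
  obtain ⟨ε, hε, hball⟩ := Metric.eventually_nhds_iff_ball.1 hev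
  exact ⟨fun i => Metric.ball (v i) ε, fun i => Metric.ball_mem_nhds _ hε, fun u hu =>
    hball u ((dist_pi_lt_iff hε).2 hu)⟩

/-- A line transversal to the discriminant meets it in at most `2n - 4` points. -/
theorem IsConvex.encard_le (hn : 3 ≤ n) (hγ : IsConvex γ) {W : Submodule ℝ (Fin n → ℝ)}
    (hW : Module.finrank ℝ W = 2) (htr : IsTransversal W (discriminant γ)) :
    (discriminant γ ∩ points W).encard ≤ ((2 * n - 4 : ℕ) : ℕ∞) := by
  by_contra hgt
  push Not at hgt
  obtain ⟨w₁, w₂, hw⟩ : ∃ w₁ w₂ : Fin n → ℝ, W = Submodule.span ℝ {w₁, w₂} := by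
    let B := Module.finBasisOfFinrankEq ℝ W hW
    refine ⟨B 0, B 1, ?_⟩
    have h1 := B.span_eq
    have h2 := congrArg (Submodule.map W.subtype) h1
    rw [Submodule.map_span, Submodule.map_top, Submodule.range_subtype] at h2
    refine h2.symm.trans (congrArg _ ?_)
    ext x
    simp [Fin.exists_fin_two, eq_comm]
  subst hw
  -- Exactly one point too many. These points are carried over to a generic plane near `W`, where
  -- they stay pairwise distinct.
  obtain ⟨P, hP, hPc⟩ := Set.exists_subset_encard_eq (Order.add_one_le_of_lt hgt)
  have hPfin : P.Finite := Set.finite_of_encard_eq_coe (k := 2 * n - 4 + 1) (by rw [hPc]; rfl)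
  set N := 2 * n - 4 + 1 with hN
  have hcard : hPfin.toFinset.card = N := by
    rw [← Set.ncard_eq_toFinset_card P hPfin, Set.ncard, hPc]; rfl
  let pt : Fin N ≃ hPfin.toFinset := (hPfin.toFinset.equivFinOfCardEq hcard).symm
  let v : Fin N → Fin n → ℝ := fun i => (pt i : RP n).rep
  have hv0 : ∀ i, v i ≠ 0 := fun i => Projectivization.rep_nonzero _
  have hvmk : ∀ i, Projectivization.mk ℝ (v i) (hv0 i) = pt i := fun i =>
    Projectivization.mk_rep _
  have hpP : ∀ i, (pt i : RP n) ∈ discriminant γ ∩ points (Submodule.span ℝ {w₁, w₂}) := fun i =>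
    hP (hPfin.mem_toFinset.1 (pt i).2)
  have hvW : ∀ i, v i ∈ Submodule.span ℝ {w₁, w₂} := fun i => by
    have h1 := (hpP i).2
    have h2 : (pt i : RP n).submodule ≤ Submodule.span ℝ {w₁, w₂} := h1
    rw [Projectivization.submodule_eq] at h2
    exact h2 (Submodule.mem_span_singleton_self _)
  have hvD : ∀ i, Projectivization.mk ℝ (v i) (hv0 i) ∈ discriminant γ := fun i => by
    rw [hvmk]; exact (hpP i).1
  have hvli : ∀ i j, i ≠ j → LinearIndependent ℝ ![v i, v j] := by
    intro i j hij
    rw [LinearIndependent.pair_iff' (hv0 i)]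
    intro a ha
    apply hij
    apply pt.injective
    apply Subtype.ext
    rw [← hvmk, ← hvmk, eq_comm, Projectivization.mk_eq_mk_iff']
    exact ⟨a, ha⟩
  obtain ⟨O, hO, hOli⟩ := exists_nhds_linearIndependent hvli
  have hev : ∀ᶠ p : (Fin n → ℝ) × (Fin n → ℝ) in 𝓝 (w₁, w₂), ∀ i, ∃ a b : ℝ,
      a • p.1 + b • p.2 ∈ O i ∧
      ∃ h0 : a • p.1 + b • p.2 ≠ 0, Projectivization.mk ℝ _ h0 ∈ discriminant γ :=
    Filter.eventually_all.2 fun i =>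
      (htr (v i) (hv0 i) (hvW i) (hvD i)).eventually (hvW i) (hv0 i) (hvD i) (hO i)
  obtain ⟨⟨x, y⟩, ⟨hg1, hg2⟩, hxy⟩ := (hγ.dense_generic hn).inter_nhds_nonempty hev
  simp only at hg1 hg2
  choose a b hab hab0 habD using hxy
  simp only [mem_discriminant] at habD
  choose z hz using habD
  have hli := hOli _ hab
  -- Two nonproportional vectors in one osculating space would put the whole plane into an
  -- osculating hyperplane, against genericity.
  have hzinj : Function.Injective z := by
    intro i j hij
    by_contra hne
    have h1 := hli i j hne
    rw [LinearIndependent.pair_iff] at h1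
    have hdet : a i * b j - a j * b i ≠ 0 := by
      intro h0
      have h2 := h1 (a j) (-a i) (by
        have : a j * b i = a i * b j := by linarith
        rw [smul_add, smul_add, smul_smul, smul_smul, smul_smul, smul_smul, this]; module)
      have h3 := h1 (b j) (-b i) (by
        have : a j * b i = a i * b j := by linarith
        rw [smul_add, smul_add, smul_smul, smul_smul, smul_smul, smul_smul,
          show b j * a i = a j * b i by linarith]; module)
      exact hab0 i (by rw [neg_eq_zero.1 h2.2, neg_eq_zero.1 h3.2]; simp)
    have hi := hz i
    have hj := hz j
    rw [← hij] at hj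
    refine hg1 (z i) ⟨osculating_mono γ (show n - 2 ≤ n - 1 by omega) (z i) ?_, osculating_mono γ (show n - 2 ≤ n - 1 by omega) (z i) ?_⟩
    · exact (Submodule.smul_mem_iff _ hdet).1 (by
        convert Submodule.sub_mem _ (Submodule.smul_mem _ (b j) hi)
          (Submodule.smul_mem _ (b i) hj) using 1
        module)
    · exact (Submodule.smul_mem_iff _ hdet).1 (by
        convert Submodule.sub_mem _ (Submodule.smul_mem _ (a i) hj)
          (Submodule.smul_mem _ (a j) hi) using 1
        module)
  classical
  obtain ⟨θ, hθ⟩ := exists_exp_notMem (Finset.univ.image z)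
  obtain ⟨C⟩ := hγ.nonempty_chart (by omega) θ
  have hex : ∀ i, ∃ t ∈ arc θ, Circle.exp t = z i := fun i =>
    exists_mem_arc (by intro h; exact hθ (by simp [← h]))
  choose t htarc htz using hex
  have htinj : Function.Injective t := fun i j hij => hzinj (by rw [← htz, ← htz, hij])
  have hcount := C.card_le (by omega) x y (Finset.univ.image t) (by
    rw [Finset.coe_image]; rintro _ ⟨i, -, rfl⟩; exact htarc i) ?_ ?_
  · rw [Finset.card_image_of_injective _ htinj, Finset.card_univ, Fintype.card_fin] at hcount
    omega
  all_goals
    intro s hs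
    obtain ⟨i, -, rfl⟩ := Finset.mem_image.1 hs
    have h1 := (C.mem_iff 2 (by omega) (t i) (htarc i) _).1 (by rw [htz i]; exact hz i)
    have e0 := h1 0 (by omega)
    have e1 := h1 1 (by omega)
    rw [map_add, map_smul, map_smul, smul_eq_mul, smul_eq_mul] at e0 e1
    have hne : a i ≠ 0 ∨ b i ≠ 0 := by
      by_contra hc
      push Not at hc
      exact hab0 i (by rw [hc.1, hc.2]; simp)
    rw [Chart.area_pair]
  · rcases hne with h | h
    · refine (mul_eq_zero.1 ?_).resolve_left h
      linear_combination (C.q 1 (t i) y) * e0 - (C.q 0 (t i) y) * e1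
    · refine (mul_eq_zero.1 ?_).resolve_left h
      linear_combination (C.q 0 (t i) x) * e1 - (C.q 1 (t i) x) * e0
  · intro h0
    have hnz : C.q 0 (t i) x ≠ 0 ∨ C.q 0 (t i) y ≠ 0 := by
      by_contra hc
      push Not at hc
      refine hg1 (z i) ?_
      rw [← htz i]
      refine ⟨(C.mem_iff 1 (by omega) _ (htarc i) _).2 ?_,
        (C.mem_iff 1 (by omega) _ (htarc i) _).2 ?_⟩
      · intro j hj; rw [show j = 0 by omega]; exact hc.1
      · intro j hj; rw [show j = 0 by omega]; exact hc.2
    -- A multiple zero makes `V 2` parallel to `V 0 ≠ 0`, so the relation satisfied by `V 0` holds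
    -- for `V 2` as well, and the vector lies in the osculating space of codimension three.
    have e2 : a i * C.q 2 (t i) x + b i * C.q 2 (t i) y = 0 := by
      rcases hnz with h | h
      · refine (mul_eq_zero.1 ?_).resolve_left h
        linear_combination (C.q 2 (t i) x) * e0 + b i * h0
      · refine (mul_eq_zero.1 ?_).resolve_left h
        linear_combination (C.q 2 (t i) y) * e0 - a i * h0
    have h3 := hg2 (z i) (a i) (b i) (by
      rw [← htz i]
      refine (C.mem_iff 3 hn (t i) (htarc i) _).2 fun j hj => ?_
      rw [map_add, map_smul, map_smul, smul_eq_mul, smul_eq_mul]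
      interval_cases j
      exacts [e0, e1, e2])
    rcases hne with h | h
    exacts [h h3.1, h h3.2]

end

/-! ### The discriminant as a smooth hypersurface near its simple points. -/

section Implicit

variable {P : Type*} [NormedAddCommGroup P] [NormedSpace ℝ P]

lemma isInvertible_comp_inr {L : P × ℝ →L[ℝ] ℝ} (h : L (0, 1) ≠ 0) :
    (L ∘L .inr ℝ P ℝ).IsInvertible := by
  refine ⟨ContinuousLinearEquiv.unitsEquivAut ℝ (Units.mk0 _ h), ?_⟩
  ext
  simp

/-- The solution of a smooth scalar equation in one unknown is smooth in the parameters on a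
neighbourhood. -/
lemma exists_smooth_implicit [CompleteSpace P] {f : P × ℝ → ℝ} {O : Set (P × ℝ)} (hO : IsOpen O)
    (hf : ContDiffOn ℝ ∞ f O) (hd : ∀ p ∈ O, fderiv ℝ f p (0, 1) ≠ 0) {x₀ : P} {t₀ : ℝ}
    (h₀ : (x₀, t₀) ∈ O) (hf₀ : f (x₀, t₀) = 0) :
    ∃ (ψ : P → ℝ) (U : Set P), IsOpen U ∧ x₀ ∈ U ∧ ContDiffOn ℝ ∞ ψ U ∧ ψ x₀ = t₀ ∧
      (∀ x ∈ U, (x, ψ x) ∈ O ∧ f (x, ψ x) = 0) ∧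
      ∀ᶠ p in 𝓝 (x₀, t₀), f p = 0 → ψ p.1 = p.2 := by
  have hne : (∞ : WithTop ℕ∞) ≠ 0 := by simp
  have hc : ∀ p ∈ O, ContDiffAt ℝ ∞ f p := fun p hp => hf.contDiffAt (hO.mem_nhds hp)
  set ψ := (hc _ h₀).implicitFunction hne (isInvertible_comp_inr (hd _ h₀)) with hψ
  have hself : ψ x₀ = t₀ := (hc _ h₀).implicitFunction_apply_self hne _
  have hiff := (hc _ h₀).eventually_apply_eq_iff_implicitFunction hne
    (isInvertible_comp_inr (hd _ h₀))
  rw [hf₀] at hiff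
  have hsm : ContDiffAt ℝ ∞ ψ x₀ := (hc _ h₀).contDiffAt_implicitFunction hne _
  have hψc : ∀ᶠ x in 𝓝 x₀, ContinuousAt ψ x :=
    ((hsm.of_le (show (1 : WithTop ℕ∞) ≤ ∞ by norm_cast)).eventually (by simp)).mono
      fun x hx => hx.continuousAt
  obtain ⟨A, hA, hAo, hA₀⟩ := eventually_nhds_iff.1 hiff
  have hpair : ContinuousAt (fun x => (x, ψ x)) x₀ := continuousAt_id.prodMk hsm.continuousAt
  have hin : ∀ᶠ x in 𝓝 x₀, (x, ψ x) ∈ O ∩ A :=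
    hpair.eventually_mem ((hO.inter hAo).mem_nhds (by rw [hself]; exact ⟨h₀, hA₀⟩))
  obtain ⟨U, hU, hUo, hU₀⟩ := eventually_nhds_iff.1 (hin.and hψc)
  refine ⟨ψ, U, hUo, hU₀, fun x hx => ?_, hself, fun x hx => ⟨(hU x hx).1.1, ?_⟩,
    hiff.mono fun p hp => hp.1⟩
  · have hp := (hU x hx).1.1
    have hfp : f (x, ψ x) = 0 := (hA _ (hU x hx).1.2).2 rfl
    have hiff' := (hc _ hp).eventually_apply_eq_iff_implicitFunction hne
      (isInvertible_comp_inr (hd _ hp))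
    rw [hfp] at hiff'
    have hpair' : ContinuousAt (fun x => (x, ψ x)) x := continuousAt_id.prodMk (hU x hx).2
    -- By uniqueness, the implicit function based at `(x, ψ x)` agrees with `ψ` near `x`, so `ψ` is
    -- smooth at `x` too.
    have heq : ψ =ᶠ[𝓝 x] (hc _ hp).implicitFunction hne (isInvertible_comp_inr (hd _ hp)) := by
      filter_upwards [hpair'.eventually hiff', hpair'.eventually_mem (hAo.mem_nhds (hU x hx).1.2)]
        with y h1 h2
      exact (h1.1 ((hA _ h2).2 rfl)).symm
    exact (((hc _ hp).contDiffAt_implicitFunction hne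
      (isInvertible_comp_inr (hd _ hp))).congr_of_eventuallyEq heq).contDiffWithinAt
  · exact (hA _ (hU x hx).1.2).2 rfl

end Implicit

section

variable {n : ℕ} {γ : Circle → RP n}

/-- A plane meets the discriminant transversally at a point which lies in only one osculating space
of codimension two, and not in that of codimension three, unless the plane is contained in the
osculating hyperplane. -/
theorem IsConvex.isTransversalAt (hn : 3 ≤ n) (hγ : IsConvex γ) {W : Submodule ℝ (Fin n → ℝ)}
    {v w : Fin n → ℝ} {z : Circle} (hv : v ∈ osculating γ (n - 2) z)
    (hv3 : v ∉ osculating γ (n - 3) z) (hv' : ∀ z', z' ≠ z → v ∉ osculating γ (n - 2) z')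
    (hw : w ∈ W) (hwz : w ∉ osculating γ (n - 1) z) :
    IsTransversalAt W (discriminant γ) v := by
  obtain ⟨θ, t₀, ht₀, rfl⟩ := exists_arc_center z
  obtain ⟨C⟩ := hγ.nonempty_chart (by omega) θ
  have hvq := (C.mem_iff 2 (by omega) t₀ ht₀ v).1 hv
  have hq0 : C.q 0 t₀ v = 0 := hvq 0 (by omega)
  have hq1 : C.q 1 t₀ v = 0 := hvq 1 (by omega)
  have hq2 : C.q 2 t₀ v ≠ 0 := by
    intro h
    refine hv3 ((C.mem_iff 3 hn t₀ ht₀ v).2 fun j hj => ?_)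
    interval_cases j
    exacts [hq0, hq1, h]
  have hw0 : C.q 0 t₀ w ≠ 0 := by
    intro h
    refine hwz ((C.mem_iff 1 (by omega) t₀ ht₀ w).2 fun j hj => ?_)
    interval_cases j
    exact h
  -- the parameter of the osculating space as a function of the point
  have hsmooth : ∀ i, ContDiffOn ℝ ∞ (fun p : (Fin n → ℝ) × ℝ => C.q i p.2 p.1)
      {p | p.2 ∈ arc θ} := fun i =>
    ((C.contDiffOn_q i).comp contDiff_snd.contDiffOn fun p hp => hp).clm_apply
      contDiff_fst.contDiffOn
  have harc : IsOpen {p : (Fin n → ℝ) × ℝ | p.2 ∈ arc θ} := (isOpen_arc θ).preimage continuous_snd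
  have hO : IsOpen {p : (Fin n → ℝ) × ℝ | p.2 ∈ arc θ ∧ C.q 2 p.2 p.1 ≠ 0} :=
    (hsmooth 2).continuousOn.isOpen_inter_preimage harc isOpen_compl_singleton
  obtain ⟨ζ, U, hU, hvU, hζ, hζv, hζU, hζuniq⟩ := exists_smooth_implicit
    (f := fun p => C.q 1 p.2 p.1) hO ((hsmooth 1).mono fun p hp => hp.1) (by
      rintro ⟨x, t⟩ ⟨ht, hne⟩
      have h1 : HasFDerivAt (fun p : (Fin n → ℝ) × ℝ => C.q 1 p.2 p.1)
          (fderiv ℝ (fun p : (Fin n → ℝ) × ℝ => C.q 1 p.2 p.1) (x, t)) (x, t) :=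
        (((hsmooth 1).contDiffAt (harc.mem_nhds ht)).differentiableAt (by simp)).hasFDerivAt
      have h2 : HasDerivAt (fun s : ℝ => (x, s)) ((0 : Fin n → ℝ), (1 : ℝ)) t :=
        (hasDerivAt_const t x).prodMk (hasDerivAt_id t)
      have h3 := (h1.comp_hasDerivAt t h2).unique (C.hasDerivAt_apply x 1 ht)
      rw [h3]
      exact mul_ne_zero (C.β_pos 1 t ht).ne' hne) (x₀ := v) (t₀ := t₀) ⟨ht₀, hq2⟩ hq1
  -- points near `v` meet only osculating spaces at points near `z`
  obtain ⟨N, hN, ε, hε, hNε⟩ : ∃ N ∈ 𝓝 v, ∃ ε > 0, ∀ x ∈ N, ∀ t ∈ Metric.ball t₀ ε,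
      C.q 1 t x = 0 → ζ x = t := by
    rw [nhds_prod_eq] at hζuniq
    obtain ⟨p, hp, r, hr, hpr⟩ := Filter.eventually_prod_iff.1 hζuniq
    obtain ⟨ε, hε, hball⟩ := Metric.eventually_nhds_iff_ball.1 hr
    exact ⟨{x | p x}, hp, ε, hε, fun x hx t ht => hpr hx (hball t ht)⟩
  set B := Metric.ball t₀ ε ∩ arc θ with hB
  have hBo : IsOpen (Circle.exp '' B) :=
    isLocalHomeomorph_circleExp.isOpenMap _ (Metric.isOpen_ball.inter (isOpen_arc θ))
  -- Vectors in osculating spaces at parameters away from `z` form a closed set, by compactness of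
  -- the circle. It misses `v`, so near `v` only the branch through `z` is seen.
  have hfar : IsClosed (Prod.snd '' ({p : Circle × (Fin n → ℝ) | p.2 ∈ osculating γ (n - 2) p.1} ∩
      (Prod.fst ⁻¹' (Circle.exp '' B)ᶜ))) :=
    isClosedMap_snd_of_compactSpace _ ((hγ.isClosed_osculating (by omega) _ (by omega)).inter
      (hBo.isClosed_compl.preimage continuous_fst))
  have hvfar : v ∉ Prod.snd '' ({p : Circle × (Fin n → ℝ) | p.2 ∈ osculating γ (n - 2) p.1} ∩
      (Prod.fst ⁻¹' (Circle.exp '' B)ᶜ)) := by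
    rintro ⟨⟨z', x⟩, ⟨h1, h2⟩, h3⟩
    have h3 : x = v := h3
    subst h3
    refine hv' z' ?_ h1
    rintro rfl
    exact h2 ⟨t₀, ⟨Metric.mem_ball_self hε, ht₀⟩, rfl⟩
  set U' := (U ∩ interior N) ∩ (Prod.snd '' ({p : Circle × (Fin n → ℝ) |
    p.2 ∈ osculating γ (n - 2) p.1} ∩ (Prod.fst ⁻¹' (Circle.exp '' B)ᶜ)))ᶜ with hU'
  have hU'o : IsOpen U' := (hU.inter isOpen_interior).inter hfar.isOpen_compl
  have hvU' : v ∈ U' := ⟨⟨hvU, mem_interior_iff_mem_nhds.2 hN⟩, hvfar⟩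
  have hg : ContDiffOn ℝ ∞ (fun x => C.q 0 (ζ x) x) U' := by
    refine ContDiffOn.clm_apply ?_ contDiff_id.contDiffOn
    exact (C.contDiffOn_q 0).comp (hζ.mono fun x hx => hx.1.1) fun x hx => (hζU x hx.1.1).1.1
  -- The equation `q 1 = 0` is solved for the parameter by `ζ`, and `q 0 = 0` remains as the local
  -- equation. Its derivative along `w` at `v` is `q 0 t₀ w`: the contribution of `ζ` has the factor
  -- `q 1 t₀ v = 0`.
  refine ⟨U', fun x => C.q 0 (ζ x) x, hU'o, hvU', hg, fun x hx hxU => ?_, w, hw, ?_⟩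
  · rw [mem_discriminant]
    obtain ⟨⟨hx1, hx2⟩, hx3⟩ := hxU
    constructor
    · rintro ⟨z', hz'⟩
      have hzB : z' ∈ Circle.exp '' B := by
        by_contra hc
        exact hx3 ⟨(z', x), ⟨hz', hc⟩, rfl⟩
      obtain ⟨t, ht, rfl⟩ := hzB
      have h1 := (C.mem_iff 2 (by omega) t ht.2 x).1 hz'
      change C.q 0 (ζ x) x = 0
      rw [hNε x (interior_subset hx2) t ht.1 (h1 1 (by omega))]
      exact h1 0 (by omega)
    · intro h0
      refine ⟨Circle.exp (ζ x), (C.mem_iff 2 (by omega) _ (hζU x hx1).1.1 x).2 fun j hj => ?_⟩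
      interval_cases j
      exacts [h0, (hζU x hx1).2]
  · have h1 : HasFDerivAt (fun x => C.q 0 (ζ x) x) (fderiv ℝ (fun x => C.q 0 (ζ x) x) v) v :=
      ((hg.contDiffAt (hU'o.mem_nhds hvU')).differentiableAt (by simp)).hasFDerivAt
    have hline : HasDerivAt (fun s : ℝ => v + s • w) w 0 := by
      simpa using ((hasDerivAt_id (0 : ℝ)).smul_const w).const_add v
    have hv0 : v + (0 : ℝ) • w = v := by simp
    have h2 : HasDerivAt (fun s : ℝ => C.q 0 (ζ (v + s • w)) (v + s • w))
        (fderiv ℝ (fun x => C.q 0 (ζ x) x) v w) 0 :=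
      HasFDerivAt.comp_hasDerivAt (f := fun s : ℝ => v + s • w) (l := fun x => C.q 0 (ζ x) x)
        (0 : ℝ) (by rwa [hv0]) hline
    have hζd : HasFDerivAt ζ (fderiv ℝ ζ v) v :=
      ((hζ.contDiffAt (hU.mem_nhds hvU)).differentiableAt (by simp)).hasFDerivAt
    have h3 : HasDerivAt (fun s : ℝ => ζ (v + s • w)) (fderiv ℝ ζ v w) 0 :=
      HasFDerivAt.comp_hasDerivAt (f := fun s : ℝ => v + s • w) (0 : ℝ) (by rwa [hv0]) hline
    have h4 : HasDerivAt (fun s : ℝ => C.q 0 (ζ (v + s • w)))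
        (fderiv ℝ ζ v w • (C.β 0 t₀ • C.q 1 t₀)) 0 :=
      HasDerivAt.scomp (g₁ := C.q 0) (h := fun s : ℝ => ζ (v + s • w)) (0 : ℝ)
        (by rw [hv0, hζv]; exact C.hasDerivAt_q 0 t₀ ht₀) h3
    have h5 := h2.unique (h4.clm_apply hline)
    rw [h5]
    simp only [hv0, hζv]
    simpa [hq1] using hw0

end

/-! ### The lower bound: a line with `2n - 4` transversal intersection points. -/

section

variable {n : ℕ} {γ : Circle → RP n}

/-- Zeros at `S` together with zeros of order `k` at `T` are too many if their total number is at
least `n`. -/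
lemma IsConvex.eq_zero_of_zeros (hn : 1 ≤ n) (hγ : IsConvex γ) (T S : Finset Circle) {k : ℕ}
    (hk : k ≤ n) {v : Fin n → ℝ} (hT : ∀ z ∈ T, v ∈ osculating γ (n - k) z)
    (hS : ∀ z ∈ S, v ∈ osculating γ (n - 1) z) (hcard : n + T.card ≤ k * T.card + S.card) :
    v = 0 := by
  classical
  refine hγ.eq_zero_of_mem_osculating hn (T ∪ S \ T) (fun z => if z ∈ T then k else 1) ?_ ?_ ?_
  · intro z _; split_ifs <;> omega
  · rw [Finset.sum_union Finset.disjoint_sdiff, Finset.sum_congr rfl (fun z hz => if_pos hz),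
      Finset.sum_congr (s₁ := S \ T) rfl (fun z hz => if_neg (Finset.mem_sdiff.1 hz).2)]
    simp only [Finset.sum_const, smul_eq_mul, mul_one]
    have := Finset.le_card_sdiff T S
    rw [mul_comm]
    omega
  · intro z hz
    split_ifs with h
    · exact hT z h
    · exact hS z (Finset.mem_sdiff.1 ((Finset.mem_union.1 hz).resolve_left h)).1

/-- If a plane meets every osculating space of codimension two at most simply, so do its small
perturbations. -/
lemma IsConvex.eventually_simple (hn : 3 ≤ n) (hγ : IsConvex γ) {v₁ v₂ w : Fin n → ℝ}
    (h : ∀ x y : ℝ, (x, y) ≠ 0 → ∀ z, x • v₁ + y • v₂ ∉ osculating γ (n - 3) z ∧ ∀ z', z ≠ z' →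
      ¬ (x • v₁ + y • v₂ ∈ osculating γ (n - 2) z ∧ x • v₁ + y • v₂ ∈ osculating γ (n - 2) z')) :
    ∀ᶠ δ in 𝓝 (0 : ℝ), ∀ x y : ℝ, (x, y) ≠ 0 → ∀ z,
      x • v₁ + y • (v₂ + δ • w) ∉ osculating γ (n - 3) z ∧ ∀ z', z ≠ z' →
      ¬ (x • v₁ + y • (v₂ + δ • w) ∈ osculating γ (n - 2) z ∧
        x • v₁ + y • (v₂ + δ • w) ∈ osculating γ (n - 2) z') := by
  let u : ℝ × (ℝ × ℝ) → Fin n → ℝ := fun p => p.2.1 • v₁ + p.2.2 • (v₂ + p.1 • w)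
  have hu : Continuous u := by simp only [u]; fun_prop
  have hcl : ∀ k ≤ n, IsClosed {p : ℝ × ((ℝ × ℝ) × Circle) | u (p.1, p.2.1) ∈ osculating γ k p.2.2} :=
    fun k hk => (hγ.isClosed_osculating (by omega) k hk).preimage
      (f := fun p : ℝ × ((ℝ × ℝ) × Circle) => (p.2.2, u (p.1, p.2.1))) (by fun_prop)
  -- By homogeneity the coefficients may be taken on a sphere, so the parameters range over a
  -- compact set. Near the diagonal of the circle, `IsConvex.eventually_notMem_of_collision` gives
  -- openness.
  have key := ((isCompact_sphere (0 : ℝ × ℝ) 1).prod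
    (isCompact_univ (X := Circle × Circle))).eventually_forall_of_forall_eventually
    (x₀ := (0 : ℝ)) (P := fun δ k => u (δ, k.1) ∉ osculating γ (n - 3) k.2.1 ∧ (k.2.1 ≠ k.2.2 →
      ¬ (u (δ, k.1) ∈ osculating γ (n - 2) k.2.1 ∧ u (δ, k.1) ∈ osculating γ (n - 2) k.2.2))) ?_
  · filter_upwards [key] with δ hδ x y hxy z
    have hnorm : ‖(x, y)‖ ≠ 0 := norm_ne_zero_iff.2 hxy
    have hmem : ‖(x, y)‖⁻¹ • (x, y) ∈ Metric.sphere (0 : ℝ × ℝ) 1 := by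
      rw [mem_sphere_zero_iff_norm, norm_smul, norm_inv, norm_norm, inv_mul_cancel₀ hnorm]
    have hsm : u (δ, ‖(x, y)‖⁻¹ • (x, y)) = ‖(x, y)‖⁻¹ • (x • v₁ + y • (v₂ + δ • w)) := by
      simp only [u, Prod.smul_mk, smul_eq_mul]; module
    have hiff : ∀ k z', u (δ, ‖(x, y)‖⁻¹ • (x, y)) ∈ osculating γ k z' ↔
        x • v₁ + y • (v₂ + δ • w) ∈ osculating γ k z' := fun k z' => by
      rw [hsm]; exact Submodule.smul_mem_iff _ (inv_ne_zero hnorm)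
    refine ⟨fun hc => ?_, fun z' hz' hc => ?_⟩
    · exact (hδ (_, (z, z)) ⟨hmem, trivial⟩).1 ((hiff _ _).2 hc)
    · exact (hδ (_, (z, z')) ⟨hmem, trivial⟩).2 hz' ⟨(hiff _ _).2 hc.1, (hiff _ _).2 hc.2⟩
  · rintro ⟨⟨x, y⟩, ⟨z, z'⟩⟩ ⟨hxy, -⟩
    have hxy0 : (x, y) ≠ 0 := by
      rintro h0
      simp only [h0, Metric.mem_sphere, dist_self] at hxy
      norm_num at hxy
    have hu0 : u (0, (x, y)) = x • v₁ + y • v₂ := by simp [u]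
    have hh := h x y hxy0
    rw [← hu0] at hh
    have c1 : ContinuousAt (fun p : ℝ × ((ℝ × ℝ) × (Circle × Circle)) => (p.1, (p.2.1, p.2.2.1)))
        (0, ((x, y), (z, z'))) := by fun_prop
    have c2 : ContinuousAt (fun p : ℝ × ((ℝ × ℝ) × (Circle × Circle)) => (p.1, (p.2.1, p.2.2.2)))
        (0, ((x, y), (z, z'))) := by fun_prop
    refine Filter.Eventually.and ?_ ?_
    · exact c1.eventually_mem ((hcl (n - 3) (by omega)).isOpen_compl.mem_nhds (hh z).1)
    · by_cases hzz : z = z'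
      · subst hzz
        have c3 : ContinuousAt (fun p : ℝ × ((ℝ × ℝ) × (Circle × Circle)) =>
            ((p.2.2.1, p.2.2.2), u (p.1, p.2.1))) (0, ((x, y), (z, z))) := by fun_prop
        exact c3.eventually (hγ.eventually_notMem_of_collision hn (hh z).1)
      · have hor := (hh z).2 z' hzz
        rw [not_and_or] at hor
        rcases hor with h1 | h1
        · filter_upwards [c1.eventually_mem ((hcl (n - 2) (by omega)).isOpen_compl.mem_nhds h1)]
            with p hp _ hc using hp hc.1
        · filter_upwards [c2.eventually_mem ((hcl (n - 2) (by omega)).isOpen_compl.mem_nhds h1)]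
            with p hp _ hc using hp hc.2

/-- A function with a nondegenerate double zero has the sign of its second derivative nearby. -/
lemma eventually_pos_of_double_zero {f h : ℝ → ℝ} {x k : ℝ} (hf : ∀ᶠ y in 𝓝 x, HasDerivAt f (h y) y)
    (hh : HasDerivAt h k x) (hk : k ≠ 0) (hf0 : f x = 0) (hh0 : h x = 0) :
    ∀ᶠ s in 𝓝[>] (0 : ℝ), 0 < k * f (x - s) ∧ 0 < k * f (x + s) := by
  have h1 := eventually_nhdsWithin_sign_eq_of_deriv_pos (f := fun y => k * h y) (x₀ := x)
    (by rw [(hh.const_mul k).deriv]; exact mul_self_pos.2 hk) (by simp [hh0])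
  obtain ⟨ε, hε, hball⟩ := Metric.eventually_nhds_iff_ball.1 (hf.and h1)
  have h2 : ∀ᶠ s in 𝓝 (0 : ℝ), s < ε := eventually_lt_nhds hε
  filter_upwards [h2.filter_mono nhdsWithin_le_nhds, self_mem_nhdsWithin] with s hs hs0
  have hs0 : 0 < s := hs0
  rw [Real.ball_eq_Ioo] at hball
  constructor
  · obtain ⟨c, hc, hc'⟩ := exists_hasDerivAt_eq_slope f h (show x - s < x by linarith)
      (fun y hy => (hball y ⟨by linarith [hy.1], by linarith [hy.2]⟩).1.continuousAt.continuousWithinAt)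
      (fun y hy => (hball y ⟨by linarith [hy.1], by linarith [hy.2]⟩).1)
    have h3 := (hball c ⟨by linarith [hc.1], by linarith [hc.2]⟩).2
    rw [sign_neg (by linarith [hc.2] : c - x < 0), sign_eq_neg_one_iff] at h3
    rw [eq_div_iff (by linarith), hf0] at hc'
    have : f (x - s) = - (h c * s) := by linarith
    rw [this]
    nlinarith [mul_pos_of_neg_of_neg h3 (show -s < 0 by linarith)]
  · obtain ⟨c, hc, hc'⟩ := exists_hasDerivAt_eq_slope f h (show x < x + s by linarith)
      (fun y hy => (hball y ⟨by linarith [hy.1], by linarith [hy.2]⟩).1.continuousAt.continuousWithinAt)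
      (fun y hy => (hball y ⟨by linarith [hy.1], by linarith [hy.2]⟩).1)
    have h3 := (hball c ⟨by linarith [hc.1], by linarith [hc.2]⟩).2
    rw [sign_pos (by linarith [hc.1] : 0 < c - x), sign_eq_one_iff] at h3
    rw [eq_div_iff (by linarith), hf0] at hc'
    have : f (x + s) = h c * s := by linarith
    rw [this]
    nlinarith [mul_pos h3 hs0]

lemma exists_strictMono_mem_arc (θ : ℝ) (n : ℕ) :
    ∃ a : ℕ → ℝ, StrictMono a ∧ ∀ i < n, a i ∈ arc θ := by
  have hpi := Real.pi_pos
  have hn : (0 : ℝ) < n + 1 := by positivity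
  refine ⟨fun i => θ + 2 * Real.pi / (n + 1) * (i + 1), fun i j hij => ?_, fun i hi => ⟨?_, ?_⟩⟩
  · have : (i : ℝ) < j := by exact_mod_cast hij
    simp only
    gcongr
  · have : 0 < 2 * Real.pi / (n + 1) * ((i : ℝ) + 1) := by positivity
    linarith
  · have h1 : (i : ℝ) + 1 < n + 1 := by exact_mod_cast Nat.succ_lt_succ hi
    have : 2 * Real.pi / (n + 1) * ((i : ℝ) + 1) < 2 * Real.pi / (n + 1) * (n + 1) := by gcongr
    rw [div_mul_cancel₀ _ hn.ne'] at this
    linarith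

lemma Chart.mem_osculating_one {θ : ℝ} (C : Chart γ θ) (hn : 1 ≤ n) {t : ℝ} (ht : t ∈ arc θ)
    {v : Fin n → ℝ} : v ∈ osculating γ (n - 1) (Circle.exp t) ↔ C.q 0 t v = 0 := by
  rw [C.mem_iff 1 hn t ht]
  constructor
  · intro h; exact h 0 (by omega)
  · intro h j hj; rwa [show j = 0 by omega]

lemma Chart.mem_osculating_two {θ : ℝ} (C : Chart γ θ) (hn : 2 ≤ n) {t : ℝ} (ht : t ∈ arc θ)
    {v : Fin n → ℝ} :
    v ∈ osculating γ (n - 2) (Circle.exp t) ↔ C.q 0 t v = 0 ∧ C.q 1 t v = 0 := by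
  rw [C.mem_iff 2 hn t ht]
  constructor
  · intro h; exact ⟨h 0 (by omega), h 1 (by omega)⟩
  · rintro ⟨h0, h1⟩ j hj; interval_cases j; exacts [h0, h1]

lemma exists_exp_finset {θ : ℝ} {a : ℕ → ℝ} (ha : StrictMono a) {k : ℕ}
    (hk : ∀ i < k, a i ∈ arc θ) :
    ∃ S : Finset Circle, S.card = k ∧ ∀ z, z ∈ S ↔ ∃ i < k, Circle.exp (a i) = z := by
  classical
  refine ⟨(Finset.range k).image fun i => Circle.exp (a i), ?_, fun z => by simp⟩
  rw [Finset.card_image_of_injOn, Finset.card_range]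
  intro i hi j hj hij
  exact ha.injective (exp_injOn_arc θ (hk i (by simpa using hi)) (hk j (by simpa using hj)) hij)

/-- Interpolation at `n` points of the curve. -/
lemma IsConvex.exists_interpolation (hn : 1 ≤ n) (hγ : IsConvex γ) {θ : ℝ} (C : Chart γ θ)
    {a : ℕ → ℝ} (ha : StrictMono a) (ha' : ∀ i < n, a i ∈ arc θ) (c : ℕ → ℝ) :
    ∃ v, ∀ i < n, C.q 0 (a i) v = c i := by
  let L : (Fin n → ℝ) →ₗ[ℝ] (Fin n → ℝ) :=
    LinearMap.pi fun i : Fin n => (C.q 0 (a i) : (Fin n → ℝ) →ₗ[ℝ] ℝ)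
  have hL : ∀ v (i : Fin n), L v i = C.q 0 (a i) v := fun v i => rfl
  have hinj : Function.Injective L := by
    rw [injective_iff_map_eq_zero]
    intro v hv
    obtain ⟨S, hS, hS'⟩ := exists_exp_finset ha ha'
    refine hγ.eq_zero_of_zeros hn ∅ S (k := 1) hn (by simp) (fun z hz => ?_) (by simp [hS])
    obtain ⟨i, hi, rfl⟩ := (hS' z).1 hz
    rw [C.mem_osculating_one hn (ha' i hi), ← hL v ⟨i, hi⟩, hv]; rfl
  obtain ⟨v, hv⟩ := LinearMap.injective_iff_surjective.1 hinj fun i => c i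
  exact ⟨v, fun i hi => by rw [← hL v ⟨i, hi⟩, hv]⟩

lemma exists_zero_of_mul_neg {d : ℝ → ℝ} {a b : ℝ} (hab : a < b) (hd : ContinuousOn d (Set.Icc a b))
    (h : d a * d b < 0) : ∃ t ∈ Set.Ioo a b, d t = 0 := by
  rcases mul_neg_iff.1 h with ⟨h1, h2⟩ | ⟨h1, h2⟩
  · exact intermediate_value_Ioo' hab.le hd ⟨h2, h1⟩
  · exact intermediate_value_Ioo hab.le hd ⟨h1, h2⟩

/-- A vector in the kernel of a singular `2 × 2` matrix. -/
lemma exists_kernel {p q r s : ℝ} (h : p * s - q * r = 0) :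
    ∃ x y : ℝ, (x, y) ≠ 0 ∧ x * p + y * q = 0 ∧ x * r + y * s = 0 := by
  by_cases h1 : p = 0 ∧ q = 0
  · by_cases h2 : r = 0 ∧ s = 0
    · exact ⟨1, 0, by simp, by simp [h1.1], by simp [h2.1]⟩
    · refine ⟨-s, r, fun h0 => h2 ?_, by simp [h1.1, h1.2], by ring⟩
      rw [Prod.mk_eq_zero] at h0
      exact ⟨h0.2, neg_eq_zero.1 h0.1⟩
  · refine ⟨-q, p, fun h0 => h1 ?_, by ring, by linarith⟩
    rw [Prod.mk_eq_zero] at h0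
    exact ⟨h0.2, neg_eq_zero.1 h0.1⟩

/-- There is a line transversal to the discriminant which meets it in at least `2n - 4` points. -/
theorem IsConvex.exists_transversal (hn : 3 ≤ n) (hγ : IsConvex γ) :
    ∃ W : Submodule ℝ (Fin n → ℝ), Module.finrank ℝ W = 2 ∧ IsTransversal W (discriminant γ) ∧
      ((2 * n - 4 : ℕ) : ℕ∞) ≤ (discriminant γ ∩ points W).encard := by
  classical
  obtain ⟨C⟩ := hγ.nonempty_chart (by omega) 0
  obtain ⟨a, ha, ha'⟩ := exists_strictMono_mem_arc 0 n
  -- On `v₁` and `v₂` the form `q 0` vanishes at the common points `a 0, …, a (n - 3)`; each has one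
  -- further zero, at `a (n - 2)` and `a (n - 1)` respectively.
  obtain ⟨v₁, hv₁⟩ := hγ.exists_interpolation (by omega) C ha ha' fun i => if i = n - 1 then 1 else 0
  obtain ⟨v₂, hv₂⟩ := hγ.exists_interpolation (by omega) C ha ha' fun i => if i = n - 2 then 1 else 0
  set k : ℕ → ℝ := fun i => C.q 1 (a i) v₁ * C.q 2 (a i) v₂ - C.q 1 (a i) v₂ * C.q 2 (a i) v₁
    with hk
  -- Up to a positive factor, `k i` is the second derivative of the area at its double zero `a i`.
  -- This choice of `w` gives the perturbed area the opposite sign at `a i` for `δ > 0`.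
  obtain ⟨w, hw⟩ := hγ.exists_interpolation (by omega) C ha ha'
    fun i => if i < n - 2 then k i * C.q 1 (a i) v₁ else 0
  have hv₁0 : ∀ i < n - 1, C.q 0 (a i) v₁ = 0 := fun i hi => by
    rw [hv₁ i (by omega), if_neg (by omega)]
  have hv₁1 : C.q 0 (a (n - 1)) v₁ = 1 := by rw [hv₁ _ (by omega), if_pos rfl]
  have hv₂0 : ∀ i < n - 2, C.q 0 (a i) v₂ = 0 := fun i hi => by
    rw [hv₂ i (by omega), if_neg (by omega)]
  have hv₂1 : C.q 0 (a (n - 2)) v₂ = 1 := by rw [hv₂ _ (by omega), if_pos rfl]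
  have hv₂2 : C.q 0 (a (n - 1)) v₂ = 0 := by rw [hv₂ _ (by omega), if_neg (by omega)]
  have hw0 : ∀ i < n - 2, C.q 0 (a i) w = k i * C.q 1 (a i) v₁ := fun i hi => by
    rw [hw i (by omega), if_pos hi]
  have hw1 : C.q 0 (a (n - 2)) w = 0 := by rw [hw _ (by omega), if_neg (by omega)]
  have hw2 : C.q 0 (a (n - 1)) w = 0 := by rw [hw _ (by omega), if_neg (by omega)]
  have hosc1 : ∀ i < n, ∀ v, v ∈ osculating γ (n - 1) (Circle.exp (a i)) ↔ C.q 0 (a i) v = 0 :=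
    fun i hi v => C.mem_osculating_one (by omega) (ha' i hi)
  have hne₁ : v₁ ≠ 0 := by rintro rfl; simp at hv₁1
  -- nonzero combinations of the two vectors
  have hcomb : ∀ δ x y : ℝ, x • v₁ + y • (v₂ + δ • w) = 0 → (x, y) = 0 := by
    intro δ x y h0
    have h1 := congrArg (C.q 0 (a (n - 1))) h0
    have h2 := congrArg (C.q 0 (a (n - 2))) h0
    simp only [map_add, map_smul, smul_eq_mul, map_zero, hv₁1, hv₂2, hw2, hv₂1, hw1,
      hv₁0 (n - 2) (by omega)] at h1 h2
    rw [Prod.mk_eq_zero]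
    constructor <;> linarith
  have hcomb0 : ∀ x y : ℝ, x • v₁ + y • v₂ = 0 → (x, y) = 0 := fun x y h0 =>
    hcomb 0 x y (by simpa using h0)
  obtain ⟨S, hS, hS'⟩ := exists_exp_finset (θ := 0) ha (k := n - 2) fun i hi => ha' i (by omega)
  obtain ⟨S₁, hS₁, hS₁'⟩ := exists_exp_finset (θ := 0) ha (k := n - 1) fun i hi => ha' i (by omega)
  have hS0 : ∀ x y : ℝ, ∀ z ∈ S, x • v₁ + y • v₂ ∈ osculating γ (n - 1) z := by
    intro x y z hz
    obtain ⟨i, hi, rfl⟩ := (hS' z).1 hz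
    rw [hosc1 i (by omega), map_add, map_smul, map_smul, hv₁0 i (by omega), hv₂0 i hi]
    simp
  have hS₁0 : ∀ z ∈ S₁, v₁ ∈ osculating γ (n - 1) z := by
    intro z hz
    obtain ⟨i, hi, rfl⟩ := (hS₁' z).1 hz
    rw [hosc1 i (by omega), hv₁0 i hi]
  -- With the `n - 2` zeros at `S`, a triple zero or two double zeros would bring the total to at
  -- least `n`, even if they are located in `S`.
  have hsimple : ∀ x y : ℝ, (x, y) ≠ 0 → ∀ z, x • v₁ + y • v₂ ∉ osculating γ (n - 3) z ∧
      ∀ z', z ≠ z' → ¬ (x • v₁ + y • v₂ ∈ osculating γ (n - 2) z ∧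
        x • v₁ + y • v₂ ∈ osculating γ (n - 2) z') := by
    intro x y hxy z
    refine ⟨fun hc => hxy (hcomb0 x y ?_), fun z' hz' hc => hxy (hcomb0 x y ?_)⟩
    · exact hγ.eq_zero_of_zeros (by omega) {z} S (k := 3) hn (by simpa using hc) (hS0 x y)
        (by rw [Finset.card_singleton, hS]; omega)
    · refine hγ.eq_zero_of_zeros (by omega) {z, z'} S (k := 2) (by omega) ?_ (hS0 x y)
        (by rw [Finset.card_pair hz', hS]; omega)
      intro u hu
      rcases Finset.mem_insert.1 hu with rfl | hu
      · exact hc.1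
      · rw [Finset.mem_singleton.1 hu]; exact hc.2
  have hq1 : ∀ i < n - 2, C.q 1 (a i) v₁ ≠ 0 := by
    intro i hi h0
    refine hne₁ (hγ.eq_zero_of_zeros (by omega) {Circle.exp (a i)} S₁ (k := 2) (by omega) ?_ hS₁0
      (by rw [Finset.card_singleton, hS₁]; omega))
    intro u hu
    rw [Finset.mem_singleton.1 hu, C.mem_osculating_two (by omega) (ha' i (by omega))]
    exact ⟨hv₁0 i (by omega), h0⟩
  have hk0 : ∀ i < n - 2, k i ≠ 0 := by
    intro i hi h0
    obtain ⟨x, y, hxy, h1, h2⟩ := exists_kernel h0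
    refine (hsimple x y hxy (Circle.exp (a i))).1 ?_
    rw [C.mem_iff 3 hn _ (ha' i (by omega))]
    intro j hj
    rw [map_add, map_smul, map_smul, smul_eq_mul, smul_eq_mul]
    interval_cases j
    · rw [hv₁0 i (by omega), hv₂0 i hi]; ring
    · exact h1
    · exact h2
  -- the intersection equation
  set d : ℝ → ℝ → ℝ := fun δ t => area (C.pair v₁ (v₂ + δ • w) 0 t) (C.pair v₁ (v₂ + δ • w) 1 t)
    with hd
  have hdc : ∀ δ, ContinuousOn (d δ) (arc 0) := fun δ t ht =>
    (C.hasDerivAt_area v₁ (v₂ + δ • w) ht).continuousAt.continuousWithinAt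
  have hdexp : ∀ δ t, d δ t = d 0 t + δ * (C.q 0 t v₁ * C.q 1 t w - C.q 0 t w * C.q 1 t v₁) := by
    intro δ t
    simp only [hd, C.area_pair, map_add, map_smul, smul_eq_mul]
    ring
  have hdc' : ∀ t, Continuous fun δ => d δ t := fun t => by
    rw [show (fun δ => d δ t) = _ from funext fun δ => hdexp δ t]; fun_prop
  have hdcenter : ∀ δ, ∀ i < n - 2, d δ (a i) = -δ * (k i * C.q 1 (a i) v₁ ^ 2) := by
    intro δ i hi
    simp only [hd, C.area_pair, map_add, map_smul, smul_eq_mul, hv₁0 i (by omega), hv₂0 i hi,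
      hw0 i hi]
    ring
  have hdside : ∀ i < n - 2, ∀ᶠ s in 𝓝[>] (0 : ℝ), 0 < k i * d 0 (a i - s) ∧
      0 < k i * d 0 (a i + s) := by
    intro i hi
    have hai := ha' i (by omega)
    have hβ0 := C.β_pos 0 _ hai
    have hβ1 := C.β_pos 1 _ hai
    have h1 := ((C.hasDerivAt_apply v₁ 0 hai).mul (C.hasDerivAt_apply v₂ 2 hai)).sub
      ((C.hasDerivAt_apply v₂ 0 hai).mul (C.hasDerivAt_apply v₁ 2 hai))
    have h2 := (hasDerivAt_of_contDiffOn (isOpen_arc 0) (C.contDiffOn_β 1) hai).mul h1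
    have h3 := eventually_pos_of_double_zero (f := d 0) (x := a i) ?_ h2 ?_ ?_ ?_
    · filter_upwards [h3] with s hs
      simp only [Pi.mul_apply, Pi.sub_apply, hv₁0 i (by omega), hv₂0 i hi] at hs
      have e : ∀ y : ℝ, (deriv (C.β 1) (a i) * (0 * C.q 2 (a i) v₂ - 0 * C.q 2 (a i) v₁) +
        C.β 1 (a i) * (C.β 0 (a i) * C.q (0 + 1) (a i) v₁ * C.q 2 (a i) v₂ +
          0 * (C.β 2 (a i) * C.q (2 + 1) (a i) v₂) -
          (C.β 0 (a i) * C.q (0 + 1) (a i) v₂ * C.q 2 (a i) v₁ +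
            0 * (C.β 2 (a i) * C.q (2 + 1) (a i) v₁)))) * y
          = (C.β 1 (a i) * C.β 0 (a i)) * (k i * y) := by
        intro y; simp only [hk, zero_add]; ring
      rw [e, e] at hs
      exact ⟨pos_of_mul_pos_right hs.1 (by positivity), pos_of_mul_pos_right hs.2 (by positivity)⟩
    · filter_upwards [(isOpen_arc 0).mem_nhds hai] with t ht
      refine (C.hasDerivAt_area v₁ (v₂ + (0 : ℝ) • w) ht).congr_deriv ?_
      rw [C.area_pair]
      simp
    · have h4 := mul_ne_zero (mul_ne_zero hβ1.ne' hβ0.ne') (hk0 i hi)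
      intro h5
      apply h4
      refine Eq.trans ?_ h5
      simp only [Pi.mul_apply, Pi.sub_apply, hv₁0 i (by omega), hv₂0 i hi, hk, zero_add]
      ring
    · rw [hdcenter 0 i hi]; simp
    · simp [hv₁0 i (by omega), hv₂0 i hi]
  obtain ⟨ε, hε, hεside⟩ : ∃ ε > 0, ∀ i < n - 2, (0 < k i * d 0 (a i - ε) ∧
      0 < k i * d 0 (a i + ε)) ∧ (a i - ε ∈ arc 0 ∧ a i + ε ∈ arc 0) ∧
      ∀ j < n - 2, i < j → a i + ε < a j - ε := by
    have h1 : ∀ i ∈ Finset.range (n - 2), ∀ᶠ s in 𝓝[>] (0 : ℝ), (0 < k i * d 0 (a i - s) ∧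
        0 < k i * d 0 (a i + s)) ∧ (a i - s ∈ arc 0 ∧ a i + s ∈ arc 0) ∧
        ∀ j < n - 2, i < j → a i + s < a j - s := by
      intro i hi
      have hi' := Finset.mem_range.1 hi
      refine (hdside i hi').and (Filter.Eventually.and ?_ ?_)
      · have c1 : ContinuousAt (fun s => a i - s) 0 := by fun_prop
        have c2 : ContinuousAt (fun s => a i + s) 0 := by fun_prop
        have hm := (isOpen_arc 0).mem_nhds (ha' i (by omega))
        exact ((c1.eventually_mem (by simpa using hm)).and
          (c2.eventually_mem (by simpa using hm))).filter_mono nhdsWithin_le_nhds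
      · have h2 : ∀ᶠ s in 𝓝 (0 : ℝ), s < (a (i + 1) - a i) / 2 :=
          eventually_lt_nhds (by have := ha (Nat.lt_succ_self i); simp only [Nat.succ_eq_add_one] at this; linarith)
        filter_upwards [h2.filter_mono nhdsWithin_le_nhds] with s hs j _ hij
        have := ha.monotone (show i + 1 ≤ j from hij)
        linarith
    obtain ⟨s, hs, hs0⟩ := (((Filter.eventually_all_finset _).2 h1).and self_mem_nhdsWithin).exists
    exact ⟨s, hs0, fun i hi => hs i (Finset.mem_range.2 hi)⟩
  -- a small perturbation
  obtain ⟨δ, hδ, hδsimple, hδside⟩ : ∃ δ > 0, (∀ x y : ℝ, (x, y) ≠ 0 → ∀ z,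
      x • v₁ + y • (v₂ + δ • w) ∉ osculating γ (n - 3) z ∧ ∀ z', z ≠ z' →
      ¬ (x • v₁ + y • (v₂ + δ • w) ∈ osculating γ (n - 2) z ∧
        x • v₁ + y • (v₂ + δ • w) ∈ osculating γ (n - 2) z')) ∧
      ∀ i < n - 2, 0 < k i * d δ (a i - ε) ∧ 0 < k i * d δ (a i + ε) := by
    have h1 : ∀ i ∈ Finset.range (n - 2), ∀ᶠ δ in 𝓝 (0 : ℝ), 0 < k i * d δ (a i - ε) ∧
        0 < k i * d δ (a i + ε) := by
      intro i hi
      have h2 := (hεside i (Finset.mem_range.1 hi)).1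
      exact ((continuous_const.mul (hdc' _)).continuousAt.eventually_const_lt h2.1).and
        ((continuous_const.mul (hdc' _)).continuousAt.eventually_const_lt h2.2)
    obtain ⟨δ, ⟨h2, h3⟩, hδ⟩ := ((((hγ.eventually_simple hn (w := w) hsimple).and
      ((Filter.eventually_all_finset _).2 h1)).filter_mono nhdsWithin_le_nhds).and
      (self_mem_nhdsWithin (s := Set.Ioi (0 : ℝ)))).exists
    exact ⟨δ, hδ, h2, fun i hi => h3 i (Finset.mem_range.2 hi)⟩
  set w₂ := v₂ + δ • w with hw₂
  -- All zeros of `v₁` are the `n - 1` points of `S₁`, since one more would force `v₁ = 0`; at each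
  -- of them `q 0` is nonzero on `w₂`, for `a i` with `i < n - 2` thanks to `w`.
  have hcommon : ∀ z, ¬ (v₁ ∈ osculating γ (n - 1) z ∧ w₂ ∈ osculating γ (n - 1) z) := by
    rintro z ⟨h1, h2⟩
    by_cases hz : z ∈ S₁
    · obtain ⟨i, hi, rfl⟩ := (hS₁' z).1 hz
      rw [hosc1 i (by omega), hw₂, map_add, map_smul, smul_eq_mul] at h2
      by_cases hin : i < n - 2
      · rw [hv₂0 i hin, hw0 i hin, zero_add] at h2
        exact mul_ne_zero hδ.ne' (mul_ne_zero (hk0 i hin) (hq1 i hin)) h2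
      · rw [show i = n - 2 by omega, hv₂1, hw1] at h2
        norm_num at h2
    · refine hne₁ (hγ.eq_zero_of_zeros (by omega) ∅ (insert z S₁) (k := 1) (by omega) (by simp) ?_
        (by rw [Finset.card_insert_of_notMem hz, hS₁]; simp; omega))
      intro u hu
      rcases Finset.mem_insert.1 hu with rfl | hu
      exacts [h1, hS₁0 u hu]
  have hli : LinearIndependent ℝ ![v₁, w₂] := LinearIndependent.pair_iff.2 fun x y h0 => by
    simpa using hcomb δ x y h0
  refine ⟨Submodule.span ℝ {v₁, w₂}, ?_, ?_, ?_⟩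
  · have := finrank_span_eq_card hli
    rwa [Matrix.range_cons_cons_empty, Fintype.card_fin] at this
  · intro v hv hvW hvD
    obtain ⟨z, hz⟩ := (mem_discriminant hv).1 hvD
    obtain ⟨x, y, rfl⟩ := Submodule.mem_span_pair.1 hvW
    have hxy : (x, y) ≠ 0 := by
      intro h0
      rw [Prod.mk_eq_zero] at h0
      exact hv (by rw [h0.1, h0.2]; simp)
    obtain ⟨u, hu, huz⟩ : ∃ u ∈ Submodule.span ℝ {v₁, w₂}, u ∉ osculating γ (n - 1) z := by
      by_contra hc
      push Not at hc
      exact hcommon z ⟨hc _ (Submodule.subset_span (by simp)), hc _ (Submodule.subset_span (by simp))⟩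
    exact hγ.isTransversalAt hn hz (hδsimple x y hxy z).1
      (fun z' hz' hc => (hδsimple x y hxy z).2 z' hz'.symm ⟨hz, hc⟩) hu huz
  · -- the zeros
    have hsub : ∀ i < n - 2, Set.Icc (a i - ε) (a i + ε) ⊆ arc 0 := fun i hi =>
      Set.ordConnected_Ioo.out (hεside i hi).2.1.1 (hεside i hi).2.1.2
    have hcneg : ∀ i < n - 2, k i * d δ (a i) < 0 := by
      intro i hi
      rw [hdcenter δ i hi]
      have := hk0 i hi
      have := hq1 i hi
      have : 0 < δ * (k i * k i) * C.q 1 (a i) v₁ ^ 2 := by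
        have := mul_self_pos.2 (hk0 i hi)
        positivity
      linarith
    have hmulneg : ∀ i < n - 2, ∀ x y : ℝ, 0 < k i * x → k i * y < 0 → x * y < 0 := by
      intro i hi x y hx hy
      have h1 := mul_neg_of_pos_of_neg hx hy
      have h2 : k i * x * (k i * y) = (k i * k i) * (x * y) := by ring
      rw [h2] at h1
      exact neg_of_mul_neg_right h1 (mul_self_nonneg _)
    -- The perturbed area has the sign of `k i` at `a i ± ε` and the opposite sign at `a i`, so
    -- there is a zero on either side of `a i`; the Boolean selects the side.
    have hzero : ∀ p : Fin (n - 2) × Bool, ∃ t, t ∈ Set.Ioo (a p.1 - ε) (a p.1 + ε) ∧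
        (if p.2 then a p.1 < t else t < a p.1) ∧ d δ t = 0 := by
      rintro ⟨⟨i, hi⟩, b⟩
      have hs := hδside i hi
      have hc := hcneg i hi
      cases b
      · obtain ⟨t, ht, ht0⟩ := exists_zero_of_mul_neg (d := d δ) (show a i - ε < a i by linarith)
          ((hdc δ).mono ((Set.Icc_subset_Icc le_rfl (by linarith)).trans (hsub i hi)))
          (hmulneg i hi _ _ hs.1 hc)
        exact ⟨t, ⟨ht.1, by dsimp only; linarith [ht.2]⟩, by simpa using ht.2, ht0⟩
      · obtain ⟨t, ht, ht0⟩ := exists_zero_of_mul_neg (d := d δ) (show a i < a i + ε by linarith)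
          ((hdc δ).mono ((Set.Icc_subset_Icc (by linarith) le_rfl).trans (hsub i hi)))
          (by rw [mul_comm]; exact hmulneg i hi _ _ hs.2 hc)
        exact ⟨t, ⟨by dsimp only; linarith [ht.1], ht.2⟩, by simpa using ht.1, ht0⟩
    choose t ht htside ht0 using hzero
    have htarc : ∀ p, t p ∈ arc 0 := fun p => hsub p.1 p.1.2 ⟨(ht p).1.le, (ht p).2.le⟩
    have htinj : Function.Injective t := by
      have hlt : ∀ p q : Fin (n - 2) × Bool, p.1 < q.1 → t p < t q := fun p q hpq =>
        ((ht p).2.trans ((hεside p.1 p.1.2).2.2 q.1 q.1.2 hpq)).trans (ht q).1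
      intro p q hpq
      have h1 : p.1 = q.1 := by
        rcases lt_trichotomy p.1 q.1 with h | h | h
        · exact absurd hpq (hlt p q h).ne
        · exact h
        · exact absurd hpq (hlt q p h).ne'
      have h2 : p.2 = q.2 := by
        have hp := htside p
        have hq := htside q
        rw [hpq, h1] at hp
        by_contra hne
        cases hp2 : p.2 <;> cases hq2 : q.2 <;> simp [hp2, hq2] at hp hq hne <;> linarith
      exact Prod.ext h1 h2
    have hex : ∀ p, ∃ x y : ℝ, (x, y) ≠ 0 ∧
        x • v₁ + y • w₂ ∈ osculating γ (n - 2) (Circle.exp (t p)) := by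
      intro p
      have h0 := ht0 p
      simp only [hd] at h0
      rw [C.area_pair] at h0
      obtain ⟨x, y, hxy, h1, h2⟩ := exists_kernel (p := C.q 0 (t p) v₁) (q := C.q 0 (t p) w₂)
        (r := C.q 1 (t p) v₁) (s := C.q 1 (t p) w₂) h0
      refine ⟨x, y, hxy, (C.mem_osculating_two (by omega) (htarc p)).2 ⟨?_, ?_⟩⟩
      · simpa using h1
      · simpa using h2
    choose x y hxy hmem using hex
    have hne : ∀ p, x p • v₁ + y p • w₂ ≠ 0 := fun p h0 => hxy p (hcomb δ _ _ h0)
    let f : Fin (n - 2) × Bool → RP n := fun p => Projectivization.mk ℝ _ (hne p)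
    have hf : Function.Injective f := by
      intro p q hpq
      by_contra hne'
      obtain ⟨c, hc⟩ := (Projectivization.mk_eq_mk_iff' ℝ _ _ _ _).1 hpq
      refine (hδsimple (x p) (y p) (hxy p) (Circle.exp (t p))).2 (Circle.exp (t q))
        (fun h => hne' (htinj (exp_injOn_arc 0 (htarc p) (htarc q) h))) ⟨hmem p, ?_⟩
      rw [← hc]
      exact Submodule.smul_mem _ _ (hmem q)
    have hrange : Set.range f ⊆ discriminant γ ∩ points (Submodule.span ℝ {v₁, w₂}) := by
      rintro _ ⟨p, rfl⟩
      refine ⟨(mem_discriminant (hne p)).2 ⟨_, hmem p⟩, ?_⟩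
      change (Projectivization.mk ℝ _ (hne p)).submodule ≤ _
      rw [Projectivization.submodule_mk, Submodule.span_singleton_le_iff_mem]
      exact Submodule.mem_span_pair.2 ⟨_, _, rfl⟩
    refine le_trans ?_ (Set.encard_le_encard hrange)
    refine le_trans ?_ hf.encard_range
    rw [ENat.card_eq_coe_fintype_card]
    simp only [Fintype.card_prod, Fintype.card_fin, Fintype.card_bool]
    exact_mod_cast (show 2 * n - 4 ≤ (n - 2) * 2 by omega)

end

end ProjCurve

theorem corollary3 (n : ℕ) (hn : 2 ≤ n) (γ : Circle → ProjCurve.RP n)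
    (hγ : ProjCurve.IsConvex γ) :
    ProjCurve.realDegree (ProjCurve.discriminant γ) = ((2 * n - 4 : ℕ) : ℕ∞) := by
  rcases hn.eq_or_lt with rfl | hn3
  -- For `n = 2` the osculating spaces of codimension two are zero and contain no projective point;
  -- `2 * 2 - 4 = 0`.
  · have hempty : ProjCurve.discriminant γ = ∅ := by
      refine Set.eq_empty_of_forall_notMem fun p => ?_
      rintro ⟨z, hz⟩
      have h0 := hγ.finrank_osculating (by norm_num) (Nat.zero_le 2) z
      rw [Submodule.finrank_eq_zero] at h0
      rw [Nat.sub_self, h0, le_bot_iff] at hz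
      have h1 := p.finrank_submodule
      rw [hz, finrank_bot] at h1
      exact zero_ne_one h1
    simp [ProjCurve.realDegree, hempty]
  · refine le_antisymm ?_ ?_
    · exact iSup_le fun W => iSup_le fun hW => iSup_le fun htr => hγ.encard_le hn3 hW htr
    · obtain ⟨W, hW, htr, hcard⟩ := hγ.exists_transversal hn3
      exact hcard.trans (le_iSup_of_le W (le_iSup_of_le hW (le_iSup_of_le htr le_rfl)))
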